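/- **Coefficients.** For $n\in\mathbb Z$ put $\{n\}=\frac{q^{2n}-1}{q^2-1}$. For $x\in\mathbb Q$ with continued fraction expansion $[a_1,\dots,a_{2m}]$ of even length ($a_1\in\mathbb Z$, $a_i\ge 1$ for $i\ge2$), let $$\{x\}=\{a_1\}+\cfrac{q^{2a_1}}{\{a_2\}_{q^{-2}}+\cfrac{q^{-2a_2}}{\{a_3\}+\cfrac{q^{2a_3}}{\ddots+\cfrac{q^{2a_{2m-1}}}{\{a_{2m}\}_{q^{-2}}}}}}\in\mathbb Q(q),\qquad \{a\}_{q^{-2}}=\frac{q^{-2a}-1}{q^{-2}-1},$$ $\binom{x}{k}_q=\frac{\{x\}\{x-1\}\cdots\{x-k+1\}}{\{k\}\cdots\{1\}}$ and $\delta_x=\{x\}-\{x-1\}$. Let $K$ be a commutative $\mathbb Q(q)$-algebra with an element $\nu_x$ such that $\nu_x^2=\delta_x^{-1}$ (for instance $K=\mathbb Q(q)[\nu_x]$). **Webs.** Objects are finite words of upward and downward arrows with labels in $\mathbb N^*$. Webs are oriented planar trivalent graphs with cups and caps, generated by the merge vertices $\uparrow_k\uparrow_l\to\uparrow_{k+l}$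 and the split vertices $\uparrow_{k+l}\to\uparrow_k\uparrow_l$; edges labelled $0$ are erased, and webs with a negative label are zero. For a commutative ring $R$ with a unit $q$ such that $q^2-1$ is a unit, consider $R$-linear braided strict monoidal categories generated by webs, taken up to isotopy (straightening of cups and caps; rotation of vertices), subject to * the *upward relations*: associativity of merges and of splits; digon removal: a split $\uparrow_{k+l}\to\uparrow_k\uparrow_l$ followed by the merge is $q^{-kl}\binom{k+l}{k}_q$ times the identity; on uprights $k,l$, (a $1$-rung to the right, then a $1$-rung to the left) $-$ (a $1$-rung to the left, then a $1$-rung to the right) $=q^{1-k+l}\{k-l\}\,\mathrm{id}$; and, on three uprights, with $E_i^{(b)}$ (resp. $F_i^{(b)}$) the rung moving $b$ from upright $i+1$ to upright $i$ (resp. from $i$ to $i+1$), $E_i^{(2)}E_j-E_iE_jE_i+E_jE_i^{(2)}=0$ and $F_i^{(2)}F_j-F_iF_jF_i+F_jF_i^{(2)}=0$ for $\{i,j\}=\{1,2\}$; * the braiding of $\uparrow_k$ over $\uparrow_l$ is $(-q)^{kl}\sum_{b-a=k-l}(-q)^{b-k}$ times ($b$-rung to the right, then $a$-rung to the left), and the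 crossing $\uparrow_k\uparrow_l\to\uparrow_l\uparrow_k$ with $\uparrow_l$ over is $(-q)^{-kl}\sum_{b-a=l-k}(-q)^{l-b}$ times ($b$-rung to the left, then $a$-rung to the right). The universal web category $\infty\mathbf{Web}$ is the category so generated over $\mathbb Z[q^{\pm1},a^{\pm1}][(q-q^{-1})^{-1}]$ with the additional relations: both $1$-labelled circles equal $\frac{a-a^{-1}}{q-q^{-1}}$; a $1$-labelled upward strand with a $1$-labelled loop attached on its right, or on its left (through a $2$-labelled edge), equals $\frac{aq^{-1}-a^{-1}q}{q-q^{-1}}\,\mathrm{id}$; the mixed square on $\uparrow_1\downarrow_1$ (two horizontal oppositely oriented $2$-labelled edges joined by $1$-labelled edges) equals $\mathrm{id}+\frac{aq^{-2}-a^{-1}q^2}{q-q^{-1}}\,(\text{cap followed by cup})$, together with its mirror image on $\downarrow_1\uparrow_1$. The category $x\mathbf{Web}$ is the $K$-linear category obtained from $\infty\mathbf{Web}$ by extension of scalars along $q\mapsto q$, $a\mapsto q\nu_x\delta_x$. **Proposition.** The category $x\mathbf{Web}$ is the braided $K$-linear category whose objects are the words of upward and downward arrows with labels in $\mathbb N^*$,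 whose morphisms are generated by webs up to isotopy, whose braiding is given by the formulas above, with the following relations: * the upward relations, which do not depend on $x$; * circle evaluation: both $k$-labelled circles equal $u_k:=q^{k(k-1)}\nu_x^k\binom{x}{k}_q$; * sideway digon removal: a $k$-labelled upward strand with an $l$-labelled loop attached on its right, or on its left (through a $(k+l)$-labelled edge), equals $q^{-kl}\binom{k+l}{k}_q\frac{u_{k+l}}{u_k}$ times the identity, where $\frac{u_{k+l}}{u_k}$ stands for $q^{l(2k+l-1)}\nu_x^l\prod_{j=0}^{l-1}\frac{\{x-k-j\}}{\{k+j+1\}}$ (also when $u_k=0$); * mixed square removal: the mixed square on $\uparrow_1\downarrow_1$ equals $\mathrm{id}+q^2\nu_x\{x-2\}\,(\text{cap followed by cup})$, together with its mirror image. That is, there is an isomorphism of $K$-linear braided monoidal categories between $x\mathbf{Web}$ and the category with this presentation which is the identity on objects and sends merges, splits, cups, caps and the braiding to themselves; and every morphism is a linear combination of webs without crossings. -/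

import Mathlib

open CategoryTheory MonoidalCategory TensorProduct

noncomputable section

namespace Web

universe u v w

/-! ### Boundary words -/

/-- An upward (`up = true`) or downward arrow labelled by a positive integer. -/
structure Arrow where
  up : Bool
  label : ℕ+

/-- A sequence of labelled upward and downward arrows on a horizontal line. -/
abbrev Word := List Arrow

/-- The upward arrow labelled `k`; an arrow labelled `0` is erased. -/
def up : ℕ → Word
  | 0 => []
  | n + 1 => [⟨true, n.succPNat⟩]

/-- The downward arrow labelled `k`; an arrow labelled `0` is erased. -/
def dn : ℕ → Word
  | 0 => []
  | n + 1 => [⟨false, n.succPNat⟩]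

/-! ### Formal diagrams

Expressions for morphisms from the bottom word to the top word, built from identities (of equal
words), vertical and horizontal composition, linear combinations, crossings, trivalent vertices,
cups and caps. `comp f g` puts `g` on top of `f`. -/

inductive Diag (R : Type u) : Word → Word → Type u
  | eqHom {X Y : Word} (h : X = Y) : Diag R X Y
  | comp {X Y Z : Word} (f : Diag R X Y) (g : Diag R Y Z) : Diag R X Z
  | tensor {X Y X' Y' : Word} (f : Diag R X Y) (g : Diag R X' Y') : Diag R (X ++ X') (Y ++ Y')
  | zero {X Y : Word} : Diag R X Y
  | add {X Y : Word} (f g : Diag R X Y) : Diag R X Y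
  | smul {X Y : Word} (r : R) (f : Diag R X Y) : Diag R X Y
  /-- the strands of `X` pass over those of `Y` -/
  | braid (X Y : Word) : Diag R (X ++ Y) (Y ++ X)
  | braidInv (X Y : Word) : Diag R (Y ++ X) (X ++ Y)
  | merge (k l : ℕ) : Diag R (up k ++ up l) (up (k + l))
  | split (k l : ℕ) : Diag R (up (k + l)) (up k ++ up l)
  /-- `∅ ⟶ ↑ ↓` -/
  | cupR (k : ℕ) : Diag R [] (up k ++ dn k)
  /-- `↓ ↑ ⟶ ∅` -/
  | capR (k : ℕ) : Diag R (dn k ++ up k) []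
  /-- `∅ ⟶ ↓ ↑` -/
  | cupL (k : ℕ) : Diag R [] (dn k ++ up k)
  /-- `↑ ↓ ⟶ ∅` -/
  | capL (k : ℕ) : Diag R (up k ++ dn k) []

namespace Diag

variable {R : Type u}

/-- The identity diagram. -/
def idd (X : Word) : Diag R X X := eqHom rfl

/-- Vertical composition where the middle words agree up to re-bracketing. -/
def seq {X Y Y' Z : Word} (f : Diag R X Y) (g : Diag R Y' Z)
    (h : Y = Y' := by simp [up, dn]) : Diag R X Z :=
  comp f (comp (eqHom h) g)

/-- Change the bottom and top words of a diagram along equalities. -/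
def cast {X Y X' Y' : Word} (f : Diag R X Y)
    (hX : X' = X := by simp [up, dn]) (hY : Y = Y' := by simp [up, dn]) : Diag R X' Y' :=
  comp (eqHom hX) (comp f (eqHom hY))

/-- The diagram `f` with vertical strands `A` to its left and `B` to its right. -/
def whisk (A : Word) {X Y : Word} (f : Diag R X Y) (B : Word) :
    Diag R (A ++ X ++ B) (A ++ Y ++ B) :=
  tensor (tensor (idd A) f) (idd B)

/-- `f 0 + ⋯ + f (n - 1)`. -/
def sum {X Y : Word} : ℕ → (ℕ → Diag R X Y) → Diag R X Y
  | 0, _ => zero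
  | n + 1, f => add (sum n f) (f n)

/-- The diagram is a linear combination of webs: it involves no crossings. -/
def IsWeb : ∀ {X Y : Word}, Diag R X Y → Prop
  | _, _, comp f g => f.IsWeb ∧ g.IsWeb
  | _, _, tensor f g => f.IsWeb ∧ g.IsWeb
  | _, _, add f g => f.IsWeb ∧ g.IsWeb
  | _, _, smul _ f => f.IsWeb
  | _, _, braid _ _ => False
  | _, _, braidInv _ _ => False
  | _, _, _ => True

/-! #### Rotations of the trivalent vertices -/

/-- The vertex `f : ↑k ↑l ⟶ ↑m` rotated by half a turn, one way. -/
def mergeRotR {k l m : ℕ} (f : Diag R (up k ++ up l) (up m)) : Diag R (dn m) (dn l ++ dn k) :=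
  cast <|
    ((whisk (dn m) (cupR k) []).seq (whisk (dn m ++ up k) (cupR l) (dn k))).seq
      ((whisk (dn m) f (dn l ++ dn k)).seq (whisk [] (capR m) (dn l ++ dn k)))

/-- The vertex `f : ↑k ↑l ⟶ ↑m` rotated by half a turn, the other way. -/
def mergeRotL {k l m : ℕ} (f : Diag R (up k ++ up l) (up m)) : Diag R (dn m) (dn l ++ dn k) :=
  cast <|
    ((whisk [] (cupL l) (dn m)).seq (whisk (dn l) (cupL k) (up l ++ dn m))).seq
      ((whisk (dn l ++ dn k) f (dn m)).seq (whisk (dn l ++ dn k) (capL m) []))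

/-- The vertex `f : ↑m ⟶ ↑k ↑l` rotated by half a turn, one way. -/
def splitRotR {k l m : ℕ} (f : Diag R (up m) (up k ++ up l)) : Diag R (dn l ++ dn k) (dn m) :=
  cast <|
    ((whisk (dn l ++ dn k) (cupR m) []).seq (whisk (dn l ++ dn k) f (dn m))).seq
      ((whisk (dn l) (capR k) (up l ++ dn m)).seq (whisk [] (capR l) (dn m)))

/-- The vertex `f : ↑m ⟶ ↑k ↑l` rotated by half a turn, the other way. -/
def splitRotL {k l m : ℕ} (f : Diag R (up m) (up k ++ up l)) : Diag R (dn l ++ dn k) (dn m) :=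
  cast <|
    ((whisk [] (cupL m) (dn l ++ dn k)).seq (whisk (dn m) f (dn l ++ dn k))).seq
      ((whisk (dn m ++ up k) (capL l) (dn k)).seq (whisk (dn m) (capL k) []))

/-! #### Ladders

A rung with a prescribed top row; it is zero unless the top row is the one that results from
moving `b`, in particular if a label would become negative. -/

/-- From `↑k ↑l` to `↑k' ↑l'`, a rung moves `b` from the right upright to the left one. -/
def rungL (b k l k' l' : ℕ) : Diag R (up k ++ up l) (up k' ++ up l') :=
  if h : k' = k + b ∧ l = b + l' then
    (tensor (idd (up k)) (comp (eqHom (congrArg up h.2)) (split b l'))).seq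
      (tensor (comp (merge k b) (eqHom (congrArg up h.1.symm))) (idd (up l')))
  else zero

/-- From `↑k ↑l` to `↑k' ↑l'`, a rung moves `b` from the left upright to the right one. -/
def rungR (b k l k' l' : ℕ) : Diag R (up k ++ up l) (up k' ++ up l') :=
  if h : k = k' + b ∧ l' = b + l then
    (tensor (comp (eqHom (congrArg up h.1)) (split k' b)) (idd (up l))).seq
      (tensor (idd (up k')) (comp (merge b l) (eqHom (congrArg up h.2.symm))))
  else zero

/-- Three upright strands. -/
abbrev up3 (k l r : ℕ) : Word := up k ++ up l ++ up r

/-- A rung from the second upright to the first of three. -/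
def rungL12 (b k l r k' l' : ℕ) : Diag R (up3 k l r) (up3 k' l' r) :=
  tensor (rungL b k l k' l') (idd (up r))

/-- A rung from the third upright to the second of three. -/
def rungL23 (b k l r l' r' : ℕ) : Diag R (up3 k l r) (up3 k l' r') :=
  cast (tensor (idd (up k)) (rungL b l r l' r'))

/-- A rung from the first upright to the second of three. -/
def rungR12 (b k l r k' l' : ℕ) : Diag R (up3 k l r) (up3 k' l' r) :=
  tensor (rungR b k l k' l') (idd (up r))

/-- A rung from the second upright to the third of three. -/
def rungR23 (b k l r l' r' : ℕ) : Diag R (up3 k l r) (up3 k l' r') :=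
  cast (tensor (idd (up k)) (rungR b l r l' r'))

/-! #### Closed diagrams and mixed diagrams -/

/-- The clockwise circle labelled `k`. -/
def circleR (k : ℕ) : Diag R [] [] := comp (cupR k) (capL k)

/-- The counterclockwise circle labelled `k`. -/
def circleL (k : ℕ) : Diag R [] [] := comp (cupL k) (capR k)

/-- An upward strand labelled `k` to which a loop labelled `l` is attached on the right. -/
def digonR (k l : ℕ) : Diag R (up k) (up k) :=
  cast <|
    ((whisk (up k) (cupR l) []).seq (whisk [] (merge k l) (dn l))).seq
      ((whisk [] (split k l) (dn l)).seq (whisk (up k) (capL l) []))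

/-- An upward strand labelled `k` to which a loop labelled `l` is attached on the left. -/
def digonL (k l : ℕ) : Diag R (up k) (up k) :=
  cast <|
    ((whisk [] (cupL l) (up k)).seq (whisk (dn l) (merge l k) [])).seq
      ((whisk (dn l) (split l k) []).seq (whisk [] (capR l) (up k)))

/-- Two `1`-labelled strands merged and split again. -/
def dumbbell : Diag R (up 1 ++ up 1) (up 1 ++ up 1) := comp (merge 1 1) (split 1 1)

/-- The dumbbell turned on its side, its `2`-labelled edge pointing to the right. -/
def sideR : Diag R (up 1 ++ dn 1) (dn 1 ++ up 1) :=
  cast <|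
    (whisk [] (cupL 1) (up 1 ++ dn 1)).seq
      ((whisk (dn 1) dumbbell (dn 1)).seq (whisk (dn 1 ++ up 1) (capL 1) []))

/-- The dumbbell turned on its side, its `2`-labelled edge pointing to the left. -/
def sideL : Diag R (dn 1 ++ up 1) (up 1 ++ dn 1) :=
  cast <|
    (whisk (dn 1 ++ up 1) (cupR 1) []).seq
      ((whisk (dn 1) dumbbell (dn 1)).seq (whisk [] (capR 1) (up 1 ++ dn 1)))

end Diag

open Diag

/-! ### Coefficients -/

section Coefficients

variable {R : Type u} [CommRing R]

/-- `{m} = (q ^ (2m) - 1) / (q ^ 2 - 1)` for an integer `m`; used where `q ^ 2 - 1` is a unit. -/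
def qInt (q : Rˣ) (m : ℤ) : R := (((q ^ (2 * m) : Rˣ) : R) - 1) * Ring.inverse ((q : R) ^ 2 - 1)

/-- The `q`-binomial coefficient `{n choose k}` for natural numbers, a polynomial in `q ^ 2`,
through the `q`-Pascal rule. -/
def qBinom (q : Rˣ) : ℕ → ℕ → R
  | _, 0 => 1
  | 0, _ + 1 => 0
  | n + 1, k + 1 => qBinom q n k + (q : R) ^ (2 * (k + 1)) * qBinom q n (k + 1)

/-- `{1} {2} ⋯ {n}`. -/
def qFact (q : Rˣ) (n : ℕ) : R := ∏ j ∈ Finset.range n, qInt q (j + 1)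

theorem qInt_add (q : Rˣ) (m n : ℤ) :
    qInt q (m + n) = qInt q m + ((q ^ (2 * m) : Rˣ) : R) * qInt q n := by
  simp only [qInt, mul_add, zpow_add, Units.val_mul]
  ring

theorem qBinom_eq_zero (q : Rˣ) : ∀ n k : ℕ, n < k → qBinom q n k = 0
  | _, 0, h => absurd h (Nat.not_lt_zero _)
  | 0, _ + 1, _ => by rw [qBinom]
  | n + 1, k + 1, h => by
      rw [qBinom, qBinom_eq_zero q n k (by omega), qBinom_eq_zero q n (k + 1) (by omega)]
      simp

theorem qBinom_mul_qFact (q : Rˣ) :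
    ∀ k l : ℕ, qBinom q (k + l) k * qFact q k * qFact q l = qFact q (k + l)
  | 0, l => by simp [qBinom, qFact]
  | k + 1, 0 => by
      have h := qBinom_mul_qFact q k 0
      simp only [Nat.add_zero] at h ⊢
      rw [qBinom, qBinom_eq_zero q k (k + 1) (by omega), qFact, Finset.prod_range_succ, ← qFact]
      simp only [qFact, Finset.prod_range_zero, mul_one, mul_zero, add_zero] at h ⊢
      rw [← mul_assoc, h]
  | k + 1, l + 1 => by
      have h₁ := qBinom_mul_qFact q k (l + 1)
      have h₂ := qBinom_mul_qFact q (k + 1) l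
      have e : k + 1 + l = k + (l + 1) := by omega
      have e' : k + 1 + (l + 1) = (k + (l + 1)) + 1 := by omega
      have s : ∀ n : ℕ, qFact q (n + 1) = qFact q n * qInt q (n + 1) := fun n => by
        rw [qFact, Finset.prod_range_succ, ← qFact]
      rw [e] at h₂
      rw [e', qBinom, s (k + (l + 1)), s k, s l]
      rw [s l] at h₁
      rw [s k] at h₂
      have a := qInt_add q ((k : ℤ) + 1) ((l : ℤ) + 1)
      have c : ((k + (l + 1) : ℕ) : ℤ) + 1 = ((k : ℤ) + 1) + ((l : ℤ) + 1) := by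
        push_cast; ring
      have p : ((q ^ (2 * ((k : ℤ) + 1)) : Rˣ) : R) = (q : R) ^ (2 * (k + 1)) := by
        have : (2 * ((k : ℤ) + 1)) = ((2 * (k + 1) : ℕ) : ℤ) := by push_cast; ring
        rw [this, zpow_natCast, Units.val_pow_eq_pow_val]
      rw [c, a, p]
      linear_combination (qInt q ((k : ℤ) + 1)) * h₁ +
        ((q : R) ^ (2 * (k + 1)) * qInt q ((l : ℤ) + 1)) * h₂

/-- `(a q ^ (-r) - a⁻¹ q ^ r) / (q - q⁻¹)`; used where `q - q⁻¹` is a unit. -/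
def aInt (q a : Rˣ) (r : ℤ) : R :=
  (((a * q ^ (-r) : Rˣ) : R) - ((a⁻¹ * q ^ r : Rˣ) : R)) *
    Ring.inverse ((q : R) - ((q⁻¹ : Rˣ) : R))

end Coefficients

/-! ### Relations -/

/-- The crossing `↑k ↑l ⟶ ↑l ↑k` in which the strand from the bottom left passes over: the sum of
`(-q) ^ (k l) (-q) ^ (b - k)` times a rung moving `b` to the right followed by a rung moving `a` to
the left, over all `a, b ≥ 0` with `b - a = k - l`. Only `b ≤ k` contributes, and the summands
with `b + l < k` are zero. -/
def crossingSum {R : Type u} [CommRing R] (q : Rˣ) (k l : ℕ) :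
    Diag R (up k ++ up l) (up l ++ up k) :=
  smul (((-q) ^ (k * l) : Rˣ) : R)
    (sum (k + 1) fun b => smul (((-q) ^ ((b : ℤ) - k) : Rˣ) : R)
      (comp (rungR b k l (k - b) (l + b)) (rungL (b + l - k) (k - b) (l + b) l k)))

/-- The crossing `↑k ↑l ⟶ ↑l ↑k` in which the strand from the bottom right passes over: the sum of
`(-q) ^ (-k l) (-q) ^ (l - b)` times a rung moving `b` to the left followed by a rung moving `a` to
the right, over all `a, b ≥ 0` with `b - a = l - k`. Only `b ≤ l` contributes, and the summands
with `b + k < l` are zero. -/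
def crossingInvSum {R : Type u} [CommRing R] (q : Rˣ) (k l : ℕ) :
    Diag R (up k ++ up l) (up l ++ up k) :=
  smul (((-q) ^ (-((k : ℤ) * l)) : Rˣ) : R)
    (sum (l + 1) fun b => smul (((-q) ^ ((l : ℤ) - b) : Rˣ) : R)
      (comp (rungL b k l (k + b) (l - b)) (rungR (b + k - l) (k + b) (l - b) l k)))

/-- A family of relations between diagrams. -/
abbrev Relations (R : Type u) := ∀ X Y : Word, Diag R X Y → Diag R X Y → Prop

/-- Relations common to all web categories: erasure of edges labelled `0`, planar isotopy,
the relations between upward webs, and the formulas for the upward crossings. -/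
inductive BasicRel {R : Type u} [CommRing R] (q : Rˣ) : Relations R
  -- edges labelled `0` are erased
  | merge_zero_left (l : ℕ) :
      BasicRel q _ _ (merge 0 l) (eqHom (by simp [up]))
  | merge_zero_right (k : ℕ) :
      BasicRel q _ _ (merge k 0) (eqHom (by simp [up]))
  | split_zero_left (l : ℕ) :
      BasicRel q _ _ (split 0 l) (eqHom (by simp [up]))
  | split_zero_right (k : ℕ) :
      BasicRel q _ _ (split k 0) (eqHom (by simp [up]))
  | cupR_zero : BasicRel q _ _ (cupR 0) (idd [])
  | capR_zero : BasicRel q _ _ (capR 0) (idd [])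
  | cupL_zero : BasicRel q _ _ (cupL 0) (idd [])
  | capL_zero : BasicRel q _ _ (capL 0) (idd [])
  -- straightening of cups and caps
  | zigzag_up_R (k : ℕ) : BasicRel q _ _
      (cast ((whisk [] (cupR k) (up k)).seq (whisk (up k) (capR k) []))) (idd (up k))
  | zigzag_dn_R (k : ℕ) : BasicRel q _ _
      (cast ((whisk (dn k) (cupR k) []).seq (whisk [] (capR k) (dn k)))) (idd (dn k))
  | zigzag_up_L (k : ℕ) : BasicRel q _ _
      (cast ((whisk (up k) (cupL k) []).seq (whisk [] (capL k) (up k)))) (idd (up k))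
  | zigzag_dn_L (k : ℕ) : BasicRel q _ _
      (cast ((whisk [] (cupL k) (dn k)).seq (whisk (dn k) (capL k) []))) (idd (dn k))
  -- rotation of vertices
  | merge_rot (k l : ℕ) : BasicRel q _ _ (mergeRotR (merge k l)) (mergeRotL (merge k l))
  | split_rot (k l : ℕ) : BasicRel q _ _ (splitRotR (split k l)) (splitRotL (split k l))
  -- associativity of vertices
  | merge_assoc (k l r : ℕ) : BasicRel q _ _
      ((tensor (merge k l) (idd (up r))).seq (merge (k + l) r))
      (cast ((tensor (idd (up k)) (merge l r)).seq (merge k (l + r)))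
        (by simp) (by rw [Nat.add_assoc]))
  | split_assoc (k l r : ℕ) : BasicRel q _ _
      ((split (k + l) r).seq (tensor (split k l) (idd (up r))))
      (cast ((split k (l + r)).seq (tensor (idd (up k)) (split l r)))
        (by rw [Nat.add_assoc]) (by simp))
  -- digon removal
  | digon (k l : ℕ) : BasicRel q _ _
      (comp (split k l) (merge k l))
      (smul (((q ^ (-((k : ℤ) * l)) : Rˣ) : R) * qBinom q (k + l) k) (idd (up (k + l))))
  -- square switch
  | square_switch (k l : ℕ) : BasicRel q _ _
      (add (comp (rungR 1 k l (k - 1) (l + 1)) (rungL 1 (k - 1) (l + 1) k l))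
        (smul (-1) (comp (rungL 1 k l (k + 1) (l - 1)) (rungR 1 (k + 1) (l - 1) k l))))
      (smul (((q ^ (1 - (k : ℤ) + l) : Rˣ) : R) * qInt q ((k : ℤ) - l)) (idd (up k ++ up l)))
  -- the four cubic relations
  | serre₁ (k l r : ℕ) : BasicRel q _ _
      (add
        (comp (rungL23 1 k l r (l + 1) (r - 1)) (rungL12 2 k (l + 1) (r - 1) (k + 2) (l - 1)))
        (add
          (smul (-1) (comp (rungL12 1 k l r (k + 1) (l - 1))
            (comp (rungL23 1 (k + 1) (l - 1) r l (r - 1))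
              (rungL12 1 (k + 1) l (r - 1) (k + 2) (l - 1)))))
          (comp (rungL12 2 k l r (k + 2) (l - 2))
            (rungL23 1 (k + 2) (l - 2) r (l - 1) (r - 1)))))
      zero
  | serre₂ (k l r : ℕ) : BasicRel q _ _
      (add
        (comp (rungL12 1 k l r (k + 1) (l - 1)) (rungL23 2 (k + 1) (l - 1) r (l + 1) (r - 2)))
        (add
          (smul (-1) (comp (rungL23 1 k l r (l + 1) (r - 1))
            (comp (rungL12 1 k (l + 1) (r - 1) (k + 1) l)
              (rungL23 1 (k + 1) l (r - 1) (l + 1) (r - 2)))))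
          (comp (rungL23 2 k l r (l + 2) (r - 2))
            (rungL12 1 k (l + 2) (r - 2) (k + 1) (l + 1)))))
      zero
  | serre₃ (k l r : ℕ) : BasicRel q _ _
      (add
        (comp (rungR23 1 k l r (l - 1) (r + 1)) (rungR12 2 k (l - 1) (r + 1) (k - 2) (l + 1)))
        (add
          (smul (-1) (comp (rungR12 1 k l r (k - 1) (l + 1))
            (comp (rungR23 1 (k - 1) (l + 1) r l (r + 1))
              (rungR12 1 (k - 1) l (r + 1) (k - 2) (l + 1)))))
          (comp (rungR12 2 k l r (k - 2) (l + 2))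
            (rungR23 1 (k - 2) (l + 2) r (l + 1) (r + 1)))))
      zero
  | serre₄ (k l r : ℕ) : BasicRel q _ _
      (add
        (comp (rungR12 1 k l r (k - 1) (l + 1)) (rungR23 2 (k - 1) (l + 1) r (l - 1) (r + 2)))
        (add
          (smul (-1) (comp (rungR23 1 k l r (l - 1) (r + 1))
            (comp (rungR12 1 k (l - 1) (r + 1) (k - 1) l)
              (rungR23 1 (k - 1) l (r + 1) (l - 1) (r + 2)))))
          (comp (rungR23 2 k l r (l - 2) (r + 2))
            (rungR12 1 k (l - 2) (r + 2) (k - 1) (l - 1)))))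
      zero
  -- the crossings of upward strands
  | crossing (k l : ℕ) : BasicRel q _ _
      (braid (up k) (up l)) (crossingSum q k l)
  | crossing_inv (k l : ℕ) : BasicRel q _ _
      (braidInv (up l) (up k)) (crossingInvSum q k l)

/-- The additional relations of the universal web category. -/
inductive UniversalRel {R : Type u} [CommRing R] (q a : Rˣ) : Relations R
  | circleR : UniversalRel q a _ _ (circleR 1) (smul (aInt q a 0) (idd []))
  | circleL : UniversalRel q a _ _ (circleL 1) (smul (aInt q a 0) (idd []))
  | digonR : UniversalRel q a _ _ (digonR 1 1) (smul (aInt q a 1) (idd (up 1)))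
  | digonL : UniversalRel q a _ _ (digonL 1 1) (smul (aInt q a 1) (idd (up 1)))
  | square : UniversalRel q a _ _ (comp sideR sideL)
      (add (idd (up 1 ++ dn 1)) (smul (aInt q a 2) (comp (capL 1) (cupR 1))))
  | square_mirror : UniversalRel q a _ _ (comp sideL sideR)
      (add (idd (dn 1 ++ up 1)) (smul (aInt q a 2) (comp (capR 1) (cupL 1))))

/-- The additional relations with circle values `c k`, sideway digon values `d k l` (strand
labelled `k`, loop labelled `l`) and mixed square value `s`. -/
inductive MixedRel {R : Type u} [CommRing R] (c : ℕ → R) (d : ℕ → ℕ → R) (s : R) : Relations R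
  | circleR (k : ℕ) : MixedRel c d s _ _ (circleR k) (smul (c k) (idd []))
  | circleL (k : ℕ) : MixedRel c d s _ _ (circleL k) (smul (c k) (idd []))
  | digonR (k l : ℕ) : MixedRel c d s _ _ (digonR k l) (smul (d k l) (idd (up k)))
  | digonL (k l : ℕ) : MixedRel c d s _ _ (digonL k l) (smul (d k l) (idd (up k)))
  | square : MixedRel c d s _ _ (comp sideR sideL)
      (add (idd (up 1 ++ dn 1)) (smul s (comp (capL 1) (cupR 1))))
  | square_mirror : MixedRel c d s _ _ (comp sideL sideR)
      (add (idd (dn 1 ++ up 1)) (smul s (comp (capR 1) (cupL 1))))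

/-! ### The linear braided strict monoidal category presented by relations -/

/-- The congruence on diagrams generated by the relations `S` and the axioms of an `R`-linear,
strict monoidal, braided category. -/
inductive Equivalent {R : Type u} [CommRing R] (S : Relations R) :
    ∀ {X Y : Word}, Diag R X Y → Diag R X Y → Prop
  | of {X Y : Word} {f g : Diag R X Y} : S X Y f g → Equivalent S f g
  | refl {X Y : Word} (f : Diag R X Y) : Equivalent S f f
  | symm {X Y : Word} {f g : Diag R X Y} : Equivalent S f g → Equivalent S g f
  | trans {X Y : Word} {f g h : Diag R X Y} :
      Equivalent S f g → Equivalent S g h → Equivalent S f h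
  | comp_congr {X Y Z : Word} {f f' : Diag R X Y} {g g' : Diag R Y Z} :
      Equivalent S f f' → Equivalent S g g' → Equivalent S (comp f g) (comp f' g')
  | tensor_congr {X Y Z W : Word} {f f' : Diag R X Y} {g g' : Diag R Z W} :
      Equivalent S f f' → Equivalent S g g' → Equivalent S (tensor f g) (tensor f' g')
  | add_congr {X Y : Word} {f f' g g' : Diag R X Y} :
      Equivalent S f f' → Equivalent S g g' → Equivalent S (add f g) (add f' g')
  | smul_congr {X Y : Word} (r : R) {f f' : Diag R X Y} :
      Equivalent S f f' → Equivalent S (smul r f) (smul r f')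
  -- module structure
  | add_assoc {X Y : Word} (f g h : Diag R X Y) :
      Equivalent S (add (add f g) h) (add f (add g h))
  | add_comm {X Y : Word} (f g : Diag R X Y) : Equivalent S (add f g) (add g f)
  | zero_add {X Y : Word} (f : Diag R X Y) : Equivalent S (add zero f) f
  | one_smul {X Y : Word} (f : Diag R X Y) : Equivalent S (smul 1 f) f
  | zero_smul {X Y : Word} (f : Diag R X Y) : Equivalent S (smul 0 f) zero
  | mul_smul {X Y : Word} (r s : R) (f : Diag R X Y) :
      Equivalent S (smul (r * s) f) (smul r (smul s f))
  | add_smul {X Y : Word} (r s : R) (f : Diag R X Y) :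
      Equivalent S (smul (r + s) f) (add (smul r f) (smul s f))
  | smul_add {X Y : Word} (r : R) (f g : Diag R X Y) :
      Equivalent S (smul r (add f g)) (add (smul r f) (smul r g))
  -- category structure
  | id_comp {X Y : Word} (f : Diag R X Y) : Equivalent S (comp (idd X) f) f
  | comp_id {X Y : Word} (f : Diag R X Y) : Equivalent S (comp f (idd Y)) f
  | comp_assoc {X Y Z W : Word} (f : Diag R X Y) (g : Diag R Y Z) (h : Diag R Z W) :
      Equivalent S (comp (comp f g) h) (comp f (comp g h))
  -- strict monoidal structure
  | tensor_id (X Y : Word) : Equivalent S (tensor (idd X) (idd Y)) (idd (X ++ Y))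
  | tensor_comp {X Y Z X' Y' Z' : Word} (f : Diag R X Y) (g : Diag R Y Z)
      (f' : Diag R X' Y') (g' : Diag R Y' Z') :
      Equivalent S (comp (tensor f f') (tensor g g')) (tensor (comp f g) (comp f' g'))
  | tensor_assoc {X Y X' Y' X'' Y'' : Word} (f : Diag R X Y) (g : Diag R X' Y')
      (h : Diag R X'' Y'') :
      Equivalent S
        (comp (tensor (tensor f g) h) (eqHom (List.append_assoc Y Y' Y'')))
        (comp (eqHom (List.append_assoc X X' X'')) (tensor f (tensor g h)))
  | unit_tensor {X Y : Word} (f : Diag R X Y) : Equivalent S (tensor (idd []) f) f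
  | tensor_unit {X Y : Word} (f : Diag R X Y) :
      Equivalent S (comp (tensor f (idd [])) (eqHom (List.append_nil Y)))
        (comp (eqHom (List.append_nil X)) f)
  -- bilinearity of both compositions
  | add_comp {X Y Z : Word} (f f' : Diag R X Y) (g : Diag R Y Z) :
      Equivalent S (comp (add f f') g) (add (comp f g) (comp f' g))
  | comp_add {X Y Z : Word} (f : Diag R X Y) (g g' : Diag R Y Z) :
      Equivalent S (comp f (add g g')) (add (comp f g) (comp f g'))
  | smul_comp {X Y Z : Word} (r : R) (f : Diag R X Y) (g : Diag R Y Z) :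
      Equivalent S (comp (smul r f) g) (smul r (comp f g))
  | comp_smul {X Y Z : Word} (r : R) (f : Diag R X Y) (g : Diag R Y Z) :
      Equivalent S (comp f (smul r g)) (smul r (comp f g))
  | add_tensor {X Y Z W : Word} (f f' : Diag R X Y) (g : Diag R Z W) :
      Equivalent S (tensor (add f f') g) (add (tensor f g) (tensor f' g))
  | tensor_add {X Y Z W : Word} (f : Diag R X Y) (g g' : Diag R Z W) :
      Equivalent S (tensor f (add g g')) (add (tensor f g) (tensor f g'))
  | smul_tensor {X Y Z W : Word} (r : R) (f : Diag R X Y) (g : Diag R Z W) :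
      Equivalent S (tensor (smul r f) g) (smul r (tensor f g))
  | tensor_smul {X Y Z W : Word} (r : R) (f : Diag R X Y) (g : Diag R Z W) :
      Equivalent S (tensor f (smul r g)) (smul r (tensor f g))
  -- braiding
  | braid_braidInv (X Y : Word) :
      Equivalent S (comp (braid X Y) (braidInv X Y)) (idd (X ++ Y))
  | braidInv_braid (X Y : Word) :
      Equivalent S (comp (braidInv X Y) (braid X Y)) (idd (Y ++ X))
  | braid_naturality {X Y X' Y' : Word} (f : Diag R X Y) (g : Diag R X' Y') :
      Equivalent S (comp (tensor f g) (braid Y Y')) (comp (braid X X') (tensor g f))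
  | hexagon_forward (X Y Z : Word) :
      Equivalent S
        (comp (eqHom (List.append_assoc X Y Z))
          (comp (braid X (Y ++ Z)) (eqHom (List.append_assoc Y Z X))))
        (comp (tensor (braid X Y) (idd Z))
          (comp (eqHom (List.append_assoc Y X Z)) (tensor (idd Y) (braid X Z))))
  | hexagon_reverse (X Y Z : Word) :
      Equivalent S
        (comp (eqHom (List.append_assoc X Y Z).symm)
          (comp (braid (X ++ Y) Z) (eqHom (List.append_assoc Z X Y).symm)))
        (comp (tensor (idd X) (braid Y Z))
          (comp (eqHom (List.append_assoc X Z Y).symm) (tensor (braid X Z) (idd Y))))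

/-- The objects of the category presented by `S`: words of labelled arrows. -/
@[ext]
structure Presented {R : Type u} (S : Relations R) where
  word : Word

namespace Presented

variable {R : Type u} [CommRing R] {S : Relations R}

/-- Equality of diagrams in the presented category. -/
def setoid (S : Relations R) (X Y : Word) : Setoid (Diag R X Y) where
  r := Equivalent S
  iseqv := ⟨Equivalent.refl, Equivalent.symm, Equivalent.trans⟩

/-- Morphisms of the presented category: diagrams modulo the relations. -/
def Hom (S : Relations R) (X Y : Word) : Type u := Quotient (setoid S X Y)

/-- The morphism represented by a diagram. -/
def cls (S : Relations R) {X Y : Word} (f : Diag R X Y) : Hom S X Y := Quotient.mk (setoid S X Y) f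

theorem sound {X Y : Word} {f g : Diag R X Y} (h : Equivalent S f g) : cls S f = cls S g :=
  Quotient.sound (s := setoid S X Y) h

theorem cls_surj {X Y : Word} (f : Hom S X Y) : ∃ f₀, cls S f₀ = f := Quotient.exists_rep f

instance (X Y : Word) : Add (Hom S X Y) :=
  ⟨Quotient.map₂ add fun _ _ h _ _ h' => Equivalent.add_congr h h'⟩

instance (X Y : Word) : Zero (Hom S X Y) := ⟨cls S zero⟩

instance (X Y : Word) : SMul R (Hom S X Y) :=
  ⟨fun r => Quotient.map (smul r) fun _ _ h => Equivalent.smul_congr r h⟩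

instance (X Y : Word) : Neg (Hom S X Y) := ⟨fun f => (-1 : R) • f⟩

/-- Vertical composition. -/
def hcomp {X Y Z : Word} : Hom S X Y → Hom S Y Z → Hom S X Z :=
  Quotient.map₂ comp fun _ _ h _ _ h' => Equivalent.comp_congr h h'

/-- Horizontal composition. -/
def htensor {X Y Z W : Word} : Hom S X Y → Hom S Z W → Hom S (X ++ Z) (Y ++ W) :=
  Quotient.map₂ tensor fun _ _ h _ _ h' => Equivalent.tensor_congr h h'

theorem cls_add {X Y : Word} (f g : Diag R X Y) : cls S (add f g) = cls S f + cls S g := rfl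
theorem cls_zero {X Y : Word} : cls S (zero : Diag R X Y) = 0 := rfl
theorem cls_smul {X Y : Word} (r : R) (f : Diag R X Y) : cls S (smul r f) = r • cls S f := rfl
theorem cls_comp {X Y Z : Word} (f : Diag R X Y) (g : Diag R Y Z) :
    cls S (comp f g) = hcomp (cls S f) (cls S g) := rfl
theorem cls_tensor {X Y Z W : Word} (f : Diag R X Y) (g : Diag R Z W) :
    cls S (tensor f g) = htensor (cls S f) (cls S g) := rfl

instance (X Y : Word) : AddCommGroup (Hom S X Y) where
  add_assoc f g h := by
    obtain ⟨f, rfl⟩ := cls_surj f; obtain ⟨g, rfl⟩ := cls_surj g; obtain ⟨h, rfl⟩ := cls_surj h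
    exact sound (.add_assoc f g h)
  add_comm f g := by
    obtain ⟨f, rfl⟩ := cls_surj f; obtain ⟨g, rfl⟩ := cls_surj g
    exact sound (.add_comm f g)
  zero_add f := by
    obtain ⟨f, rfl⟩ := cls_surj f
    exact sound (.zero_add f)
  add_zero f := by
    obtain ⟨f, rfl⟩ := cls_surj f
    exact sound ((Equivalent.add_comm f zero).trans (.zero_add f))
  neg_add_cancel f := by
    obtain ⟨f, rfl⟩ := cls_surj f
    refine sound (f := add (smul (-1) f) f) (g := zero) ?_
    refine ((Equivalent.refl _).add_congr (Equivalent.one_smul f).symm).trans ?_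
    refine (Equivalent.add_smul (-1) 1 f).symm.trans ?_
    rw [neg_add_cancel]
    exact .zero_smul f
  nsmul := nsmulRec
  zsmul := zsmulRec

instance (X Y : Word) : Module R (Hom S X Y) where
  one_smul f := by
    obtain ⟨f, rfl⟩ := cls_surj f
    exact sound (.one_smul f)
  zero_smul f := by
    obtain ⟨f, rfl⟩ := cls_surj f
    exact sound (.zero_smul f)
  mul_smul r s f := by
    obtain ⟨f, rfl⟩ := cls_surj f
    exact sound (.mul_smul r s f)
  add_smul r s f := by
    obtain ⟨f, rfl⟩ := cls_surj f
    exact sound (.add_smul r s f)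
  smul_add r f g := by
    obtain ⟨f, rfl⟩ := cls_surj f; obtain ⟨g, rfl⟩ := cls_surj g
    exact sound (.smul_add r f g)
  smul_zero r := by
    refine sound (f := smul r zero) (g := zero) ?_
    refine (Equivalent.smul_congr r (Equivalent.zero_smul zero).symm).trans ?_
    refine (Equivalent.mul_smul r 0 zero).symm.trans ?_
    rw [mul_zero]
    exact .zero_smul zero

instance : Category (Presented S) where
  Hom X Y := Hom S X.word Y.word
  id X := cls S (idd X.word)
  comp f g := hcomp f g
  id_comp f := by
    obtain ⟨f, rfl⟩ := cls_surj f
    exact sound (.id_comp f)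
  comp_id f := by
    obtain ⟨f, rfl⟩ := cls_surj f
    exact sound (.comp_id f)
  assoc f g h := by
    obtain ⟨f, rfl⟩ := cls_surj f; obtain ⟨g, rfl⟩ := cls_surj g; obtain ⟨h, rfl⟩ := cls_surj h
    exact sound (.comp_assoc f g h)

/-- The morphism represented by a diagram, as a morphism of the category. -/
def homMk (S : Relations R) {X Y : Word} (f : Diag R X Y) :
    (⟨X⟩ : Presented S) ⟶ (⟨Y⟩ : Presented S) := cls S f

instance : Preadditive (Presented S) where
  homGroup X Y := inferInstanceAs (AddCommGroup (Hom S X.word Y.word))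
  add_comp _ _ _ f f' g := by
    obtain ⟨f, rfl⟩ := cls_surj f; obtain ⟨f', rfl⟩ := cls_surj f'; obtain ⟨g, rfl⟩ := cls_surj g
    exact sound (.add_comp f f' g)
  comp_add _ _ _ f g g' := by
    obtain ⟨f, rfl⟩ := cls_surj f; obtain ⟨g, rfl⟩ := cls_surj g; obtain ⟨g', rfl⟩ := cls_surj g'
    exact sound (.comp_add f g g')

instance : Linear R (Presented S) where
  homModule X Y := inferInstanceAs (Module R (Hom S X.word Y.word))
  smul_comp _ _ _ r f g := by
    obtain ⟨f, rfl⟩ := cls_surj f; obtain ⟨g, rfl⟩ := cls_surj g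
    exact sound (.smul_comp r f g)
  comp_smul _ _ _ f r g := by
    obtain ⟨f, rfl⟩ := cls_surj f; obtain ⟨g, rfl⟩ := cls_surj g
    exact sound (.comp_smul r f g)

/-- The isomorphism between equal words. -/
def isoOfEq (S : Relations R) {X Y : Word} (h : X = Y) :
    (⟨X⟩ : Presented S) ≅ (⟨Y⟩ : Presented S) where
  hom := homMk S (eqHom h)
  inv := homMk S (eqHom h.symm)
  hom_inv_id := by subst h; exact Category.id_comp (𝟙 (⟨X⟩ : Presented S))
  inv_hom_id := by subst h; exact Category.id_comp (𝟙 (⟨X⟩ : Presented S))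

instance : MonoidalCategoryStruct (Presented S) where
  tensorObj X Y := ⟨X.word ++ Y.word⟩
  tensorUnit := ⟨[]⟩
  whiskerLeft X _ _ f := htensor (cls S (idd X.word)) f
  whiskerRight f Y := htensor f (cls S (idd Y.word))
  tensorHom f g := htensor f g
  associator X Y Z := isoOfEq S (List.append_assoc X.word Y.word Z.word)
  leftUnitor X := isoOfEq S (List.nil_append X.word)
  rightUnitor X := isoOfEq S (List.append_nil X.word)

theorem eqHom_comp {X Y Z : Word} (h : X = Y) (h' : Y = Z) :
    Equivalent S (comp (eqHom h) (eqHom h')) (eqHom (h.trans h')) := by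
  subst h; subst h'; exact .id_comp _

theorem eqHom_tensor {X Y Z W : Word} (h : X = Y) (h' : Z = W) :
    Equivalent S (tensor (eqHom h) (eqHom h')) (eqHom (by rw [h, h'])) := by
  subst h; subst h'; exact .tensor_id _ _

instance : MonoidalCategory (Presented S) :=
  MonoidalCategory.ofTensorHom
    (id_tensorHom_id := fun X Y => sound (.tensor_id X.word Y.word))
    (id_tensorHom := fun _ _ _ _ => rfl)
    (tensorHom_id := fun _ _ => rfl)
    (tensorHom_comp_tensorHom := fun f f' g g' => by
      obtain ⟨f, rfl⟩ := cls_surj f; obtain ⟨g, rfl⟩ := cls_surj g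
      obtain ⟨f', rfl⟩ := cls_surj f'; obtain ⟨g', rfl⟩ := cls_surj g'
      exact sound (.tensor_comp f g f' g'))
    (associator_naturality := fun f g h => by
      obtain ⟨f, rfl⟩ := cls_surj f; obtain ⟨g, rfl⟩ := cls_surj g; obtain ⟨h, rfl⟩ := cls_surj h
      exact sound (.tensor_assoc f g h))
    (leftUnitor_naturality := fun {X Y} f => by
      obtain ⟨f, rfl⟩ := cls_surj f
      refine sound (f := comp (tensor (idd []) f) (idd Y.word)) (g := comp (idd X.word) f) ?_
      exact (((Equivalent.comp_id _).trans (.unit_tensor f))).trans (Equivalent.id_comp f).symm)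
    (rightUnitor_naturality := fun f => by
      obtain ⟨f, rfl⟩ := cls_surj f
      exact sound (.tensor_unit f))
    (pentagon := fun X Y Z W => by
      refine sound (X := ((X.word ++ Y.word) ++ Z.word) ++ W.word)
        (Y := X.word ++ (Y.word ++ (Z.word ++ W.word)))
        (f := comp (tensor (eqHom (List.append_assoc _ _ _)) (idd W.word))
          (comp (eqHom (List.append_assoc _ _ _))
            (tensor (idd X.word) (eqHom (List.append_assoc _ _ _)))))
        (g := comp (eqHom (List.append_assoc _ _ _)) (eqHom (List.append_assoc _ _ _))) ?_
      refine (Equivalent.comp_congr (eqHom_tensor _ _)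
        ((Equivalent.comp_congr (.refl _) (eqHom_tensor _ _)).trans (eqHom_comp _ _))).trans ?_
      exact (eqHom_comp _ _).trans (eqHom_comp _ _).symm)
    (triangle := fun X Y => by
      refine sound (X := (X.word ++ []) ++ Y.word) (Y := X.word ++ Y.word)
        (f := comp (eqHom (List.append_assoc _ _ _))
          (tensor (idd X.word) (eqHom (List.nil_append Y.word))))
        (g := tensor (eqHom (List.append_nil X.word)) (idd Y.word)) ?_
      refine (Equivalent.comp_congr (.refl _) (eqHom_tensor _ _)).trans ?_
      exact (eqHom_comp _ _).trans (eqHom_tensor _ _).symm)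

instance : MonoidalPreadditive (Presented S) where
  whiskerLeft_zero {X Y Z} := by
    refine sound (f := tensor (idd X.word) zero) (g := zero) ?_
    refine (Equivalent.tensor_congr (.refl _) (Equivalent.zero_smul zero).symm).trans ?_
    exact (Equivalent.tensor_smul 0 _ _).trans (.zero_smul _)
  zero_whiskerRight {X Y Z} := by
    refine sound (f := tensor zero (idd X.word)) (g := zero) ?_
    refine (Equivalent.tensor_congr (Equivalent.zero_smul zero).symm (.refl _)).trans ?_
    exact (Equivalent.smul_tensor 0 _ _).trans (.zero_smul _)
  whiskerLeft_add f g := by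
    obtain ⟨f, rfl⟩ := cls_surj f; obtain ⟨g, rfl⟩ := cls_surj g
    exact sound (.tensor_add _ f g)
  add_whiskerRight f g := by
    obtain ⟨f, rfl⟩ := cls_surj f; obtain ⟨g, rfl⟩ := cls_surj g
    exact sound (.add_tensor f g _)

instance : MonoidalLinear R (Presented S) where
  whiskerLeft_smul _ _ _ r f := by
    obtain ⟨f, rfl⟩ := cls_surj f
    exact sound (.tensor_smul r _ f)
  smul_whiskerRight r _ _ f _ := by
    obtain ⟨f, rfl⟩ := cls_surj f
    exact sound (.smul_tensor r f _)

instance : BraidedCategory (Presented S) where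
  braiding X Y :=
    { hom := homMk S (braid X.word Y.word)
      inv := homMk S (braidInv X.word Y.word)
      hom_inv_id := sound (.braid_braidInv X.word Y.word)
      inv_hom_id := sound (.braidInv_braid X.word Y.word) }
  braiding_naturality_right X _ _ f := by
    obtain ⟨f, rfl⟩ := cls_surj f
    exact sound (.braid_naturality (idd X.word) f)
  braiding_naturality_left f Z := by
    obtain ⟨f, rfl⟩ := cls_surj f
    exact sound (.braid_naturality f (idd Z.word))
  hexagon_forward X Y Z := sound (.hexagon_forward X.word Y.word Z.word)
  hexagon_reverse X Y Z := sound (.hexagon_reverse X.word Y.word Z.word)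

end Presented

/-! ### Extension of scalars of a linear braided monoidal category -/

/-- The objects of the category obtained from the `R`-linear category `C` by extending the scalars
from `R` to the `R`-algebra `K`. -/
@[ext]
structure BaseChange (R : Type u) (K : Type v) [CommRing R] [CommRing K] [Algebra R K]
    (C : Type w) where
  obj : C

namespace BaseChange

universe v₁

variable {R : Type u} {K : Type v} [CommRing R] [CommRing K] [Algebra R K]
variable {C : Type w} [Category.{v₁} C] [Preadditive C] [Linear R C]

/-- Morphisms are `K ⊗[R] (X ⟶ Y)`. -/
def Hom (K : Type v) [CommRing K] [Algebra R K] (X Y : C) : Type max v v₁ := K ⊗[R] (X ⟶ Y)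

instance (X Y : C) : AddCommGroup (Hom (R := R) K X Y) :=
  inferInstanceAs (AddCommGroup (K ⊗[R] (X ⟶ Y)))

instance (X Y : C) : Module K (Hom (R := R) K X Y) :=
  inferInstanceAs (Module K (K ⊗[R] (X ⟶ Y)))

/-- Composition, `(s ⊗ f) ≫ (t ⊗ g) = (s * t) ⊗ (f ≫ g)`. -/
def bcomp (X Y Z : C) : K ⊗[R] (X ⟶ Y) →ₗ[R] K ⊗[R] (Y ⟶ Z) →ₗ[R] K ⊗[R] (X ⟶ Z) :=
  TensorProduct.map₂ (LinearMap.mul R K) (Linear.comp (S := R) X Y Z)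

@[simp]
theorem bcomp_tmul (X Y Z : C) (s t : K) (f : X ⟶ Y) (g : Y ⟶ Z) :
    bcomp X Y Z (s ⊗ₜ[R] f) (t ⊗ₜ[R] g) = (s * t) ⊗ₜ[R] (f ≫ g) := rfl

theorem bcomp_smul_left (X Y Z : C) (r : K) (f : K ⊗[R] (X ⟶ Y)) (g : K ⊗[R] (Y ⟶ Z)) :
    bcomp X Y Z (r • f) g = r • bcomp X Y Z f g := by
  induction f using TensorProduct.induction_on with
  | zero => simp
  | add f f' h h' => simp [h, h']
  | tmul s f =>
    induction g using TensorProduct.induction_on with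
    | zero => simp
    | add g g' h h' => simp [h, h']
    | tmul t g => simp [TensorProduct.smul_tmul', mul_assoc]

theorem bcomp_smul_right (X Y Z : C) (r : K) (f : K ⊗[R] (X ⟶ Y)) (g : K ⊗[R] (Y ⟶ Z)) :
    bcomp X Y Z f (r • g) = r • bcomp X Y Z f g := by
  induction f using TensorProduct.induction_on with
  | zero => simp
  | add f f' h h' => simp [h, h']
  | tmul s f =>
    induction g using TensorProduct.induction_on with
    | zero => simp
    | add g g' h h' => simp only [smul_add, map_add, h, h']
    | tmul t g => simp [TensorProduct.smul_tmul', mul_left_comm]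

instance : Category (BaseChange R K C) where
  Hom X Y := Hom (R := R) K X.obj Y.obj
  id X := (1 : K) ⊗ₜ[R] 𝟙 X.obj
  comp f g := bcomp _ _ _ f g
  id_comp {X Y} (f : K ⊗[R] _) := by
    change bcomp _ _ _ _ f = f
    induction f using TensorProduct.induction_on with
    | zero => simp
    | add f f' h h' => simp [h, h']
    | tmul s f => simp
  comp_id {X Y} (f : K ⊗[R] _) := by
    change bcomp _ _ _ f _ = f
    induction f using TensorProduct.induction_on with
    | zero => simp
    | add f f' h h' => simp [h, h']
    | tmul s f => simp
  assoc {X Y Z W} (f : K ⊗[R] _) (g : K ⊗[R] _) (h : K ⊗[R] _) := by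
    change bcomp _ _ _ (bcomp _ _ _ f g) h = bcomp _ _ _ f (bcomp _ _ _ g h)
    induction f using TensorProduct.induction_on with
    | zero => simp
    | add f f' i i' => simp [i, i']
    | tmul s f =>
      induction g using TensorProduct.induction_on with
      | zero => simp
      | add g g' i i' => simp [i, i']
      | tmul t g =>
        induction h using TensorProduct.induction_on with
        | zero => simp
        | add h h' i i' => simp only [map_add, i, i']
        | tmul u h => simp [mul_assoc]

/-- The morphism `1 ⊗ f`. -/
def ofHom (K : Type v) [CommRing K] [Algebra R K] {X Y : C} (f : X ⟶ Y) :
    (⟨X⟩ : BaseChange R K C) ⟶ ⟨Y⟩ := (1 : K) ⊗ₜ[R] f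

instance : Preadditive (BaseChange R K C) where
  homGroup X Y := inferInstanceAs (AddCommGroup (Hom (R := R) K X.obj Y.obj))
  add_comp X Y Z f f' g := LinearMap.map_add₂ (bcomp X.obj Y.obj Z.obj) f f' g
  comp_add X Y Z f g g' := (bcomp X.obj Y.obj Z.obj f).map_add g g'

instance : Linear K (BaseChange R K C) where
  homModule X Y := inferInstanceAs (Module K (Hom (R := R) K X.obj Y.obj))
  smul_comp _ _ _ r f g := bcomp_smul_left _ _ _ r f g
  comp_smul _ _ _ f r g := bcomp_smul_right _ _ _ r f g

/-- The image of an isomorphism of `C`. -/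
def ofIso (R : Type u) (K : Type v) [CommRing R] [CommRing K] [Algebra R K] [Linear R C]
    {X Y : C} (e : X ≅ Y) : (⟨X⟩ : BaseChange R K C) ≅ ⟨Y⟩ where
  hom := ofHom K e.hom
  inv := ofHom K e.inv
  hom_inv_id := by
    change bcomp _ _ _ (_ ⊗ₜ _) (_ ⊗ₜ _) = _ ⊗ₜ _
    simp
  inv_hom_id := by
    change bcomp _ _ _ (_ ⊗ₜ _) (_ ⊗ₜ _) = _ ⊗ₜ _
    simp

variable [MonoidalCategory C] [MonoidalPreadditive C] [MonoidalLinear R C]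

/-- The tensor product of morphisms of `C` as a bilinear map. -/
def tensorBilin (X Y X' Y' : C) : (X ⟶ Y) →ₗ[R] (X' ⟶ Y') →ₗ[R] (X ⊗ X' ⟶ Y ⊗ Y') :=
  LinearMap.mk₂ R (fun f g => f ⊗ₘ g)
    (fun f f' g => by simp [MonoidalCategory.tensorHom_def])
    (fun r f g => by simp [MonoidalCategory.tensorHom_def])
    (fun f g g' => by simp [MonoidalCategory.tensorHom_def])
    (fun r f g => by simp [MonoidalCategory.tensorHom_def])

/-- The tensor product of morphisms, `(s ⊗ f) ⊗ (t ⊗ g) = (s * t) ⊗ (f ⊗ g)`. -/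
def btensor (X Y X' Y' : C) :
    K ⊗[R] (X ⟶ Y) →ₗ[R] K ⊗[R] (X' ⟶ Y') →ₗ[R] K ⊗[R] (X ⊗ X' ⟶ Y ⊗ Y') :=
  TensorProduct.map₂ (LinearMap.mul R K) (tensorBilin X Y X' Y')

@[simp]
theorem btensor_tmul (X Y X' Y' : C) (s t : K) (f : X ⟶ Y) (g : X' ⟶ Y') :
    btensor X Y X' Y' (s ⊗ₜ[R] f) (t ⊗ₜ[R] g) = (s * t) ⊗ₜ[R] (f ⊗ₘ g) := rfl

theorem btensor_smul_left (X Y X' Y' : C) (r : K) (f : K ⊗[R] (X ⟶ Y)) (g : K ⊗[R] (X' ⟶ Y')) :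
    btensor X Y X' Y' (r • f) g = r • btensor X Y X' Y' f g := by
  induction f using TensorProduct.induction_on with
  | zero => simp
  | add f f' h h' => simp [h, h']
  | tmul s f =>
    induction g using TensorProduct.induction_on with
    | zero => simp
    | add g g' h h' => simp [h, h']
    | tmul t g => simp [TensorProduct.smul_tmul', mul_assoc]

theorem btensor_smul_right (X Y X' Y' : C) (r : K) (f : K ⊗[R] (X ⟶ Y)) (g : K ⊗[R] (X' ⟶ Y')) :
    btensor X Y X' Y' f (r • g) = r • btensor X Y X' Y' f g := by
  induction f using TensorProduct.induction_on with
  | zero => simp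
  | add f f' h h' => simp [h, h']
  | tmul s f =>
    induction g using TensorProduct.induction_on with
    | zero => simp
    | add g g' h h' => simp only [smul_add, map_add, h, h']
    | tmul t g => simp [TensorProduct.smul_tmul', mul_left_comm]

instance : MonoidalCategoryStruct (BaseChange R K C) where
  tensorObj X Y := ⟨X.obj ⊗ Y.obj⟩
  tensorUnit := ⟨𝟙_ C⟩
  whiskerLeft X _ _ f := btensor _ _ _ _ ((1 : K) ⊗ₜ[R] 𝟙 X.obj) f
  whiskerRight f Y := btensor _ _ _ _ f ((1 : K) ⊗ₜ[R] 𝟙 Y.obj)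
  tensorHom f g := btensor _ _ _ _ f g
  associator X Y Z := ofIso R K (α_ X.obj Y.obj Z.obj)
  leftUnitor X := ofIso R K (λ_ X.obj)
  rightUnitor X := ofIso R K (ρ_ X.obj)

instance : MonoidalCategory (BaseChange R K C) :=
  MonoidalCategory.ofTensorHom
    (id_tensorHom_id := fun X Y => by
      change btensor _ _ _ _ (_ ⊗ₜ _) (_ ⊗ₜ _) = _ ⊗ₜ _
      simp only [btensor_tmul, mul_one]
      exact congrArg (TensorProduct.tmul R (1 : K)) (id_tensorHom_id X.obj Y.obj))
    (id_tensorHom := fun _ _ _ _ => rfl)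
    (tensorHom_id := fun _ _ => rfl)
    (tensorHom_comp_tensorHom := fun {X Y Z X' Y' Z'} (f : K ⊗[R] _) (f' : K ⊗[R] _)
        (g : K ⊗[R] _) (g' : K ⊗[R] _) => by
      change bcomp _ _ _ (btensor _ _ _ _ f f') (btensor _ _ _ _ g g') =
        btensor _ _ _ _ (bcomp _ _ _ f g) (bcomp _ _ _ f' g')
      induction f using TensorProduct.induction_on with
      | zero => simp
      | add f₁ f₂ i i' => simp [i, i']
      | tmul s f =>
        induction g using TensorProduct.induction_on with
        | zero => simp
        | add g₁ g₂ i i' => simp [i, i']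
        | tmul t g =>
          induction f' using TensorProduct.induction_on with
          | zero => simp
          | add f₁ f₂ i i' => simp [i, i']
          | tmul s' f' =>
            induction g' using TensorProduct.induction_on with
            | zero => simp
            | add g₁ g₂ i i' => simp only [map_add, i, i']
            | tmul t' g' => simp [mul_mul_mul_comm])
    (associator_naturality := fun {X X' X'' Y Y' Y''} (f : K ⊗[R] _) (g : K ⊗[R] _)
        (h : K ⊗[R] _) => by
      change bcomp _ _ _ (btensor _ _ _ _ (btensor _ _ _ _ f g) h) ((1 : K) ⊗ₜ[R] (α_ _ _ _).hom) =
        bcomp _ _ _ ((1 : K) ⊗ₜ[R] (α_ _ _ _).hom) (btensor _ _ _ _ f (btensor _ _ _ _ g h))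
      induction f using TensorProduct.induction_on with
      | zero => simp
      | add f₁ f₂ i i' => simp [i, i']
      | tmul s f =>
        induction g using TensorProduct.induction_on with
        | zero => simp
        | add g₁ g₂ i i' => simp [i, i']
        | tmul t g =>
          induction h using TensorProduct.induction_on with
          | zero => simp
          | add h₁ h₂ i i' => simp only [map_add, LinearMap.add_apply, i, i']
          | tmul u h => simp [mul_assoc])
    (leftUnitor_naturality := fun {X Y} (f : K ⊗[R] _) => by
      change bcomp _ _ _ (btensor _ _ _ _ ((1 : K) ⊗ₜ[R] 𝟙 _) f) ((1 : K) ⊗ₜ[R] (λ_ _).hom) =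
        bcomp _ _ _ ((1 : K) ⊗ₜ[R] (λ_ _).hom) f
      induction f using TensorProduct.induction_on with
      | zero => simp
      | add f₁ f₂ i i' => simp only [map_add, LinearMap.add_apply, i, i']
      | tmul s f => simp)
    (rightUnitor_naturality := fun {X Y} (f : K ⊗[R] _) => by
      change bcomp _ _ _ (btensor _ _ _ _ f ((1 : K) ⊗ₜ[R] 𝟙 _)) ((1 : K) ⊗ₜ[R] (ρ_ _).hom) =
        bcomp _ _ _ ((1 : K) ⊗ₜ[R] (ρ_ _).hom) f
      induction f using TensorProduct.induction_on with
      | zero => simp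
      | add f₁ f₂ i i' => simp only [map_add, LinearMap.add_apply, i, i']
      | tmul s f => simp)
    (pentagon := fun W X Y Z => by
      change bcomp _ _ _ (btensor _ _ _ _ (_ ⊗ₜ _) (_ ⊗ₜ _))
        (bcomp _ _ _ (_ ⊗ₜ _) (btensor _ _ _ _ (_ ⊗ₜ _) (_ ⊗ₜ _))) =
        bcomp _ _ _ (_ ⊗ₜ _) (_ ⊗ₜ _)
      simp only [btensor_tmul, bcomp_tmul, mul_one, tensorHom_id, id_tensorHom]
      exact congrArg (TensorProduct.tmul R (1 : K))
        (MonoidalCategory.pentagon W.obj X.obj Y.obj Z.obj))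
    (triangle := fun X Y => by
      change bcomp _ _ _ (_ ⊗ₜ _) (btensor _ _ _ _ (_ ⊗ₜ _) (_ ⊗ₜ _)) =
        btensor _ _ _ _ (_ ⊗ₜ _) (_ ⊗ₜ _)
      simp only [btensor_tmul, bcomp_tmul, mul_one, tensorHom_id, id_tensorHom]
      exact congrArg (TensorProduct.tmul R (1 : K)) (MonoidalCategory.triangle X.obj Y.obj))

instance [BraidedCategory C] : BraidedCategory (BaseChange R K C) where
  braiding X Y := ofIso R K (β_ X.obj Y.obj)
  braiding_naturality_right X {Y Z} (f : K ⊗[R] _) := by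
    change bcomp _ _ _ (btensor _ _ _ _ ((1 : K) ⊗ₜ[R] 𝟙 _) f) ((1 : K) ⊗ₜ[R] (β_ _ _).hom) =
      bcomp _ _ _ ((1 : K) ⊗ₜ[R] (β_ _ _).hom) (btensor _ _ _ _ f ((1 : K) ⊗ₜ[R] 𝟙 _))
    induction f using TensorProduct.induction_on with
    | zero => simp
    | add f₁ f₂ i i' => simp only [map_add, LinearMap.add_apply, i, i']
    | tmul s f => simp
  braiding_naturality_left {X Y} (f : K ⊗[R] _) Z := by
    change bcomp _ _ _ (btensor _ _ _ _ f ((1 : K) ⊗ₜ[R] 𝟙 _)) ((1 : K) ⊗ₜ[R] (β_ _ _).hom) =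
      bcomp _ _ _ ((1 : K) ⊗ₜ[R] (β_ _ _).hom) (btensor _ _ _ _ ((1 : K) ⊗ₜ[R] 𝟙 _) f)
    induction f using TensorProduct.induction_on with
    | zero => simp
    | add f₁ f₂ i i' => simp only [map_add, LinearMap.add_apply, i, i']
    | tmul s f => simp
  hexagon_forward X Y Z := by
    change bcomp _ _ _ (_ ⊗ₜ _) (bcomp _ _ _ (_ ⊗ₜ _) (_ ⊗ₜ _)) =
      bcomp _ _ _ (btensor _ _ _ _ (_ ⊗ₜ _) (_ ⊗ₜ _))
        (bcomp _ _ _ (_ ⊗ₜ _) (btensor _ _ _ _ (_ ⊗ₜ _) (_ ⊗ₜ _)))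
    simp only [btensor_tmul, bcomp_tmul, mul_one, tensorHom_id, id_tensorHom]
    exact congrArg (TensorProduct.tmul R (1 : K))
      (BraidedCategory.hexagon_forward X.obj Y.obj Z.obj)
  hexagon_reverse X Y Z := by
    change bcomp _ _ _ (_ ⊗ₜ _) (bcomp _ _ _ (_ ⊗ₜ _) (_ ⊗ₜ _)) =
      bcomp _ _ _ (btensor _ _ _ _ (_ ⊗ₜ _) (_ ⊗ₜ _))
        (bcomp _ _ _ (_ ⊗ₜ _) (btensor _ _ _ _ (_ ⊗ₜ _) (_ ⊗ₜ _)))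
    simp only [btensor_tmul, bcomp_tmul, mul_one, tensorHom_id, id_tensorHom]
    exact congrArg (TensorProduct.tmul R (1 : K))
      (BraidedCategory.hexagon_reverse X.obj Y.obj Z.obj)

end BaseChange

/-! ### `q`-rational numbers -/

/-- The denominators decrease along the even continued fraction algorithm. -/
theorem den_next_lt (x : ℚ) (h : ¬ (x - (⌈x⌉ - 1 : ℤ))⁻¹ = ⌊(x - (⌈x⌉ - 1 : ℤ))⁻¹⌋) :
    ((x - (⌈x⌉ - 1 : ℤ))⁻¹ - ⌊(x - (⌈x⌉ - 1 : ℤ))⁻¹⌋)⁻¹.den < x.den := by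
  set z : ℚ := x - (⌈x⌉ - 1 : ℤ) with hz
  have hz0 : 0 < z := by
    have := Int.ceil_lt_add_one x
    rw [hz]; push_cast; linarith
  have hz1 : z ≤ 1 := by
    have := Int.le_ceil x
    rw [hz]; push_cast; linarith
  have hzden : z.den = x.den := by rw [hz, Rat.sub_intCast_den]
  set w : ℚ := z⁻¹ - ⌊z⁻¹⌋ with hw
  have hw0 : 0 < w := by
    have h₁ := Int.floor_le z⁻¹
    have h₂ : (⌊z⁻¹⌋ : ℚ) ≠ z⁻¹ := fun e => h e.symm
    have := lt_of_le_of_ne h₁ h₂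
    rw [hw]; linarith
  have hw1 : w < 1 := by
    have := Int.lt_floor_add_one z⁻¹
    rw [hw]; linarith
  have hwden : w.den = z⁻¹.den := by rw [hw, Rat.sub_intCast_den]
  have key : ∀ y : ℚ, 0 < y → (y⁻¹.den : ℤ) = y.num := fun y hy => by
    rw [Rat.den_inv_of_ne_zero hy.ne']
    exact Int.natAbs_of_nonneg (Rat.num_nonneg.2 hy.le)
  have h₁ : (w⁻¹.den : ℤ) = w.num := key w hw0
  have h₂ : (z⁻¹.den : ℤ) = z.num := key z hz0
  have h₃ : w.num < w.den := by
    have := (Rat.lt_iff w 1).1 hw1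
    simpa using this
  have h₄ : z.num ≤ z.den := by
    have := (Rat.le_iff z 1).1 hz1
    simpa using this
  omega

/-- The continued fraction expansion `[a₁, a₂, …, a₂ₘ]` of even length of a rational number, with
`a₂, …, a₂ₘ` positive, as the list of the pairs `(a₁, a₂), (a₃, a₄), …`. -/
def evenCF (x : ℚ) : List (ℤ × ℤ) :=
  if _h : (x - (⌈x⌉ - 1 : ℤ))⁻¹ = ⌊(x - (⌈x⌉ - 1 : ℤ))⁻¹⌋ then
    [(⌈x⌉ - 1, ⌊(x - (⌈x⌉ - 1 : ℤ))⁻¹⌋)]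
  else
    (⌈x⌉ - 1, ⌊(x - (⌈x⌉ - 1 : ℤ))⁻¹⌋) ::
      evenCF ((x - (⌈x⌉ - 1 : ℤ))⁻¹ - ⌊(x - (⌈x⌉ - 1 : ℤ))⁻¹⌋)⁻¹
termination_by x.den
decreasing_by exact den_next_lt x _h

open RatFunc in
/-- `{a} = (q ^ (2a) - 1) / (q ^ 2 - 1)` in `ℚ(q)`, for an integer `a`. -/
def qNum (a : ℤ) : RatFunc ℚ := ((X : RatFunc ℚ) ^ (2 * a) - 1) / ((X : RatFunc ℚ) ^ 2 - 1)

open RatFunc in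
/-- `{a}` with `q` replaced by `q⁻¹`. -/
def qNumInv (a : ℤ) : RatFunc ℚ :=
  ((X : RatFunc ℚ) ^ (-2 * a) - 1) / ((X : RatFunc ℚ) ^ (-2 : ℤ) - 1)

open RatFunc in
/-- The `q`-deformed continued fraction of even length with entries `(a₁, a₂), (a₃, a₄), …`. -/
def qCF : List (ℤ × ℤ) → RatFunc ℚ
  | [] => 0
  | [(a, b)] => qNum a + (X : RatFunc ℚ) ^ (2 * a) / qNumInv b
  | (a, b) :: t =>
      qNum a + (X : RatFunc ℚ) ^ (2 * a) / (qNumInv b + (X : RatFunc ℚ) ^ (-2 * b) / qCF t)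

/-- The `q`-rational `{x}`. -/
def qRat (x : ℚ) : RatFunc ℚ := qCF (evenCF x)

/-- `δ_x = {x} - {x - 1}`. -/
def qDelta (x : ℚ) : RatFunc ℚ := qRat x - qRat (x - 1)

/-- The `q`-binomial coefficient `{x choose k}` for rational `x`. -/
def qRatBinom (x : ℚ) (k : ℕ) : RatFunc ℚ :=
  (∏ j ∈ Finset.range k, qRat (x - j)) / ∏ j ∈ Finset.range k, qNum (j + 1)

/-! ### The universal web category -/

section Universal

open MvPolynomial in
/-- The ring `ℤ[q^{±1}, a^{±1}][(q - q⁻¹)⁻¹]`: the polynomial ring in `q` and `a` over the integers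
with `q`, `a` and `q ^ 2 - 1` inverted. -/
abbrev UnivRing : Type :=
  Localization.Away (X 0 * X 1 * (X 0 ^ 2 - 1) : MvPolynomial (Fin 2) ℤ)

theorem isUnit_univ : IsUnit (algebraMap (MvPolynomial (Fin 2) ℤ) UnivRing
    (MvPolynomial.X 0 * MvPolynomial.X 1 * (MvPolynomial.X 0 ^ 2 - 1))) :=
  IsLocalization.Away.algebraMap_isUnit _

theorem isUnit_univ_q :
    IsUnit (algebraMap (MvPolynomial (Fin 2) ℤ) UnivRing (MvPolynomial.X 0)) := by
  have h := isUnit_univ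
  rw [map_mul, map_mul] at h
  exact isUnit_of_mul_isUnit_left (isUnit_of_mul_isUnit_left h)

theorem isUnit_univ_a :
    IsUnit (algebraMap (MvPolynomial (Fin 2) ℤ) UnivRing (MvPolynomial.X 1)) := by
  have h := isUnit_univ
  rw [map_mul, map_mul] at h
  exact isUnit_of_mul_isUnit_right (isUnit_of_mul_isUnit_left h)

/-- The unit `q`. -/
def univQ : UnivRingˣ := isUnit_univ_q.unit

/-- The unit `a`. -/
def univA : UnivRingˣ := isUnit_univ_a.unit

/-- The universal web category `∞Web`: the `UnivRing`-linear braided pivotal category generated by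
webs, subject to the upward web relations and the circle, sideway digon and square relations. -/
abbrev InfWeb : Type :=
  Presented (R := UnivRing) fun X Y f g =>
    BasicRel univQ X Y f g ∨ UniversalRel univQ univA X Y f g

end Universal

/-! ### Specialization -/

section Specialization

variable {K : Type v} [CommRing K] [Algebra (RatFunc ℚ) K]

/-- The unit `q` of a `ℚ(q)`-algebra. -/
def qUnit (K : Type v) [CommRing K] [Algebra (RatFunc ℚ) K] : Kˣ :=
  Units.map (algebraMap (RatFunc ℚ) K).toMonoidHom (Units.mk0 RatFunc.X RatFunc.X_ne_zero)

/-- The unit `q ν δ_x`, where `ν ^ 2 δ_x = 1`. -/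
def aUnit (x : ℚ) (ν : K) (hν : ν ^ 2 * algebraMap (RatFunc ℚ) K (qDelta x) = 1) : Kˣ where
  val := (qUnit K : K) * ν * algebraMap (RatFunc ℚ) K (qDelta x)
  inv := ((qUnit K)⁻¹ : Kˣ) * ν
  val_inv := by
    linear_combination ((qUnit K : K) * ((qUnit K)⁻¹ : Kˣ)) * hν + (qUnit K).mul_inv
  inv_val := by
    linear_combination ((qUnit K : K) * ((qUnit K)⁻¹ : Kˣ)) * hν + (qUnit K).mul_inv

theorem isUnit_qUnit_sq_sub_one (K : Type v) [CommRing K] [Algebra (RatFunc ℚ) K] :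
    IsUnit ((qUnit K : K) ^ 2 - 1) := by
  have h : (RatFunc.X : RatFunc ℚ) ^ 2 - 1 ≠ 0 := by
    have h₀ : (RatFunc.X : RatFunc ℚ) ^ 2 - 1 =
        algebraMap (Polynomial ℚ) (RatFunc ℚ) (Polynomial.X ^ 2 - 1) := by
      simp [RatFunc.algebraMap_X]
    rw [h₀]
    refine RatFunc.algebraMap_ne_zero ?_
    intro h₁
    have := congrArg (Polynomial.eval 0) h₁
    simp at this
  have := (IsUnit.mk0 _ h).map (algebraMap (RatFunc ℚ) K)
  simpa [qUnit] using this

/-- The ring homomorphism `UnivRing → K` with `q ↦ q` and `a ↦ q ν δ_x`. -/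
def specialize (x : ℚ) (ν : K) (hν : ν ^ 2 * algebraMap (RatFunc ℚ) K (qDelta x) = 1) :
    UnivRing →+* K :=
  IsLocalization.Away.lift
    (MvPolynomial.X 0 * MvPolynomial.X 1 * (MvPolynomial.X 0 ^ 2 - 1) : MvPolynomial (Fin 2) ℤ)
    (g := MvPolynomial.eval₂Hom (Int.castRingHom K) ![(qUnit K : K), (aUnit x ν hν : K)])
    (by
      simp only [map_mul, map_sub, map_pow, map_one, MvPolynomial.eval₂Hom_X']
      exact ((qUnit K).isUnit.mul (aUnit x ν hν).isUnit).mul (isUnit_qUnit_sq_sub_one K))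

theorem specialize_q (x : ℚ) (ν : K) (hν : ν ^ 2 * algebraMap (RatFunc ℚ) K (qDelta x) = 1) :
    specialize x ν hν univQ = algebraMap (RatFunc ℚ) K RatFunc.X := by
  change specialize x ν hν (algebraMap _ _ _) = _
  rw [specialize, IsLocalization.Away.lift_eq]
  simp [qUnit]

theorem specialize_a (x : ℚ) (ν : K) (hν : ν ^ 2 * algebraMap (RatFunc ℚ) K (qDelta x) = 1) :
    specialize x ν hν univA =
      algebraMap (RatFunc ℚ) K RatFunc.X * ν * algebraMap (RatFunc ℚ) K (qDelta x) := by
  change specialize x ν hν (algebraMap _ _ _) = _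
  rw [specialize, IsLocalization.Away.lift_eq]
  simp [qUnit, aUnit]

/-- `K` as an algebra over the universal coefficient ring, with `a` acting as `q ν δ_x`. -/
abbrev specAlgebra (x : ℚ) (ν : K) (hν : ν ^ 2 * algebraMap (RatFunc ℚ) K (qDelta x) = 1) :
    Algebra UnivRing K := (specialize x ν hν).toAlgebra

/-- The category `xWeb`: the specialization of `∞Web` at `a = q ν δ_x`. -/
abbrev XWeb (x : ℚ) (ν : K) (hν : ν ^ 2 * algebraMap (RatFunc ℚ) K (qDelta x) = 1) : Type :=
  @BaseChange UnivRing K _ _ (specAlgebra x ν hν) InfWeb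

/-- A word as an object of `xWeb`. -/
abbrev XWeb.of (x : ℚ) (ν : K) (hν : ν ^ 2 * algebraMap (RatFunc ℚ) K (qDelta x) = 1)
    (X : Word) : XWeb x ν hν :=
  letI := specAlgebra x ν hν
  BaseChange.mk (Presented.mk X)

/-- The morphism of `xWeb` represented by a diagram over the universal coefficient ring. -/
def XWeb.ofDiag (x : ℚ) (ν : K) (hν : ν ^ 2 * algebraMap (RatFunc ℚ) K (qDelta x) = 1)
    {X Y : Word} (f : Diag UnivRing X Y) : XWeb.of x ν hν X ⟶ XWeb.of x ν hν Y :=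
  letI := specAlgebra x ν hν
  BaseChange.ofHom K (Presented.homMk _ f)

/-! ### The presentation -/

/-- The value `u_k = q ^ (k (k - 1)) ν ^ k {x choose k}` of the circle labelled `k`. -/
def circleValue (x : ℚ) (ν : K) (k : ℕ) : K :=
  (qUnit K : K) ^ (k * (k - 1)) * ν ^ k * algebraMap (RatFunc ℚ) K (qRatBinom x k)

/-- The quotient `u_(k + l) / u_k`, with the common factors `{x}, …, {x - k + 1}` cancelled, so that
it makes sense when they vanish. -/
def circleRatio (x : ℚ) (ν : K) (k l : ℕ) : K :=
  (qUnit K : K) ^ (l * (2 * k + l - 1)) * ν ^ l *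
    algebraMap (RatFunc ℚ) K
      ((∏ j ∈ Finset.range l, qRat (x - (k + j : ℕ))) / ∏ j ∈ Finset.range l, qNum ((k + j : ℕ) + 1))

theorem circleRatio_mul_circleValue (x : ℚ) (ν : K) (k l : ℕ) :
    circleRatio x ν k l * circleValue x ν k = circleValue x ν (k + l) := by
  have h : qRatBinom x (k + l) =
      ((∏ j ∈ Finset.range l, qRat (x - (k + j : ℕ))) /
        ∏ j ∈ Finset.range l, qNum ((k + j : ℕ) + 1)) * qRatBinom x k := by
    rw [qRatBinom, qRatBinom, Finset.prod_range_add, Finset.prod_range_add, mul_comm, div_mul_div_comm]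
    congr 1
    rw [mul_comm]
  have e : (k + l) * (k + l - 1) = l * (2 * k + l - 1) + k * (k - 1) := by
    rcases k with _ | k
    · simp
    · rcases l with _ | l
      · simp
      · have h₁ : k + 1 + (l + 1) - 1 = k + l + 1 := by omega
        have h₂ : 2 * (k + 1) + (l + 1) - 1 = 2 * k + l + 2 := by omega
        have h₃ : k + 1 - 1 = k := by omega
        rw [h₁, h₂, h₃]; ring
  rw [circleRatio, circleValue, circleValue, h, e, map_mul, pow_add, pow_add]
  ring

/-- The coefficient `q ^ (-k l) {k + l choose k} u_(k + l) / u_k` of the sideway digon with strand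
labelled `k` and loop labelled `l`. -/
def digonValue (x : ℚ) (ν : K) (k l : ℕ) : K :=
  ((qUnit K ^ (-((k : ℤ) * l)) : Kˣ) : K) * qBinom (qUnit K) (k + l) k * circleRatio x ν k l

/-- The coefficient `q ^ 2 ν {x - 2}` of the mixed square. -/
def squareValue (x : ℚ) (ν : K) : K :=
  (qUnit K : K) ^ 2 * ν * algebraMap (RatFunc ℚ) K (qRat (x - 2))

/-- The `K`-linear braided category of webs presented by the upward web relations, circle
evaluation, sideway digon removal and mixed square removal. -/
abbrev XWebPresented (x : ℚ) (ν : K) : Type :=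
  Presented (R := K) fun X Y f g =>
    BasicRel (qUnit K) X Y f g ∨
      MixedRel (circleValue x ν) (digonValue x ν) (squareValue x ν) X Y f g

/-- A word as an object of the presented category. -/
abbrev XWebPresented.of (x : ℚ) (ν : K) (X : Word) : XWebPresented x ν := Presented.mk X

/-- The morphism of the presented category represented by a diagram. -/
def XWebPresented.ofDiag (x : ℚ) (ν : K) {X Y : Word} (f : Diag K X Y) :
    XWebPresented.of x ν X ⟶ XWebPresented.of x ν Y := Presented.homMk _ f

end Specialization

end Web

end

/-! Extension of scalars commutes with presentations. Each defining relation over `UnivRing` is a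
fixed expression in `q`, `a` and the inverse of `q ^ 2 - 1`, so tensoring `InfWeb` with `K` gives
the category presented over `K` by the same relations at `a = q ν δ_x` (`specRel`). One direction
evaluates a diagram over `K` in the tensor product (`evalDiag`); the other sends `s ⊗ f` to `s`
times the specialized diagram (`baseChangeHom`). It remains to see that `specRel` and `presRel`
impose the same equalities over `K`.

Coefficients. The one fact needed about `q`-rationals is `{x} = q² {x - 1} + 1` (`qRat_sub_one`). It
gives `a² = q² δ_x = 1 + (q² - 1) {x}`, so that `a` plays the part of `q ^ x`, and `(a q⁻ⁿ - a⁻¹ qⁿ)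
/ (q - q⁻¹) = qⁿ ν {x - n}` (`aInt_aUnit`). For `n = 0, 1, 2` this identifies the values of the
`1`-circle, of the `(1, 1)`-digon and of the mixed square, so the universal relations are instances
of `MixedRel`.

Conversely, a sideway digon is the closure of one strand of a merge followed by a split. The square
switch on uprights `m + 1` and `1` rewrites this composite through the dumbbell of two `1`-strands
and a multiple of the identity; closing a strand evaluates every loop labelled `1` (`digonR_one`,
with `aInt_succ` for the value). For longer loops, the loop `l + 1` is opened into `l` and `1`, and
the merge vertex is slid around the closure (`trace_cyclic`), which is possible because its two
half-turn rotations agree. With `d k l` the digon values, the result is `q⁻ˡ {l + 1} d k (l + 1) = d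
(k + l) 1 * d k l` (`digonR_succ`). As `{l + 1}` is invertible in a `ℚ(q)`-algebra, all digon values
follow by induction on `l`; circles are the case `k = 0`.

Crossings. Upward crossings are sums of ladders by definition. Naturality of the braiding along a
cap or a cup expresses a crossing with a downward strand as a bent inverse crossing of the upward
strand, and the hexagons reduce arbitrary words to single letters (`braidHasWeb`). Hence every
diagram has a crossingless representative (`hasWeb`). -/

noncomputable section

namespace Web

universe u v w u'

open Diag

/-! ### Morphisms with varying source and target

Morphisms of a presented category, packaged with their source and target. Horizontal composition
is strictly associative and unital, and the re-bracketing morphisms become identities. -/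

section Mor

variable {R : Type u} [CommRing R] {S : Relations R}

/-- A morphism of the presented category together with its source and target. -/
structure Mor (S : Relations R) where
  src : Word
  tgt : Word
  hom : Presented.Hom S src tgt

namespace Mor

/-- The morphism represented by a diagram. -/
def of (S : Relations R) {X Y : Word} (f : Diag R X Y) : Mor S := ⟨X, Y, Presented.cls S f⟩

@[simp] theorem of_src {X Y : Word} (f : Diag R X Y) : (of S f).src = X := rfl
@[simp] theorem of_tgt {X Y : Word} (f : Diag R X Y) : (of S f).tgt = Y := rfl

theorem exists_of (f : Mor S) : ∃ f₀ : Diag R f.src f.tgt, of S f₀ = f := by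
  obtain ⟨f₀, h⟩ := Presented.cls_surj f.hom
  exact ⟨f₀, by cases f; simp only [of] at *; rw [h]⟩

theorem of_eq_of {X Y : Word} {f g : Diag R X Y} (h : Equivalent S f g) : of S f = of S g := by
  rw [of, of, Presented.sound h]

/-- The way back: computations with packaged morphisms yield equivalences of diagrams. -/
theorem equivalent_of_eq {X Y : Word} {f g : Diag R X Y} (h : of S f = of S g) :
    Equivalent S f g := by
  simp only [of, Mor.mk.injEq, heq_eq_eq, true_and] at h
  exact Quotient.exact (s := Presented.setoid S X Y) h

/-- Re-bracketing morphisms are identities once the words are identified; this converts the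
associativity and unit axioms of `Equivalent` into equalities. -/
theorem of_eq_of_eqHom {X Y X' Y' : Word} {f : Diag R X Y} {g : Diag R X' Y'} (hX : X = X')
    (hY : Y = Y') (h : Equivalent S (comp f (eqHom hY)) (comp (eqHom hX) g)) :
    of S f = of S g := by
  subst hX hY
  exact of_eq_of (((Equivalent.comp_id f).symm.trans h).trans (.id_comp g))

/-- The identity of a word. -/
def I (X : Word) : Mor S := of S (idd X)

@[simp] theorem I_src (X : Word) : (I X : Mor S).src = X := rfl
@[simp] theorem I_tgt (X : Word) : (I X : Mor S).tgt = X := rfl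

theorem of_eqHom {X Y : Word} (h : X = Y) : of S (eqHom h) = I X := by
  subst h; rfl

open scoped Classical in
/-- Vertical composition, zero if the target and the source do not match. -/
def comp (f g : Mor S) : Mor S :=
  if h : f.tgt = g.src then ⟨f.src, g.tgt, Presented.hcomp (h ▸ f.hom) g.hom⟩
  else ⟨f.src, g.tgt, 0⟩

-- The precedence lies between those of `+` and `*`: horizontal products are formed first and sums
-- last.
infixr:67 "⊚" => Mor.comp

@[simp] theorem comp_src (f g : Mor S) : (f ⊚ g).src = f.src := by
  unfold comp; split_ifs <;> rfl
@[simp] theorem comp_tgt (f g : Mor S) : (f ⊚ g).tgt = g.tgt := by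
  unfold comp; split_ifs <;> rfl

theorem of_comp {X Y Z : Word} (f : Diag R X Y) (g : Diag R Y Z) :
    of S (Diag.comp f g) = of S f ⊚ of S g := by
  rw [comp, dif_pos (by rfl)]; rfl

theorem of_comp_ne {X Y Y' Z : Word} (f : Diag R X Y) (g : Diag R Y' Z) (h : Y ≠ Y') :
    of S f ⊚ of S g = of S (zero : Diag R X Z) := by
  rw [comp, dif_neg (by exact h)]; rfl

theorem zero_comp {X Y Z : Word} (g : Diag R Y Z) :
    of S (Diag.comp (zero : Diag R X Y) g) = of S (zero : Diag R X Z) :=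
  of_eq_of <| ((Equivalent.comp_congr (.symm (.zero_smul zero)) (.refl g)).trans
    (.smul_comp 0 _ _)).trans (.zero_smul _)

theorem comp_zero {X Y Z : Word} (f : Diag R X Y) :
    of S (Diag.comp f (zero : Diag R Y Z)) = of S (zero : Diag R X Z) :=
  of_eq_of <| ((Equivalent.comp_congr (.refl f) (.symm (.zero_smul zero))).trans
    (.comp_smul 0 _ _)).trans (.zero_smul _)

/-- No matching hypotheses are needed: a mismatch at either place makes both sides the zero morphism
between the outer words. -/
theorem comp_assoc (f g h : Mor S) : (f ⊚ g) ⊚ h = f ⊚ g ⊚ h := by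
  obtain ⟨X, Y, f⟩ := f
  obtain ⟨Y', Z, g⟩ := g
  obtain ⟨Z', W, h⟩ := h
  obtain ⟨f, rfl⟩ := Presented.cls_surj f
  obtain ⟨g, rfl⟩ := Presented.cls_surj g
  obtain ⟨h, rfl⟩ := Presented.cls_surj h
  change (of S f ⊚ of S g) ⊚ of S h = of S f ⊚ of S g ⊚ of S h
  by_cases e : Y = Y'
  · subst e
    by_cases e' : Z = Z'
    · subst e'
      simp only [← of_comp]
      exact of_eq_of (.comp_assoc f g h)
    · rw [← of_comp, of_comp_ne _ _ e', of_comp_ne _ _ e', ← of_comp, comp_zero]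
  · rw [of_comp_ne _ _ e]
    by_cases e' : Z = Z'
    · subst e'
      rw [← of_comp, ← of_comp, zero_comp, of_comp_ne _ _ e]
    · rw [of_comp_ne _ _ e', of_comp_ne _ _ e', of_comp_ne _ _ e]

theorem id_comp {X : Word} (f : Mor S) (h : X = f.src) : I X ⊚ f = f := by
  subst h
  obtain ⟨X, Y, f⟩ := f
  obtain ⟨f, rfl⟩ := Presented.cls_surj f
  exact (of_comp (idd X) f).symm.trans (of_eq_of (.id_comp f))

theorem comp_id {X : Word} (f : Mor S) (h : f.tgt = X) : f ⊚ I X = f := by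
  subst h
  obtain ⟨X, Y, f⟩ := f
  obtain ⟨f, rfl⟩ := Presented.cls_surj f
  exact (of_comp f (idd Y)).symm.trans (of_eq_of (.comp_id f))

instance : Mul (Mor S) :=
  ⟨fun f g => ⟨f.src ++ g.src, f.tgt ++ g.tgt, Presented.htensor f.hom g.hom⟩⟩
instance : One (Mor S) := ⟨I []⟩

@[simp] theorem mul_src (f g : Mor S) : (f * g).src = f.src ++ g.src := rfl
@[simp] theorem mul_tgt (f g : Mor S) : (f * g).tgt = f.tgt ++ g.tgt := rfl

theorem I_nil : (I [] : Mor S) = 1 := rfl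

theorem of_tensor {X Y Z W : Word} (f : Diag R X Y) (g : Diag R Z W) :
    of S (tensor f g) = of S f * of S g := rfl

theorem I_append (X Y : Word) : (I (X ++ Y) : Mor S) = I X * I Y :=
  (of_eq_of (.tensor_id X Y)).symm

instance : Monoid (Mor S) where
  mul_assoc f g h := by
    obtain ⟨f₀, hf⟩ := exists_of f
    obtain ⟨g₀, hg⟩ := exists_of g
    obtain ⟨h₀, hh⟩ := exists_of h
    rw [← hf, ← hg, ← hh]
    exact of_eq_of_eqHom (List.append_assoc _ _ _) (List.append_assoc _ _ _)
      (.tensor_assoc f₀ g₀ h₀)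
  one_mul f := by
    obtain ⟨f₀, hf⟩ := exists_of f
    rw [← hf]
    exact of_eq_of (.unit_tensor f₀)
  mul_one f := by
    obtain ⟨f₀, hf⟩ := exists_of f
    rw [← hf]
    exact of_eq_of_eqHom (List.append_nil _) (List.append_nil _) (.tensor_unit f₀)

theorem mul_comp_mul (f f' g g' : Mor S) (h : f.tgt = g.src) (h' : f'.tgt = g'.src) :
    (f * f') ⊚ (g * g') = (f ⊚ g) * (f' ⊚ g') := by
  obtain ⟨X, Y, f⟩ := f
  obtain ⟨X', Y', f'⟩ := f'
  obtain ⟨_, Z, g⟩ := g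
  obtain ⟨_, Z', g'⟩ := g'
  obtain ⟨f, rfl⟩ := Presented.cls_surj f
  obtain ⟨g, rfl⟩ := Presented.cls_surj g
  obtain ⟨f', rfl⟩ := Presented.cls_surj f'
  obtain ⟨g', rfl⟩ := Presented.cls_surj g'
  dsimp only at h h'
  subst h h'
  change (of S f * of S f') ⊚ (of S g * of S g') = (of S f ⊚ of S g) * (of S f' ⊚ of S g')
  simp only [← of_comp, ← of_tensor]
  exact of_eq_of (.tensor_comp f g f' g')

/-! ### Linear structure on packaged morphisms -/

instance : SMul R (Mor S) := ⟨fun r f => ⟨f.src, f.tgt, r • f.hom⟩⟩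

@[simp] theorem smul_src (r : R) (f : Mor S) : (r • f).src = f.src := rfl
@[simp] theorem smul_tgt (r : R) (f : Mor S) : (r • f).tgt = f.tgt := rfl

theorem of_smul {X Y : Word} (r : R) (f : Diag R X Y) : of S (smul r f) = r • of S f := rfl

theorem smul_smul' (r s : R) (f : Mor S) : (r * s) • f = r • s • f := by
  change (⟨_, _, _⟩ : Mor S) = ⟨f.src, f.tgt, r • s • f.hom⟩
  rw [mul_smul]

theorem one_smul' (f : Mor S) : (1 : R) • f = f := by
  change (⟨_, _, _⟩ : Mor S) = _
  rw [one_smul]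

theorem smul_mul (r : R) (f g : Mor S) : (r • f) * g = r • (f * g) := by
  obtain ⟨f₀, hf⟩ := exists_of f
  obtain ⟨g₀, hg⟩ := exists_of g
  rw [← hf, ← hg]
  exact of_eq_of (.smul_tensor r f₀ g₀)

theorem mul_smul_right (r : R) (f g : Mor S) : f * (r • g) = r • (f * g) := by
  obtain ⟨f₀, hf⟩ := exists_of f
  obtain ⟨g₀, hg⟩ := exists_of g
  rw [← hf, ← hg]
  exact of_eq_of (.tensor_smul r f₀ g₀)

theorem smul_zero_of (r : R) {X Y : Word} :
    r • of S (zero : Diag R X Y) = of S (zero : Diag R X Y) := by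
  change (⟨_, _, r • (0 : Presented.Hom S X Y)⟩ : Mor S) = ⟨_, _, 0⟩
  rw [smul_zero]

theorem smul_comp (r : R) (f g : Mor S) : (r • f) ⊚ g = r • (f ⊚ g) := by
  obtain ⟨X, Y, f⟩ := f
  obtain ⟨Y', Z, g⟩ := g
  obtain ⟨f, rfl⟩ := Presented.cls_surj f
  obtain ⟨g, rfl⟩ := Presented.cls_surj g
  change of S (smul r f) ⊚ of S g = r • (of S f ⊚ of S g)
  by_cases e : Y = Y'
  · subst e
    simp only [← of_comp, ← of_smul]
    exact of_eq_of (.smul_comp r f g)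
  · rw [of_comp_ne _ _ e, of_comp_ne _ _ e, smul_zero_of]

theorem comp_smul (r : R) (f g : Mor S) : f ⊚ (r • g) = r • (f ⊚ g) := by
  obtain ⟨X, Y, f⟩ := f
  obtain ⟨Y', Z, g⟩ := g
  obtain ⟨f, rfl⟩ := Presented.cls_surj f
  obtain ⟨g, rfl⟩ := Presented.cls_surj g
  change of S f ⊚ of S (smul r g) = r • (of S f ⊚ of S g)
  by_cases e : Y = Y'
  · subst e
    simp only [← of_comp, ← of_smul]
    exact of_eq_of (.comp_smul r f g)
  · rw [of_comp_ne _ _ e, of_comp_ne _ _ e, smul_zero_of]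

open scoped Classical in
/-- The sum of two morphisms, the first one if they are not parallel. -/
def add (f g : Mor S) : Mor S :=
  if h : g.src = f.src ∧ g.tgt = f.tgt then ⟨f.src, f.tgt, f.hom + h.1 ▸ h.2 ▸ g.hom⟩ else f

instance : Add (Mor S) := ⟨add⟩

theorem of_add {X Y : Word} (f g : Diag R X Y) : of S (f.add g) = of S f + of S g := by
  change _ = Mor.add _ _
  rw [Mor.add, dif_pos ⟨rfl, rfl⟩]; rfl

/-- The summands are assumed parallel because `f + f'` is `f` by convention otherwise. -/
theorem add_comp (f f' g : Mor S) (hs : f.src = f'.src) (ht : f.tgt = f'.tgt)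
    (h : f.tgt = g.src) : (f + f') ⊚ g = f ⊚ g + f' ⊚ g := by
  obtain ⟨X, Y, f⟩ := f
  obtain ⟨X', Y', f'⟩ := f'
  obtain ⟨_, Z, g⟩ := g
  obtain ⟨f, rfl⟩ := Presented.cls_surj f
  obtain ⟨g, rfl⟩ := Presented.cls_surj g
  obtain ⟨f', rfl⟩ := Presented.cls_surj f'
  dsimp only at hs ht h
  subst hs ht h
  change (of S f + of S f') ⊚ of S g = of S f ⊚ of S g + of S f' ⊚ of S g
  simp only [← of_comp, ← of_add]
  exact of_eq_of (.add_comp f f' g)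

theorem comp_add (f g g' : Mor S) (hs : g.src = g'.src) (ht : g.tgt = g'.tgt)
    (h : f.tgt = g.src) : f ⊚ (g + g') = f ⊚ g + f ⊚ g' := by
  obtain ⟨X, Y, f⟩ := f
  obtain ⟨X', Y', g⟩ := g
  obtain ⟨_, Z, g'⟩ := g'
  obtain ⟨f, rfl⟩ := Presented.cls_surj f
  obtain ⟨g, rfl⟩ := Presented.cls_surj g
  obtain ⟨g', rfl⟩ := Presented.cls_surj g'
  dsimp only at hs ht h
  subst hs ht h
  change of S f ⊚ (of S g + of S g') = of S f ⊚ of S g + of S f ⊚ of S g'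
  simp only [← of_comp, ← of_add]
  exact of_eq_of (.comp_add f g g')

theorem add_mul (f f' g : Mor S) (hs : f.src = f'.src) (ht : f.tgt = f'.tgt) :
    (f + f') * g = f * g + f' * g := by
  obtain ⟨X, Y, f⟩ := f
  obtain ⟨X', Y', f'⟩ := f'
  obtain ⟨Z', Z, g⟩ := g
  obtain ⟨f, rfl⟩ := Presented.cls_surj f
  obtain ⟨g, rfl⟩ := Presented.cls_surj g
  obtain ⟨f', rfl⟩ := Presented.cls_surj f'
  dsimp only at hs ht
  subst hs ht
  change (of S f + of S f') * of S g = of S f * of S g + of S f' * of S g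
  simp only [← of_tensor, ← of_add]
  exact of_eq_of (.add_tensor f f' g)

theorem mul_add (f g g' : Mor S) (hs : g.src = g'.src) (ht : g.tgt = g'.tgt) :
    f * (g + g') = f * g + f * g' := by
  obtain ⟨X, Y, f⟩ := f
  obtain ⟨X', Y', g⟩ := g
  obtain ⟨Z', Z, g'⟩ := g'
  obtain ⟨f, rfl⟩ := Presented.cls_surj f
  obtain ⟨g, rfl⟩ := Presented.cls_surj g
  obtain ⟨g', rfl⟩ := Presented.cls_surj g'
  dsimp only at hs ht
  subst hs ht
  change of S f * (of S g + of S g') = of S f * of S g + of S f * of S g'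
  simp only [← of_tensor, ← of_add]
  exact of_eq_of (.tensor_add f g g')

theorem smul_add_smul (r s : R) (f : Mor S) : r • f + s • f = (r + s) • f := by
  obtain ⟨X, Y, f⟩ := f
  obtain ⟨f, rfl⟩ := Presented.cls_surj f
  change of S (smul r f) + of S (smul s f) = of S (smul (r + s) f)
  rw [← of_add]
  exact of_eq_of (.symm (.add_smul r s f))

/-! ### Translation of derived diagrams, and the interchange law -/

theorem of_cast {X Y X' Y' : Word} (f : Diag R X Y) (hX : X' = X) (hY : Y = Y') :
    of S (f.cast hX hY) = of S f := by
  subst hX hY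
  exact of_eq_of ((Equivalent.id_comp _).trans (.comp_id _))

theorem of_seq {X Y Y' Z : Word} (f : Diag R X Y) (g : Diag R Y' Z) (h : Y = Y') :
    of S (f.seq g h) = of S f ⊚ of S g := by
  subst h
  rw [← of_comp]
  exact of_eq_of (.comp_congr (.refl _) (.id_comp _))

theorem of_whisk (A : Word) {X Y : Word} (f : Diag R X Y) (B : Word) :
    of S (whisk A f B) = I A * of S f * I B := rfl

theorem of_idd (X : Word) : of S (idd X) = I X := rfl

theorem I_mul_comp (X : Word) (f g : Mor S) (h : f.tgt = g.src) :
    I X * (f ⊚ g) = (I X * f) ⊚ (I X * g) := by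
  rw [mul_comp_mul _ _ _ _ rfl h, comp_id (I X) (I_tgt X)]

theorem comp_mul_I (X : Word) (f g : Mor S) (h : f.tgt = g.src) :
    (f ⊚ g) * I X = (f * I X) ⊚ (g * I X) := by
  rw [mul_comp_mul _ _ _ _ h rfl, comp_id (I X) (I_tgt X)]

/-- Exchange of the heights of two morphisms next to each other. -/
theorem exchange (f g : Mor S) {X Y X' Y' : Word} (hX : f.src = X) (hY : f.tgt = Y)
    (hX' : g.src = X') (hY' : g.tgt = Y') :
    (f * I X') ⊚ (I Y * g) = (I X * g) ⊚ (f * I Y') := by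
  subst hX hY hX' hY'
  rw [mul_comp_mul _ _ _ _ rfl rfl, mul_comp_mul _ _ _ _ rfl rfl, comp_id _ rfl, id_comp _ rfl,
    comp_id _ rfl, id_comp _ rfl]

/-- Rewriting inside a composite. -/
theorem comp_eq_comp {f g f' g' : Mor S} (e : f ⊚ g = f' ⊚ g') (h : Mor S) :
    f ⊚ g ⊚ h = f' ⊚ g' ⊚ h := by
  rw [← comp_assoc, e, comp_assoc]

end Mor

end Mor

section Trace

variable {R : Type u} [CommRing R] {S : Relations R}

open Mor

/-! ### Partial traces -/

/-- A morphism slides along a cup and becomes its mate. -/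
theorem cup_comp_mate {L L' P Q : Word} {c e cP t : Mor S} (hcs : c.src = [])
    (hct : c.tgt = L ++ L')
    (hes : e.src = L' ++ L) (zig : (c * I L) ⊚ (I L * e) = I L)
    (hts : t.src = P) (htt : t.tgt = L) (hPs : cP.src = []) (hPt : cP.tgt = P ++ Q) :
    c ⊚ (I L * ((I L' * cP) ⊚ (I L' * t * I Q) ⊚ (e * I Q))) = cP ⊚ (t * I Q) := by
  rw [I_mul_comp _ _ _ (by simp [*]), I_mul_comp _ _ _ (by simp [*])]
  simp only [← mul_assoc, ← I_append]
  -- The cup `c` is raised past `cP` and `t` until it meets `e`, where the zigzag straightens.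
  have h₁ : c ⊚ (I (L ++ L') * cP) = cP ⊚ (c * I (P ++ Q)) := by
    simpa [I_nil] using exchange c cP hcs hct hPs hPt
  have h₂ : (c * I (P ++ Q)) ⊚ (I (L ++ L') * t * I Q) = (t * I Q) ⊚ (c * I (L ++ Q)) := by
    simpa [I_nil, mul_assoc] using exchange c (t * I Q) hcs hct (X' := P ++ Q) (Y' := L ++ Q)
      (by simp [*]) (by simp [*])
  have h₃ : (c * I (L ++ Q)) ⊚ (I L * e * I Q) = I (L ++ Q) := by
    rw [I_append, ← mul_assoc, ← comp_mul_I _ _ _ (by simp [*]), zig]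
  rw [comp_eq_comp h₁, comp_eq_comp h₂, h₃, comp_id _ (by simp [*])]

/-- A morphism slides along a cap and becomes its mate. -/
theorem mate_comp_cap {L L' P Q : Word} {e cP eP t : Mor S}
    (hes : e.src = L ++ L') (het : e.tgt = []) (zig : (I P * cP) ⊚ (eP * I P) = I P)
    (hts : t.src = P) (htt : t.tgt = L) (hPt : cP.tgt = Q ++ P)
    (hEs : eP.src = P ++ Q) (hEt : eP.tgt = []) :
    (I P * ((cP * I L') ⊚ (I Q * t * I L') ⊚ (I Q * e))) ⊚ eP = (t * I L') ⊚ e := by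
  rw [I_mul_comp _ _ _ (by simp [*]), I_mul_comp _ _ _ (by simp [*])]
  simp only [← mul_assoc, ← I_append]
  simp only [comp_assoc]
  -- The cap `eP` is lowered past `e` and `t` until it meets `cP`, where the zigzag straightens.
  have h₁ : (I (P ++ Q) * e) ⊚ eP = (eP * I (L ++ L')) ⊚ e := by
    simpa [I_nil] using (exchange eP e hEs hEt hes het).symm
  have h₂ : (I (P ++ Q) * t * I L') ⊚ (eP * I (L ++ L')) = (eP * I (P ++ L')) ⊚ (t * I L') := by
    simpa [I_nil, mul_assoc] using (exchange eP (t * I L') hEs hEt (X' := P ++ L') (Y' := L ++ L')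
      (by simp [*]) (by simp [*])).symm
  have h₃ : (I P * cP * I L') ⊚ (eP * I (P ++ L')) = I (P ++ L') := by
    rw [I_append, ← mul_assoc, ← comp_mul_I _ _ _ (by simp [*]), zig]
  rw [h₁, comp_eq_comp h₂, ← comp_assoc, h₃, id_comp _ (by simp [*])]

/-- Mirror image of `cup_comp_mate`. -/
theorem cup_comp_mate_left {L L' P Q : Word} {c e cP t : Mor S} (hcs : c.src = [])
    (hct : c.tgt = L' ++ L) (hes : e.src = L ++ L') (zig : (I L * c) ⊚ (e * I L) = I L)
    (hts : t.src = P) (htt : t.tgt = L) (hPs : cP.src = []) (hPt : cP.tgt = Q ++ P) :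
    c ⊚ (((cP * I L') ⊚ (I Q * t * I L') ⊚ (I Q * e)) * I L) = cP ⊚ (I Q * t) := by
  rw [comp_mul_I _ _ _ (by simp [*]), comp_mul_I _ _ _ (by simp [*])]
  simp only [mul_assoc, ← I_append]
  have h₁ : c ⊚ (cP * I (L' ++ L)) = cP ⊚ (I (Q ++ P) * c) := by
    simpa [I_nil] using (exchange cP c hPs hPt hcs hct).symm
  have h₂ : (I (Q ++ P) * c) ⊚ (I Q * (t * I (L' ++ L))) = (I Q * t) ⊚ (I (Q ++ L) * c) := by
    rw [← mul_assoc]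
    simpa [I_nil] using (exchange (I Q * t) c (X := Q ++ P) (Y := Q ++ L)
      (by simp [*]) (by simp [*]) hcs hct).symm
  have h₃ : (I (Q ++ L) * c) ⊚ (I Q * (e * I L)) = I (Q ++ L) := by
    rw [I_append, mul_assoc, ← I_mul_comp _ _ _ (by simp [*]), zig]
  rw [comp_eq_comp h₁, comp_eq_comp h₂, h₃, comp_id _ (by simp [*])]

/-- Mirror image of `mate_comp_cap`. -/
theorem mate_comp_cap_left {L L' P Q : Word} {e cP eP t : Mor S}
    (hes : e.src = L' ++ L) (het : e.tgt = []) (zig : (cP * I P) ⊚ (I P * eP) = I P)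
    (hts : t.src = P) (htt : t.tgt = L) (hPt : cP.tgt = P ++ Q)
    (hEs : eP.src = Q ++ P) (hEt : eP.tgt = []) :
    (((I L' * cP) ⊚ (I L' * t * I Q) ⊚ (e * I Q)) * I P) ⊚ eP = (I L' * t) ⊚ e := by
  rw [comp_mul_I _ _ _ (by simp [*]), comp_mul_I _ _ _ (by simp [*])]
  simp only [mul_assoc, ← I_append]
  simp only [comp_assoc]
  have h₁ : (e * I (Q ++ P)) ⊚ eP = (I (L' ++ L) * eP) ⊚ e := by
    simpa [I_nil] using exchange e eP hes het hEs hEt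
  have h₂ : (I L' * (t * I (Q ++ P))) ⊚ (I (L' ++ L) * eP) = (I (L' ++ P) * eP) ⊚ (I L' * t) := by
    rw [← mul_assoc]
    simpa [I_nil] using exchange (I L' * t) eP (X := L' ++ P) (Y := L' ++ L)
      (by simp [*]) (by simp [*]) hEs hEt
  have h₃ : (I L' * (cP * I P)) ⊚ (I (L' ++ P) * eP) = I (L' ++ P) := by
    rw [I_append, mul_assoc, ← I_mul_comp _ _ _ (by simp [*]), zig]
  rw [h₁, comp_eq_comp h₂, ← comp_assoc, h₃, id_comp _ (by simp [*])]

/-- The closure of `g ⊚ (K * t)` by strands on the right equals the closure of `(K * t) ⊚ g`,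
provided that the mates of `t` on both sides agree. -/
theorem trace_cyclic {K L L' P Q : Word} {t g c e e' cP cP' eP : Mor S}
    (hts : t.src = P) (htt : t.tgt = L) (hgs : g.src = K ++ L) (hgt : g.tgt = K ++ P)
    (hcs : c.src = [])
    (hct : c.tgt = L ++ L') (hes : e.src = L' ++ L)
    (hes' : e'.src = L ++ L') (het' : e'.tgt = [])
    (hPs : cP.src = []) (hPt : cP.tgt = P ++ Q) (hPt' : cP'.tgt = Q ++ P)
    (hEs : eP.src = P ++ Q) (hEt : eP.tgt = [])
    (zigL : (c * I L) ⊚ (I L * e) = I L) (zigP : (I P * cP') ⊚ (eP * I P) = I P)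
    (rot : (I L' * cP) ⊚ (I L' * t * I Q) ⊚ (e * I Q) =
      (cP' * I L') ⊚ (I Q * t * I L') ⊚ (I Q * e'))
    (hrt : e.tgt = []) :
    (I K * c) ⊚ ((g ⊚ (I K * t)) * I L') ⊚ (I K * e') =
      (I K * cP) ⊚ (((I K * t) ⊚ g) * I Q) ⊚ (I K * eP) := by
  have h₁ := cup_comp_mate hcs hct hes zigL hts htt hPs hPt
  have h₂ := mate_comp_cap hes' het' zigP hts htt hPt' hEs hEt
  rw [← rot] at h₂
  -- `r : L' ⟶ Q` is the common mate of `t` on the closing strand. Below, `t` is pulled over the cap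
  -- into `r` by `h₂`, `r` slides down past `g`, and `h₁` pulls it out at the cup as `t`, now below
  -- `g`.
  set r := (I L' * cP) ⊚ (I L' * t * I Q) ⊚ (e * I Q) with hr
  have hrs : r.src = L' := by simp [hr, hPs]
  have hrt : r.tgt = Q := by simp [hr, hrt]
  rw [comp_mul_I _ _ _ (by simp [*]), comp_mul_I _ _ _ (by simp [*]), comp_assoc, comp_assoc,
    mul_assoc (I K) t, mul_assoc (I K) t, ← I_mul_comp _ (t * I L') e' (by simp [*]), ← h₂,
    I_mul_comp _ _ eP (by simp [hrt, hEs]), ← mul_assoc (I K) (I P), ← I_append,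
    comp_eq_comp (exchange g r hgs hgt hrs hrt), ← comp_assoc, I_append, mul_assoc (I K) (I L),
    ← I_mul_comp _ c _ (by simp [hct, hrs]), h₁, I_mul_comp _ _ _ (by simp [*]), comp_assoc]

/-- The closure of `g ⊚ (t * K)` by strands on the left equals the closure of `(t * K) ⊚ g`,
provided that the mates of `t` on both sides agree. -/
theorem trace_cyclic_left {K L L' P Q : Word} {t g c e e' cP cP' eP : Mor S}
    (hts : t.src = P) (htt : t.tgt = L) (hgs : g.src = L ++ K) (hgt : g.tgt = P ++ K)
    (hcs : c.src = []) (hct : c.tgt = L' ++ L) (hes : e.src = L ++ L')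
    (hes' : e'.src = L' ++ L) (het' : e'.tgt = [])
    (hPs : cP.src = []) (hPt : cP.tgt = Q ++ P) (hPt' : cP'.tgt = P ++ Q)
    (hEs : eP.src = Q ++ P) (hEt : eP.tgt = [])
    (zigL : (I L * c) ⊚ (e * I L) = I L) (zigP : (cP' * I P) ⊚ (I P * eP) = I P)
    (rot : (I L' * cP') ⊚ (I L' * t * I Q) ⊚ (e' * I Q) =
      (cP * I L') ⊚ (I Q * t * I L') ⊚ (I Q * e))
    (hrt : e.tgt = []) :
    (c * I K) ⊚ (I L' * (g ⊚ (t * I K))) ⊚ (e' * I K) =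
      (cP * I K) ⊚ (I Q * ((t * I K) ⊚ g)) ⊚ (eP * I K) := by
  have h₁ := cup_comp_mate_left hcs hct hes zigL hts htt hPs hPt
  have h₂ := mate_comp_cap_left hes' het' zigP hts htt hPt' hEs hEt
  rw [rot] at h₂
  set r := (cP * I L') ⊚ (I Q * t * I L') ⊚ (I Q * e) with hr
  have hrs : r.src = L' := by simp [hr, hPs]
  have hrt : r.tgt = Q := by simp [hr, hrt]
  rw [I_mul_comp _ _ _ (by simp [*]), I_mul_comp _ _ _ (by simp [*]), comp_assoc, comp_assoc,
    ← mul_assoc _ t (I K), ← mul_assoc _ t (I K), ← comp_mul_I _ (I L' * t) e' (by simp [*]), ← h₂,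
    comp_mul_I _ _ eP (by simp [*]), mul_assoc _ (I P) (I K), ← I_append,
    comp_eq_comp (exchange r g hrs hrt hgs hgt).symm, ← comp_assoc, I_append, ← mul_assoc _ (I L) (I K),
    ← comp_mul_I _ c _ (by simp [*]), h₁, comp_mul_I _ _ _ (by simp [*]), comp_assoc]

end Trace

section Digons

variable {R : Type u} [CommRing R] {S : Relations R}

open Mor

/-! ### Consequences of the basic relations -/

/-- By interchange (`h₄`) the inner cup and cap decouple, which leaves the zigzag of `B` followed by
that of `A`. This supplies the duality of a word of two strands to the partial trace. -/
theorem zigzag_nested {A A' B B' : Word} {cA eA cB eB : Mor S}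
    (hcA : cA.src = []) (hcA' : cA.tgt = A' ++ A) (heA : eA.src = A ++ A')
    (hcB' : cB.tgt = B' ++ B) (heB : eB.src = B ++ B') (heB' : eB.tgt = [])
    (zA : (I A * cA) ⊚ (eA * I A) = I A) (zB : (I B * cB) ⊚ (eB * I B) = I B) :
    (I (A ++ B) * (cB ⊚ (I B' * cA * I B))) ⊚ (((I A * eB * I A') ⊚ eA) * I (A ++ B)) =
      I (A ++ B) := by
  have h₁ : (I (B ++ B') * cA) ⊚ (eB * I (A' ++ A)) = eB ⊚ cA := by
    simpa [I_nil] using (exchange eB cA heB heB' hcA hcA').symm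
  have h₂ : (I (A ++ B) * cB) ⊚ (I A * eB * I B) = I (A ++ B) := by
    rw [I_append, mul_assoc, mul_assoc, ← I_mul_comp _ _ _ (by simp [*]), zB]
  have h₃ : (I A * cA * I B) ⊚ (eA * I (A ++ B)) = I (A ++ B) := by
    rw [I_append, ← mul_assoc, ← comp_mul_I _ _ _ (by simp [*]), zA]
  have h₄ : (I (A ++ B) * (I B' * cA * I B)) ⊚ (I A * eB * I A' * I (A ++ B)) =
      (I A * eB * I B) ⊚ (I A * cA * I B) := by
    rw [← comp_mul_I _ _ _ (by simp [*]), ← I_mul_comp _ _ _ (by simp [*]), ← h₁,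
      I_mul_comp _ _ _ (by simp [*]), comp_mul_I _ _ _ (by simp [*])]
    simp only [I_append, mul_assoc]
  rw [I_mul_comp _ _ _ (by simp [*]), comp_mul_I _ _ _ (by simp [*]), comp_assoc,
    comp_eq_comp h₄, ← comp_assoc, h₂, h₃, id_comp _ (I_src _).symm]

/-- Same decoupling for the other orientation: the zigzag of `A`, then that of `B`. -/
theorem zigzag_nested_right {A A' B B' : Word} {cA eA cB eB : Mor S}
    (hcA' : cA.tgt = A ++ A') (heA : eA.src = A' ++ A) (heA' : eA.tgt = [])
    (hcB : cB.src = []) (hcB' : cB.tgt = B ++ B') (heB : eB.src = B' ++ B)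
    (zA : (cA * I A) ⊚ (I A * eA) = I A) (zB : (cB * I B) ⊚ (I B * eB) = I B) :
    ((cA ⊚ (I A * cB * I A')) * I (A ++ B)) ⊚ (I (A ++ B) * ((I B' * eA * I B) ⊚ eB)) =
      I (A ++ B) := by
  have h₁ : (cB * I (A' ++ A)) ⊚ (I (B ++ B') * eA) = eA ⊚ cB := by
    simpa [I_nil] using exchange cB eA hcB hcB' heA heA'
  have h₂ : (cA * I (A ++ B)) ⊚ (I A * eA * I B) = I (A ++ B) := by
    rw [I_append, ← mul_assoc, ← comp_mul_I _ _ _ (by simp [*]), zA]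
  have h₃ : (I A * cB * I B) ⊚ (I (A ++ B) * eB) = I (A ++ B) := by
    rw [I_append, mul_assoc, mul_assoc, ← I_mul_comp _ _ _ (by simp [*]), zB]
  have h₄ : (I A * cB * I A' * I (A ++ B)) ⊚ (I (A ++ B) * (I B' * eA * I B)) =
      (I A * eA * I B) ⊚ (I A * cB * I B) := by
    rw [← comp_mul_I _ _ _ (by simp [*]), ← I_mul_comp _ _ _ (by simp [*]), ← h₁,
      I_mul_comp _ _ _ (by simp [*]), comp_mul_I _ _ _ (by simp [*])]
    simp only [I_append, mul_assoc]
  rw [I_mul_comp _ _ _ (by simp [*]), comp_mul_I _ _ _ (by simp [*]), comp_assoc,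
    comp_eq_comp h₄, ← comp_assoc, h₂, h₃, id_comp _ (I_src _).symm]

theorem of_rungL (b : ℕ) {k l k' l' : ℕ} (h : k' = k + b) (h' : l = b + l') :
    of S (rungL b k l k' l') =
      (I (up k) * of S (split b l')) ⊚ (of S (merge k b) * I (up l')) := by
  subst h h'
  rw [rungL, dif_pos ⟨rfl, rfl⟩]
  erw [of_seq]
  simp only [of_tensor, of_comp, of_eqHom, of_idd]
  rw [id_comp _ (of_src _).symm, comp_id _ (of_tgt _)]

theorem of_rungR (b : ℕ) {k l k' l' : ℕ} (h : k = k' + b) (h' : l' = b + l) :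
    of S (rungR b k l k' l') =
      (of S (split k' b) * I (up l)) ⊚ (I (up k') * of S (merge b l)) := by
  subst h h'
  rw [rungR, dif_pos ⟨rfl, rfl⟩]
  erw [of_seq]
  simp only [of_tensor, of_comp, of_eqHom, of_idd]
  rw [id_comp _ (of_src _).symm, comp_id _ (of_tgt _)]

/-- Solves the square switch for its second product, as needed for loops on the right. -/
theorem Equivalent.eq_sub {X Y : Word} {f g h : Diag R X Y}
    (e : Equivalent S (add f (smul (-1) g)) h) : Equivalent S g (add f (smul (-1) h)) := by
  have e' := Presented.sound e
  refine Quotient.exact (s := Presented.setoid S X Y) ?_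
  change Presented.cls S g = Presented.cls S f + (-1 : R) • Presented.cls S h
  rw [← e', Presented.cls_add, Presented.cls_smul, neg_one_smul, neg_one_smul]
  abel

/-- Solves the square switch for its first product, as needed for loops on the left. -/
theorem Equivalent.eq_add {X Y : Word} {f g h : Diag R X Y}
    (e : Equivalent S (add f (smul (-1) g)) h) : Equivalent S f (add g h) := by
  have e' := Presented.sound e
  refine Quotient.exact (s := Presented.setoid S X Y) ?_
  change Presented.cls S f = Presented.cls S g + Presented.cls S h
  rw [← e', Presented.cls_add, Presented.cls_smul, neg_one_smul]
  abel

/-! ### The basic relations as equations between packaged morphisms -/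

variable {q : Rˣ}

/-- The relations `S` contain the basic ones. -/
def HasBasic (S : Relations R) (q : Rˣ) : Prop :=
  ∀ ⦃X Y : Word⦄ ⦃f g : Diag R X Y⦄, BasicRel q X Y f g → S X Y f g

namespace HasBasic

theorem zigzag_up_R (hS : HasBasic S q) (k : ℕ) :
    (of S (cupR k) * I (up k)) ⊚ (I (up k) * of S (capR k)) = I (up k) := by
  have := of_eq_of (.of (hS (.zigzag_up_R k)))
  erw [of_cast, of_seq] at this
  simpa only [of_whisk, I_nil, one_mul, mul_one, of_idd] using this

theorem zigzag_up_L (hS : HasBasic S q) (k : ℕ) :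
    (I (up k) * of S (cupL k)) ⊚ (of S (capL k) * I (up k)) = I (up k) := by
  have := of_eq_of (.of (hS (.zigzag_up_L k)))
  erw [of_cast, of_seq] at this
  simpa only [of_whisk, I_nil, one_mul, mul_one, of_idd] using this

theorem zigzag_dn_R (hS : HasBasic S q) (k : ℕ) :
    (I (dn k) * of S (cupR k)) ⊚ (of S (capR k) * I (dn k)) = I (dn k) := by
  have := of_eq_of (.of (hS (.zigzag_dn_R k)))
  erw [of_cast, of_seq] at this
  simpa only [of_whisk, I_nil, one_mul, mul_one, of_idd] using this

theorem zigzag_dn_L (hS : HasBasic S q) (k : ℕ) :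
    (of S (cupL k) * I (dn k)) ⊚ (I (dn k) * of S (capL k)) = I (dn k) := by
  have := of_eq_of (.of (hS (.zigzag_dn_L k)))
  erw [of_cast, of_seq] at this
  simpa only [of_whisk, I_nil, one_mul, mul_one, of_idd] using this

/-- Written with nested cups, in the shape of the hypothesis `rot` of `trace_cyclic` and
`trace_cyclic_left`: the two mates of the merge vertex agree. -/
theorem merge_rot (hS : HasBasic S q) (k l : ℕ) :
    (I (dn (k + l)) * (of S (cupR k) ⊚ (I (up k) * of S (cupR l) * I (dn k)))) ⊚
        (I (dn (k + l)) * of S (merge k l) * I (dn l ++ dn k)) ⊚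
        (of S (capR (k + l)) * I (dn l ++ dn k)) =
      ((of S (cupL l) ⊚ (I (dn l) * of S (cupL k) * I (up l))) * I (dn (k + l))) ⊚
        (I (dn l ++ dn k) * of S (merge k l) * I (dn (k + l))) ⊚
        (I (dn l ++ dn k) * of S (capL (k + l))) := by
  have := of_eq_of (.of (hS (.merge_rot k l)))
  rw [mergeRotR, mergeRotL] at this
  erw [of_cast, of_cast, of_seq, of_seq, of_seq, of_seq, of_seq, of_seq] at this
  simp only [of_whisk, I_nil, one_mul, mul_one] at this
  rw [I_mul_comp _ _ _ (by simp), comp_mul_I _ _ _ (by simp)]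
  simp only [I_append, mul_assoc, comp_assoc] at this ⊢
  exact this

theorem merge_assoc (hS : HasBasic S q) (k l r : ℕ) :
    (of S (merge k l) * I (up r)) ⊚ of S (merge (k + l) r) =
      (I (up k) * of S (merge l r)) ⊚ of S (merge k (l + r)) := by
  have := of_eq_of (.of (hS (.merge_assoc k l r)))
  erw [of_cast, of_seq, of_seq] at this
  simpa only [of_tensor, of_idd] using this

theorem split_assoc (hS : HasBasic S q) (k l r : ℕ) :
    of S (split (k + l) r) ⊚ (of S (split k l) * I (up r)) =
      of S (split k (l + r)) ⊚ (I (up k) * of S (split l r)) := by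
  have := of_eq_of (.of (hS (.split_assoc k l r)))
  erw [of_cast, of_seq, of_seq] at this
  simpa only [of_tensor, of_idd] using this

theorem digon (hS : HasBasic S q) (k l : ℕ) : of S (split k l) ⊚ of S (merge k l) =
    (((q ^ (-((k : ℤ) * l)) : Rˣ) : R) * qBinom q (k + l) k) • I (up (k + l)) := by
  have := of_eq_of (.of (hS (.digon k l)))
  simpa only [of_comp, of_smul, of_idd] using this

theorem merge_zero_left (hS : HasBasic S q) (l : ℕ) : of S (merge 0 l) = I (up l) :=
  (of_eq_of (.of (hS (.merge_zero_left l)))).trans (of_eqHom _)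

theorem merge_zero_right (hS : HasBasic S q) (k : ℕ) : of S (merge k 0) = I (up k) :=
  ((of_eq_of (.of (hS (.merge_zero_right k)))).trans (of_eqHom _)).trans (by simp [up])

theorem split_zero_left (hS : HasBasic S q) (l : ℕ) : of S (split 0 l) = I (up l) :=
  ((of_eq_of (.of (hS (.split_zero_left l)))).trans (of_eqHom _)).trans (by simp)

theorem split_zero_right (hS : HasBasic S q) (k : ℕ) : of S (split k 0) = I (up k) :=
  (of_eq_of (.of (hS (.split_zero_right k)))).trans (of_eqHom _)

end HasBasic

end Digons

section SidewayDigons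

variable {R : Type u} [CommRing R] {S : Relations R}

open Mor

/-! ### Sideway digons -/

/-- Exhibits the sideway digon as a partial trace of merge followed by split, the form to which the
trace lemmas apply. -/
theorem of_digonR (k l : ℕ) : of S (digonR k l) =
    (I (up k) * of S (cupR l)) ⊚ ((of S (merge k l) ⊚ of S (split k l)) * I (dn l)) ⊚
      (I (up k) * of S (capL l)) := by
  rw [digonR]
  erw [of_cast, of_seq, of_seq, of_seq]
  rw [comp_mul_I _ _ _ rfl]
  simp only [of_whisk, I_nil, one_mul, mul_one, comp_assoc]

theorem of_digonL (k l : ℕ) : of S (digonL k l) =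
    (of S (cupL l) * I (up k)) ⊚ (I (dn l) * (of S (merge l k) ⊚ of S (split l k))) ⊚
      (of S (capR l) * I (up k)) := by
  rw [digonL]
  erw [of_cast, of_seq, of_seq, of_seq]
  rw [I_mul_comp _ _ _ rfl]
  simp only [of_whisk, I_nil, one_mul, mul_one, comp_assoc]

/-- Morphisms on the left of a cup and a cap leave the partial trace. -/
theorem trace_comp {X Y X' Y' A A' : Word} {s f t c e : Mor S} (hss : s.src = X)
    (hst : s.tgt = X') (hfs : f.src = X' ++ A) (hft : f.tgt = Y' ++ A) (hts : t.src = Y')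
    (htt : t.tgt = Y) (hcs : c.src = []) (hct : c.tgt = A ++ A') (hes : e.src = A ++ A')
    (het : e.tgt = []) :
    (I X * c) ⊚ (((s * I A) ⊚ f ⊚ (t * I A)) * I A') ⊚ (I Y * e) =
      s ⊚ ((I X' * c) ⊚ (f * I A') ⊚ (I Y' * e)) ⊚ t := by
  have h₁ : (I X * c) ⊚ (s * I (A ++ A')) = s ⊚ (I X' * c) := by
    simpa [I_nil] using (exchange s c hss hst hcs hct).symm
  have h₂ : (t * I (A ++ A')) ⊚ (I Y * e) = (I Y' * e) ⊚ t := by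
    simpa [I_nil] using exchange t e hts htt hes het
  rw [comp_mul_I _ _ _ (by simp [*]), comp_mul_I _ _ _ (by simp [*]), mul_assoc, ← I_append,
    mul_assoc t, ← I_append, comp_assoc, comp_assoc, h₂, comp_eq_comp h₁]
  simp only [comp_assoc]

theorem trace_comp_left {X Y X' Y' A A' : Word} {s f t c e : Mor S} (hss : s.src = X)
    (hst : s.tgt = X') (hfs : f.src = A ++ X') (hft : f.tgt = A ++ Y') (hts : t.src = Y')
    (htt : t.tgt = Y) (hcs : c.src = []) (hct : c.tgt = A' ++ A) (hes : e.src = A' ++ A)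
    (het : e.tgt = []) :
    (c * I X) ⊚ (I A' * ((I A * s) ⊚ f ⊚ (I A * t))) ⊚ (e * I Y) =
      s ⊚ ((c * I X') ⊚ (I A' * f) ⊚ (e * I Y')) ⊚ t := by
  have h₁ : (c * I X) ⊚ (I (A' ++ A) * s) = s ⊚ (c * I X') := by
    simpa [I_nil] using exchange c s hcs hct hss hst
  have h₂ : (I (A' ++ A) * t) ⊚ (e * I Y) = (e * I Y') ⊚ t := by
    simpa [I_nil] using (exchange e t hes het hts htt).symm
  rw [I_mul_comp _ _ _ (by simp [*]), I_mul_comp _ _ _ (by simp [*]), ← mul_assoc, ← I_append,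
    ← mul_assoc _ _ t, ← I_append, comp_assoc, comp_assoc, h₂, comp_eq_comp h₁]
  simp only [comp_assoc]

/-- Partial traces are linear. -/
theorem trace_linear {X A A' : Word} {f g c e : Mor S} (r : R)
    (hfs : f.src = X ++ A) (hft : f.tgt = X ++ A) (hgs : g.src = X ++ A) (hgt : g.tgt = X ++ A)
    (hct : c.tgt = A ++ A') (hes : e.src = A ++ A') :
    (I X * c) ⊚ ((f + r • g) * I A') ⊚ (I X * e) =
      (I X * c) ⊚ (f * I A') ⊚ (I X * e) + r • ((I X * c) ⊚ (g * I A') ⊚ (I X * e)) := by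
  rw [add_mul _ _ _ (by simp [*]) (by simp [*]), add_comp _ _ _ (by simp [*]) (by simp [*])
    (by simp [*]), comp_add _ _ _ (by simp [*]) (by simp [*]) (by simp [*]), smul_mul, smul_comp,
    comp_smul]

theorem trace_linear_left {X A A' : Word} {f g c e : Mor S} (r : R)
    (hfs : f.src = A ++ X) (hft : f.tgt = A ++ X) (hgs : g.src = A ++ X) (hgt : g.tgt = A ++ X)
    (hct : c.tgt = A' ++ A) (hes : e.src = A' ++ A) :
    (c * I X) ⊚ (I A' * (f + r • g)) ⊚ (e * I X) =
      (c * I X) ⊚ (I A' * f) ⊚ (e * I X) + r • ((c * I X) ⊚ (I A' * g) ⊚ (e * I X)) := by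
  rw [mul_add _ _ _ (by simp [*]) (by simp [*]), add_comp _ _ _ (by simp [*]) (by simp [*])
    (by simp [*]), comp_add _ _ _ (by simp [*]) (by simp [*]) (by simp [*]), mul_smul_right, smul_comp,
    comp_smul]

/-- An identity strand closes up to a free circle, of value `γ`. -/
theorem trace_id {X A A' : Word} {c e : Mor S} (hct : c.tgt = A ++ A')
    (hes : e.src = A ++ A') (γ : R) (h : c ⊚ e = γ • 1) :
    (I X * c) ⊚ (I (X ++ A) * I A') ⊚ (I X * e) = γ • I X := by
  rw [I_append, mul_assoc, ← I_append A A', ← I_append, id_comp _ (by simp [*]),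
    ← I_mul_comp _ _ _ (by simp [*]), h, mul_smul_right, mul_one]

theorem trace_id_left {X A A' : Word} {c e : Mor S} (hct : c.tgt = A' ++ A)
    (hes : e.src = A' ++ A) (γ : R) (h : c ⊚ e = γ • 1) :
    (c * I X) ⊚ (I A' * I (A ++ X)) ⊚ (e * I X) = γ • I X := by
  rw [I_append, ← mul_assoc, ← I_append A' A, ← I_append, id_comp _ (by simp [*]),
    ← comp_mul_I _ _ _ (by simp [*]), h, smul_mul, one_mul]

variable {q : Rˣ}

namespace HasBasic

/-- Square switch on uprights `m + 1` and `1`. Moving `1` to the left empties the right upright, so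
that product is merge followed by split; in the other product the two middle rungs meet in a
dumbbell of `1`-strands. -/
theorem dumbbell_right (hS : HasBasic S q) (m : ℕ) :
    of S (merge (m + 1) 1) ⊚ of S (split (m + 1) 1) =
    ((of S (split m 1) * I (up 1)) ⊚ (I (up m) * of S dumbbell) ⊚ (of S (merge m 1) * I (up 1))) +
      (-1 : R) • (((q ^ (1 - ((m + 1 : ℕ) : ℤ) + (1 : ℕ)) : Rˣ) : R) *
        qInt q (((m + 1 : ℕ) : ℤ) - (1 : ℕ))) • I (up (m + 1) ++ up 1) := by
  have h := of_eq_of (Equivalent.eq_sub (.of (hS (.square_switch (m + 1) 1))))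
  have n : (I (up 0) : Mor S) = 1 := rfl
  rw [of_add, of_smul, of_smul, of_idd, of_comp, of_comp, of_rungL 1 (by omega) (by omega),
    of_rungR 1 (by omega) (by omega), of_rungR 1 (by omega) (by omega),
    of_rungL 1 (by omega) (by omega)] at h
  rw [Nat.add_sub_cancel, Nat.sub_self] at h
  rw [hS.split_zero_right, hS.merge_zero_right, n, mul_one, mul_one, ← I_append,
    id_comp _ (by simp), comp_id _ (by simp)] at h
  rw [h, dumbbell, of_comp, I_mul_comp _ _ _ (by simp)]
  simp only [comp_assoc]

/-- Square switch on uprights `1` and `1 + m`: now moving `1` to the right empties the left upright.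
The label is written `1 + m` to fit the split vertex with `1` on its left. -/
theorem dumbbell_left (hS : HasBasic S q) (m : ℕ) :
    of S (merge 1 (1 + m)) ⊚ of S (split 1 (1 + m)) =
    ((I (up 1) * of S (split 1 m)) ⊚ (of S dumbbell * I (up m)) ⊚ (I (up 1) * of S (merge 1 m))) +
      (((q ^ (1 - ((1 : ℕ) : ℤ) + (1 + m : ℕ)) : Rˣ) : R) *
        qInt q (((1 : ℕ) : ℤ) - (1 + m : ℕ))) • I (up 1 ++ up (1 + m)) := by
  have h := of_eq_of (Equivalent.eq_add (.of (hS (.square_switch 1 (1 + m)))))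
  have n : (I (up 0) : Mor S) = 1 := rfl
  rw [of_add, of_smul, of_idd, of_comp, of_comp, of_rungL 1 (by omega) (by omega),
    of_rungR 1 (by omega) (by omega), of_rungR 1 (by omega) (by omega),
    of_rungL 1 (by omega) (by omega)] at h
  rw [Nat.add_sub_cancel_left, Nat.sub_self] at h
  rw [hS.split_zero_left, hS.merge_zero_left, n, one_mul, one_mul, ← I_append,
    id_comp _ (by simp), comp_id _ (by simp)] at h
  rw [h, dumbbell, of_comp, comp_mul_I _ _ _ (by simp)]
  simp only [comp_assoc]

/-- A sideway digon with a loop labelled `1`. -/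
theorem digonR_one (hS : HasBasic S q) {α γ : R} (hα : of S (digonR 1 1) = α • I (up 1))
    (hγ : of S (circleR 1) = γ • 1) (m : ℕ) :
    of S (digonR (m + 1) 1) =
      (α * (((q ^ (-((m : ℤ) * (1 : ℕ))) : Rˣ) : R) * qBinom q (m + 1) m) -
        ((q ^ (1 - ((m + 1 : ℕ) : ℤ) + (1 : ℕ)) : Rˣ) : R) *
          qInt q (((m + 1 : ℕ) : ℤ) - (1 : ℕ)) * γ) • I (up (m + 1)) := by
  rw [of_digonR, ← of_comp, ← dumbbell] at hα
  rw [circleR, of_comp] at hγ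
  -- Closing the last strand: the identity term contributes the circle `γ`; in the other term the
  -- outer split and merge leave the trace, the dumbbell closes to `α`, and the remaining digon is
  -- removed.
  rw [of_digonR, hS.dumbbell_right, ← smul_smul', trace_linear (A := up 1) _ (by simp) (by simp) (by simp)
    (by simp) (by simp) (by simp), trace_id (by simp) (by simp) γ hγ,
    trace_comp (X' := up m ++ up 1) (Y' := up m ++ up 1) (by simp) (by simp) (by simp)
    (by simp) (by simp) (by simp) (by simp) (by simp) (by simp) (by simp)]
  have e : (I (up m ++ up 1) * of S (cupR 1)) ⊚ (I (up m) * of S dumbbell * I (dn 1)) ⊚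
      (I (up m ++ up 1) * of S (capL 1)) = α • I (up m ++ up 1) := by
    rw [I_append, mul_assoc, mul_assoc, mul_assoc, ← I_mul_comp _ _ _ (by simp),
      ← I_mul_comp _ _ _ (by simp), hα, mul_smul_right]
  rw [e, smul_comp, comp_smul, id_comp _ (by simp), hS.digon, ← smul_smul', ← smul_smul',
    smul_add_smul]
  congr 1
  ring

/-- Mirror of `digonR_one`. The square switch is used with the opposite sign, so the circle term
involves `{-m}`; `zpow_mul_qInt_neg` reconciles the two forms. -/
theorem digonL_one (hS : HasBasic S q) {α γ : R} (hα : of S (digonL 1 1) = α • I (up 1))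
    (hγ : of S (circleL 1) = γ • 1) (m : ℕ) :
    of S (digonL (1 + m) 1) =
      (α * (((q ^ (-(((1 : ℕ) : ℤ) * m)) : Rˣ) : R) * qBinom q (1 + m) 1) +
        ((q ^ (1 - ((1 : ℕ) : ℤ) + (1 + m : ℕ)) : Rˣ) : R) *
          qInt q (((1 : ℕ) : ℤ) - (1 + m : ℕ)) * γ) • I (up (1 + m)) := by
  rw [of_digonL, ← of_comp, ← dumbbell] at hα
  rw [circleL, of_comp] at hγ
  rw [of_digonL, hS.dumbbell_left, trace_linear_left (A := up 1) _ (by simp) (by simp) (by simp)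
    (by simp) (by simp) (by simp), trace_id_left (by simp) (by simp) γ hγ,
    trace_comp_left (X' := up 1 ++ up m) (Y' := up 1 ++ up m) (by simp) (by simp) (by simp)
    (by simp) (by simp) (by simp) (by simp) (by simp) (by simp) (by simp)]
  have e : (of S (cupL 1) * I (up 1 ++ up m)) ⊚ (I (dn 1) * (of S dumbbell * I (up m))) ⊚
      (of S (capR 1) * I (up 1 ++ up m)) = α • I (up 1 ++ up m) := by
    rw [I_append, ← mul_assoc, ← mul_assoc, ← mul_assoc, ← comp_mul_I _ _ _ (by simp),
      ← comp_mul_I _ _ _ (by simp), hα, smul_mul]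
  rw [e, smul_comp, comp_smul, id_comp _ (by simp), hS.digon, ← smul_smul', ← smul_smul',
    smul_add_smul]

/-- The recursion for sideway digons. -/
theorem digonR_succ (hS : HasBasic S q) {β : R} (k l : ℕ)
    (hβ : of S (digonR (k + l) 1) = β • I (up (k + l))) :
    (((q ^ (-((l : ℤ) * (1 : ℕ))) : Rˣ) : R) * qBinom q (l + 1) l) • of S (digonR k (l + 1)) =
      β • of S (digonR k l) := by
  rw [of_digonR] at hβ
  -- `g` opens the loop `l + 1` into strands `l` and `1`. Merging them after `g` leaves an upward
  -- digon on the loop (`e₁`); merging them before `g` produces two nested loops (`e₂`, `e₃`).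
  -- Cyclicity of the trace equates the two closures.
  set g := (of S (merge k (l + 1)) ⊚ of S (split k (l + 1))) ⊚ (I (up k) * of S (split l 1)) with hg
  have h := trace_cyclic (K := up k) (t := of S (merge l 1)) (g := g) rfl rfl (by simp [hg])
    (by simp [hg]) (c := of S (cupR (l + 1))) (e := of S (capR (l + 1)))
    (e' := of S (capL (l + 1))) rfl rfl rfl rfl rfl
    (cP := of S (cupR l) ⊚ (I (up l) * of S (cupR 1) * I (dn l)))
    (cP' := of S (cupL 1) ⊚ (I (dn 1) * of S (cupL l) * I (up 1)))
    (eP := (I (up l) * of S (capL 1) * I (dn l)) ⊚ of S (capL l))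
    (by simp) (Q := dn 1 ++ dn l) (by simp) (by simp) (by simp) (by simp)
    (hS.zigzag_up_R _)
    (zigzag_nested rfl rfl rfl rfl rfl rfl (hS.zigzag_up_L l) (hS.zigzag_up_L 1))
    (hS.merge_rot l 1) rfl
  have e₁ : g ⊚ (I (up k) * of S (merge l 1)) =
      (((q ^ (-((l : ℤ) * (1 : ℕ))) : Rˣ) : R) * qBinom q (l + 1) l) •
        (of S (merge k (l + 1)) ⊚ of S (split k (l + 1))) := by
    rw [hg, comp_assoc, ← I_mul_comp _ _ _ (by simp), hS.digon, mul_smul_right, ← I_append,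
      comp_smul, comp_id _ (by simp)]
  -- Associativity attaches the `1`-strand to the edge labelled `k + l`.
  have e₂ : (I (up k) * of S (merge l 1)) ⊚ g = (of S (merge k l) * I (up 1)) ⊚
      (of S (merge (k + l) 1) ⊚ of S (split (k + l) 1)) ⊚ (of S (split k l) * I (up 1)) := by
    rw [hg, comp_assoc, comp_assoc, ← hS.split_assoc, ← comp_assoc, ← hS.merge_assoc, comp_assoc]
  rw [e₁, smul_mul, smul_comp, comp_smul, ← of_digonR, e₂] at h
  -- The inner cup and cap close the `1`-strand around the edge `k + l`, which contributes `β`; the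
  -- outer ones close the `l`-strand afterwards.
  have e₃ : (I (up k) * (I (up l) * of S (cupR 1) * I (dn l))) ⊚
      (((of S (merge k l) * I (up 1)) ⊚ (of S (merge (k + l) 1) ⊚ of S (split (k + l) 1)) ⊚
        (of S (split k l) * I (up 1))) * I (dn 1 ++ dn l)) ⊚
      (I (up k) * (I (up l) * of S (capL 1) * I (dn l))) =
      β • ((of S (merge k l) ⊚ of S (split k l)) * I (dn l)) := by
    rw [I_append (dn 1)]
    simp only [← mul_assoc]
    rw [← comp_mul_I _ _ _ (by simp), ← comp_mul_I _ _ _ (by simp), ← I_append,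
      trace_comp (X' := up (k + l)) (Y' := up (k + l)) (by simp) (by simp) (by simp) (by simp)
        (by simp) (by simp) (by simp) (by simp) (by simp) (by simp), hβ, smul_comp, comp_smul,
      id_comp _ (by simp), smul_mul]
  rw [h, I_mul_comp _ _ _ (by simp), I_mul_comp _ _ _ (by simp), comp_assoc,
    ← comp_assoc _ _ (_ * of S (capL l)), ← comp_assoc _ _ (_ * of S (capL l)), e₃,
    smul_comp, comp_smul, ← of_digonR]

/-- Mirror of `digonR_succ`, with the loop opened into `1` and `l` so that the `1`-strand is again
the inner one. -/
theorem digonL_succ (hS : HasBasic S q) {β : R} (k l : ℕ)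
    (hβ : of S (digonL (l + k) 1) = β • I (up (l + k))) :
    (((q ^ (-(((1 : ℕ) : ℤ) * l)) : Rˣ) : R) * qBinom q (1 + l) 1) • of S (digonL k (1 + l)) =
      β • of S (digonL k l) := by
  rw [of_digonL] at hβ
  set g := (of S (merge (1 + l) k) ⊚ of S (split (1 + l) k)) ⊚ (of S (split 1 l) * I (up k)) with hg
  have h := trace_cyclic_left (K := up k) (t := of S (merge 1 l)) (g := g) rfl rfl (by simp [hg])
    (by simp [hg]) (c := of S (cupL (1 + l))) (e := of S (capL (1 + l)))
    (e' := of S (capR (1 + l))) rfl rfl rfl rfl rfl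
    (cP' := of S (cupR 1) ⊚ (I (up 1) * of S (cupR l) * I (dn 1)))
    (cP := of S (cupL l) ⊚ (I (dn l) * of S (cupL 1) * I (up l)))
    (eP := (I (dn l) * of S (capR 1) * I (up l)) ⊚ of S (capR l))
    (by simp) (Q := dn l ++ dn 1) (by simp) (by simp) (by simp) (by simp)
    (hS.zigzag_up_L _)
    (zigzag_nested_right rfl rfl rfl rfl rfl rfl (hS.zigzag_up_R 1) (hS.zigzag_up_R l))
    (hS.merge_rot 1 l) rfl
  have e₁ : g ⊚ (of S (merge 1 l) * I (up k)) =
      (((q ^ (-(((1 : ℕ) : ℤ) * l)) : Rˣ) : R) * qBinom q (1 + l) 1) •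
        (of S (merge (1 + l) k) ⊚ of S (split (1 + l) k)) := by
    rw [hg, comp_assoc, ← comp_mul_I _ _ _ (by simp), hS.digon, smul_mul, ← I_append,
      comp_smul, comp_id _ (by simp)]
  have e₂ : (of S (merge 1 l) * I (up k)) ⊚ g = (I (up 1) * of S (merge l k)) ⊚
      (of S (merge 1 (l + k)) ⊚ of S (split 1 (l + k))) ⊚ (I (up 1) * of S (split l k)) := by
    rw [hg, comp_assoc, comp_assoc, hS.split_assoc, ← comp_assoc, hS.merge_assoc, comp_assoc]
  rw [e₁, mul_smul_right, smul_comp, comp_smul, ← of_digonL, e₂] at h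
  have e₃ : ((I (dn l) * of S (cupL 1) * I (up l)) * I (up k)) ⊚
      (I (dn l ++ dn 1) * ((I (up 1) * of S (merge l k)) ⊚
        (of S (merge 1 (l + k)) ⊚ of S (split 1 (l + k))) ⊚ (I (up 1) * of S (split l k)))) ⊚
      ((I (dn l) * of S (capR 1) * I (up l)) * I (up k)) =
      β • (I (dn l) * (of S (merge l k) ⊚ of S (split l k))) := by
    rw [I_append (dn l)]
    simp only [mul_assoc]
    rw [← I_mul_comp _ _ _ (by simp), ← I_mul_comp _ _ _ (by simp), ← I_append,
      trace_comp_left (X' := up (l + k)) (Y' := up (l + k)) (by simp) (by simp) (by simp) (by simp)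
        (by simp) (by simp) (by simp) (by simp) (by simp) (by simp), hβ, smul_comp, comp_smul,
      id_comp _ (by simp), mul_smul_right]
  rw [h, comp_mul_I _ _ _ (by simp), comp_mul_I _ _ _ (by simp), comp_assoc,
    ← comp_assoc _ _ (of S (capR l) * _), ← comp_assoc _ _ (of S (capR l) * _), e₃,
    smul_comp, comp_smul, ← of_digonL]

/-- With the upright erased only the loop remains, so circle evaluation is a case of digon removal.
-/
theorem digonR_zero_left (hS : HasBasic S q) (l : ℕ) : of S (digonR 0 l) = of S (circleR l) := by
  have n : (I (up 0) : Mor S) = 1 := rfl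
  rw [of_digonR, hS.merge_zero_left, hS.split_zero_left, circleR, of_comp, n, one_mul, one_mul,
    comp_id _ (by simp), ← I_append, id_comp _ (by simp)]

theorem digonL_zero_left (hS : HasBasic S q) (l : ℕ) : of S (digonL 0 l) = of S (circleL l) := by
  have n : (I (up 0) : Mor S) = 1 := rfl
  rw [of_digonL, hS.merge_zero_right, hS.split_zero_right, circleL, of_comp, n, mul_one, mul_one,
    comp_id _ (by simp), ← I_append, id_comp _ (by simp)]

/-- Base of the induction on the label of the loop. -/
theorem digonR_zero_right (hS : HasBasic S q) (k : ℕ) : of S (digonR k 0) = I (up k) := by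
  have n : (I (dn 0) : Mor S) = 1 := rfl
  have h₁ : of S (cupR 0) = 1 := of_eq_of (.of (hS .cupR_zero))
  have h₂ : of S (capL 0) = 1 := of_eq_of (.of (hS .capL_zero))
  rw [of_digonR, hS.merge_zero_right, hS.split_zero_right, n, h₁, h₂, mul_one, mul_one,
    comp_id _ (by simp), comp_id _ (by simp), comp_id _ (by simp)]

theorem digonL_zero_right (hS : HasBasic S q) (k : ℕ) : of S (digonL k 0) = I (up k) := by
  have n : (I (dn 0) : Mor S) = 1 := rfl
  have h₁ : of S (cupL 0) = 1 := of_eq_of (.of (hS .cupL_zero))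
  have h₂ : of S (capR 0) = 1 := of_eq_of (.of (hS .capR_zero))
  rw [of_digonL, hS.merge_zero_left, hS.split_zero_left, n, h₁, h₂, one_mul, one_mul,
    comp_id _ (by simp), comp_id _ (by simp), comp_id _ (by simp)]

end HasBasic

end SidewayDigons

/-! ### Identities between the coefficients -/

section CoefficientIdentities

theorem qNum_sub_one (a : ℤ) : RatFunc.X ^ 2 * qNum (a - 1) + 1 = qNum a := by
  have hX : (RatFunc.X : RatFunc ℚ) ≠ 0 := RatFunc.X_ne_zero
  have h : (RatFunc.X : RatFunc ℚ) ^ 2 - 1 ≠ 0 := (isUnit_qUnit_sq_sub_one (RatFunc ℚ)).ne_zero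
  have e : (RatFunc.X : RatFunc ℚ) ^ (2 * a) = RatFunc.X ^ 2 * RatFunc.X ^ (2 * (a - 1)) := by
    rw [← zpow_natCast, ← zpow_add₀ hX]; congr 1; push_cast; ring
  rw [qNum, qNum, e]
  field_simp
  ring

/-- The expansions of `x` and `x - 1` differ only in the first entry, `a₁` against `a₁ - 1`, and the
deformed fraction is `{a₁} + q ^ (2 a₁)` times a tail independent of `a₁`. No other property of
`qRat` enters the proof. -/
theorem qRat_sub_one (x : ℚ) : RatFunc.X ^ 2 * qRat (x - 1) + 1 = qRat x := by
  have hX : (RatFunc.X : RatFunc ℚ) ≠ 0 := RatFunc.X_ne_zero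
  have hc : ⌈x - 1⌉ = ⌈x⌉ - 1 := Int.ceil_sub_one x
  have hx : x - 1 - ((⌈x - 1⌉ - 1 : ℤ) : ℚ) = x - ((⌈x⌉ - 1 : ℤ) : ℚ) := by
    rw [hc]; push_cast; ring
  have e (a : ℤ) : (RatFunc.X : RatFunc ℚ) ^ (2 * a) =
      RatFunc.X ^ 2 * RatFunc.X ^ (2 * (a - 1)) := by
    rw [← zpow_natCast, ← zpow_add₀ hX]; congr 1; push_cast; ring
  -- A list with one pair is treated apart because `qCF` has a separate clause for it, with no
  -- division by a tail.
  have key (a b : ℤ) (t : List (ℤ × ℤ)) :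
      RatFunc.X ^ 2 * qCF ((a - 1, b) :: t) + 1 = qCF ((a, b) :: t) := by
    cases t with
    | nil => rw [qCF, qCF, e a, ← qNum_sub_one a]; ring
    | cons p t =>
      have c (a : ℤ) : qCF ((a, b) :: p :: t) = qNum a + (RatFunc.X : RatFunc ℚ) ^ (2 * a) /
          (qNumInv b + (RatFunc.X : RatFunc ℚ) ^ (-2 * b) / qCF (p :: t)) := by
        rw [qCF]; simp
      rw [c, c, e a, ← qNum_sub_one a]; ring
  rw [qRat, qRat, evenCF, evenCF.eq_1 x, hx, hc]
  split_ifs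
  · exact key _ _ _
  · exact key _ _ _

variable {K : Type v} [CommRing K] [Algebra (RatFunc ℚ) K]

theorem qUnit_val : (qUnit K : K) = algebraMap (RatFunc ℚ) K RatFunc.X := rfl

/-- The quantity `(q² - 1) {x} + 1` is multiplied by `q²` when `x` grows by `1`; these are `n` such
steps, written without division. -/
theorem algebraMap_qRat_sub (x : ℚ) (n : ℕ) :
    (qUnit K : K) ^ (2 * n) * algebraMap (RatFunc ℚ) K (qRat (x - n)) * ((qUnit K : K) ^ 2 - 1) =
      algebraMap (RatFunc ℚ) K (qRat x) * ((qUnit K : K) ^ 2 - 1) - ((qUnit K : K) ^ (2 * n) - 1) := by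
  induction n with
  | zero => simp
  | succ n ih =>
    have h := congrArg (algebraMap (RatFunc ℚ) K) (qRat_sub_one (x - n))
    rw [map_add, map_mul, map_pow, map_one, ← qUnit_val, sub_sub] at h
    push_cast
    rw [← h] at ih
    linear_combination ih

/-- The left side is `a²` for `a = q ν δ_x`, so `{x} = (a² - 1) / (q² - 1)`: `a` stands for `q ^ x`.
-/
theorem algebraMap_qDelta (x : ℚ) :
    (qUnit K : K) ^ 2 * algebraMap (RatFunc ℚ) K (qDelta x) =
      algebraMap (RatFunc ℚ) K (qRat x) * ((qUnit K : K) ^ 2 - 1) + 1 := by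
  have h := congrArg (algebraMap (RatFunc ℚ) K) (qRat_sub_one x)
  rw [map_add, map_mul, map_pow, map_one, ← qUnit_val] at h
  rw [qDelta, map_sub]
  linear_combination -h

/-- `q - q⁻¹` is `q⁻¹ (q² - 1)`, a unit times `q² - 1`; hence no invertibility of `q² - 1` is
required, even for the default value of `Ring.inverse`. -/
theorem ringInverse_sub_inv {R : Type u} [CommRing R] (q : Rˣ) :
    Ring.inverse ((q : R) - ((q⁻¹ : Rˣ) : R)) = q * Ring.inverse ((q : R) ^ 2 - 1) := by
  have e : (q : R) - ((q⁻¹ : Rˣ) : R) = ((q⁻¹ : Rˣ) : R) * ((q : R) ^ 2 - 1) := by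
    linear_combination (- (q : R)) * q.inv_mul
  rw [e, Ring.mul_inverse_rev' (Commute.all _ _), mul_comm, Ring.inverse_unit, inv_inv]

/-- Together with `qInt_mul`, this lets identities be checked after multiplication by the unit `q² -
1`. -/
theorem aInt_mul {R : Type u} [CommRing R] (q a : Rˣ) (h : IsUnit ((q : R) ^ 2 - 1)) (r : ℤ) :
    aInt q a r * ((q : R) ^ 2 - 1) =
      q * (((a * q ^ (-r) : Rˣ) : R) - ((a⁻¹ * q ^ r : Rˣ) : R)) := by
  rw [aInt, ringInverse_sub_inv q]
  linear_combination (((a * q ^ (-r) : Rˣ) : R) - ((a⁻¹ * q ^ r : Rˣ) : R)) * q *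
    Ring.inverse_mul_cancel _ h

theorem qInt_mul {R : Type u} [CommRing R] (q : Rˣ) (h : IsUnit ((q : R) ^ 2 - 1)) (r : ℤ) :
    qInt q r * ((q : R) ^ 2 - 1) = ((q ^ (2 * r) : Rˣ) : R) - 1 := by
  rw [qInt, mul_assoc, Ring.inverse_mul_cancel _ h, mul_one]

/-- `(a q ^ (-n) - a⁻¹ q ^ n) / (q - q⁻¹) = q ^ n ν {x - n}` for `a = q ν δ_x`. -/
theorem aInt_aUnit (x : ℚ) (ν : K) (hν : ν ^ 2 * algebraMap (RatFunc ℚ) K (qDelta x) = 1) (n : ℕ) :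
    aInt (qUnit K) (aUnit x ν hν) n =
      (qUnit K : K) ^ n * ν * algebraMap (RatFunc ℚ) K (qRat (x - n)) := by
  have hu := isUnit_qUnit_sq_sub_one K
  refine hu.mul_right_cancel ?_
  rw [aInt_mul _ _ hu]
  -- A further factor `q ^ n` clears the negative powers of `q`.
  refine (((qUnit K).isUnit.pow n).mul_right_inj).1 ?_
  have h₁ := algebraMap_qRat_sub (K := K) x n
  have h₂ := algebraMap_qDelta (K := K) x
  have e₁ : ((aUnit x ν hν * qUnit K ^ (-(n : ℤ)) : Kˣ) : K) * (qUnit K : K) ^ n =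
      (qUnit K : K) * ν * algebraMap (RatFunc ℚ) K (qDelta x) := by
    rw [← Units.val_pow_eq_pow_val, ← Units.val_mul, mul_assoc, ← zpow_natCast, ← zpow_add,
      neg_add_cancel, zpow_zero, mul_one]
    rfl
  have e₂ : (((aUnit x ν hν)⁻¹ * qUnit K ^ (n : ℤ) : Kˣ) : K) * qUnit K = ν * (qUnit K : K) ^ n := by
    rw [zpow_natCast, Units.val_mul, Units.val_pow_eq_pow_val]
    change ((qUnit K)⁻¹ : Kˣ) * ν * _ * _ = _
    linear_combination ν * (qUnit K : K) ^ n * (qUnit K).inv_mul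
  linear_combination (qUnit K : K) * e₁ - (qUnit K : K) ^ n * e₂ - ν * h₁ + ν * h₂

/-! ### Quantum integers and binomials -/

theorem qInt_one {R : Type u} [CommRing R] (q : Rˣ) (h : IsUnit ((q : R) ^ 2 - 1)) :
    qInt q 1 = 1 := by
  refine h.mul_right_cancel ?_
  rw [qInt_mul q h]
  simp [zpow_ofNat]

theorem qBinom_self {R : Type u} [CommRing R] (q : Rˣ) (n : ℕ) : qBinom q n n = 1 := by
  induction n with
  | zero => rw [qBinom]
  | succ n ih => rw [qBinom, ih, qBinom_eq_zero q n (n + 1) (by omega)]; simp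

theorem qBinom_succ_self {R : Type u} [CommRing R] (q : Rˣ) (h : IsUnit ((q : R) ^ 2 - 1)) (n : ℕ) :
    qBinom q (n + 1) n = qInt q (n + 1) := by
  induction n with
  | zero => rw [qBinom, Nat.cast_zero, zero_add, qInt_one q h]
  | succ n ih =>
    rw [qBinom, ih, qBinom_self]
    push_cast
    rw [qInt_add q ((n : ℤ) + 1) 1, qInt_one q h]
    norm_cast

theorem qBinom_succ_one {R : Type u} [CommRing R] (q : Rˣ) (h : IsUnit ((q : R) ^ 2 - 1)) (n : ℕ) :
    qBinom q (n + 1) 1 = qInt q (n + 1) := by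
  induction n with
  | zero => simp [qBinom, qInt_one q h]
  | succ n ih =>
    rw [qBinom, ih, qBinom]
    push_cast
    rw [add_comm ((n : ℤ) + 1) 1, qInt_add q 1, qInt_one q h]
    norm_cast

/-- In symmetric quantum integers `[m] = q ^ (1 - m) {m}`, with `a = q ^ α`, this reads `[m + 1] [α
- 1] - [m] [α] = [α - m - 1]`. The left side is the coefficient of a `1`-loop on a strand `m + 1`
given by `digonR_one`. -/
theorem aInt_succ {R : Type u} [CommRing R] (q a : Rˣ) (h : IsUnit ((q : R) ^ 2 - 1)) (m : ℕ) :
    aInt q a 1 * (((q ^ (-(m : ℤ)) : Rˣ) : R) * qInt q (m + 1)) -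
      ((q ^ (1 - (m : ℤ)) : Rˣ) : R) * qInt q m * aInt q a 0 = aInt q a (m + 1) := by
  refine h.mul_right_cancel (h.mul_right_cancel ?_)
  have a₀ := aInt_mul q a h 0
  have a₁ := aInt_mul q a h 1
  have a₂ := aInt_mul q a h (m + 1)
  have b₁ := qInt_mul q h (m + 1)
  have b₀ := qInt_mul q h m
  have t₁ : ((q ^ (1 - (m : ℤ)) : Rˣ) : R) = q * ((q ^ (-(m : ℤ)) : Rˣ) : R) := by
    rw [sub_eq_add_neg, zpow_add, zpow_one, Units.val_mul]
  have t₂ : ((q ^ (2 * ((m : ℤ) + 1)) : Rˣ) : R) = (((q ^ (m : ℤ) : Rˣ) : R) * q) ^ 2 := by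
    rw [mul_comm, zpow_mul, zpow_add, zpow_one, zpow_ofNat]; push_cast; rfl
  have t₃ : ((q ^ (2 * (m : ℤ)) : Rˣ) : R) = ((q ^ (m : ℤ) : Rˣ) : R) ^ 2 := by
    rw [mul_comm, zpow_mul, zpow_ofNat, Units.val_pow_eq_pow_val]
  have t₄ : ((q ^ (-(m : ℤ)) : Rˣ) : R) * ((q ^ (m : ℤ) : Rˣ) : R) = 1 := by
    rw [← Units.val_mul, ← zpow_add, neg_add_cancel, zpow_zero, Units.val_one]
  rw [t₂] at b₁
  rw [t₃] at b₀
  simp only [neg_add, zpow_add, zpow_neg_one, zpow_one, Units.val_mul, neg_zero, zpow_zero,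
    mul_one] at a₀ a₁ a₂
  rw [t₁]
  -- With the powers named, the identity is polynomial modulo `t' t = 1` and `q q' = 1`; the
  -- relation `a a' = 1` plays no role.
  generalize ((q ^ (-(m : ℤ)) : Rˣ) : R) = t' at *
  generalize ((q ^ (m : ℤ) : Rˣ) : R) = t at *
  have t₅ := q.mul_inv
  generalize ((q⁻¹ : Rˣ) : R) = q' at *
  generalize ((a⁻¹ : Rˣ) : R) = a' at *
  generalize aInt q a 1 = A₁ at *
  generalize aInt q a 0 = A₀ at *
  generalize aInt q a (m + 1) = A₂ at *
  generalize qInt q (m + 1) = Q₁ at *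
  generalize qInt q m = Q₀ at *
  generalize (a : R) = a at *
  generalize (q : R) = q at *
  linear_combination t' * Q₁ * (q ^ 2 - 1) * a₁ + t' * (q * (a * q' - a' * q)) * b₁ -
    q * t' * Q₀ * (q ^ 2 - 1) * a₀ - q * t' * (q * (a - a')) * b₀ - (q ^ 2 - 1) * a₂ +
    a * t' * (t ^ 2 * q ^ 2 - q ^ 2) * t₅ - a' * q ^ 2 * (q ^ 2 - 1) * t * t₄

/-- `{n + 1}` is nonzero in the field `ℚ(q)`, hence a unit in every algebra over it. This provides
the divisions of the induction on loops, which are not available over `UnivRing`. -/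
theorem isUnit_qInt (n : ℕ) : IsUnit (qInt (qUnit K) (n + 1)) := by
  have hu := isUnit_qUnit_sq_sub_one K
  have h : IsUnit ((qUnit K : K) ^ (2 * (n + 1)) - 1) := by
    have h₀ : (RatFunc.X : RatFunc ℚ) ^ (2 * (n + 1)) - 1 ≠ 0 := by
      have e : (RatFunc.X : RatFunc ℚ) ^ (2 * (n + 1)) - 1 =
          algebraMap (Polynomial ℚ) (RatFunc ℚ) (Polynomial.X ^ (2 * (n + 1)) - 1) := by
        simp [RatFunc.algebraMap_X]
      rw [e]
      refine RatFunc.algebraMap_ne_zero fun h₁ => ?_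
      -- The value of this polynomial at `0` is `-1`.
      have := congrArg (Polynomial.eval 0) h₁
      simp at this
    have := (IsUnit.mk0 _ h₀).map (algebraMap (RatFunc ℚ) K)
    simpa [qUnit_val] using this
  refine isUnit_of_mul_isUnit_left (y := (qUnit K : K) ^ 2 - 1) ?_
  rw [qInt_mul _ hu]
  convert h
  norm_cast

/-- Reconciles division in `ℚ(q)` with `Ring.inverse` in `K`. -/
theorem algebraMap_qNum (n : ℤ) : algebraMap (RatFunc ℚ) K (qNum n) = qInt (qUnit K) n := by
  have hu := isUnit_qUnit_sq_sub_one K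
  have h₀ : (RatFunc.X : RatFunc ℚ) ^ 2 - 1 ≠ 0 := (isUnit_qUnit_sq_sub_one (RatFunc ℚ)).ne_zero
  refine hu.mul_right_cancel ?_
  rw [qInt_mul _ hu, qUnit_val, ← map_one (algebraMap (RatFunc ℚ) K), ← map_pow, ← map_sub,
    ← map_mul, qNum, div_mul_cancel₀ _ h₀, map_sub]
  congr 1
  rw [qUnit, ← map_zpow, Units.coe_map, Units.val_zpow_eq_zpow_val, Units.val_mk0]
  rfl

/-- Follows from the factorial formula, since the factorials are units in `K`. -/
theorem qBinom_succ_mul (k l : ℕ) :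
    qBinom (qUnit K) (k + (l + 1)) k * qInt (qUnit K) (l + 1) =
      qBinom (qUnit K) (k + l) k * qInt (qUnit K) ((k + l : ℕ) + 1) := by
  have hf (n : ℕ) : IsUnit (qFact (qUnit K) n) := by
    rw [qFact]
    exact IsUnit.prod_iff.2 fun j _ => isUnit_qInt j
  have s (n : ℕ) : qFact (qUnit K) (n + 1) = qFact (qUnit K) n * qInt (qUnit K) (n + 1) := by
    rw [qFact, Finset.prod_range_succ, ← qFact]
  have h₁ := qBinom_mul_qFact (qUnit K) k (l + 1)
  have h₂ := qBinom_mul_qFact (qUnit K) k l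
  rw [← add_assoc, s, s, ← h₂] at h₁
  refine ((hf k).mul (hf l)).mul_right_cancel ?_
  rw [← add_assoc]
  linear_combination h₁

/-! ### Values of the sideway digons -/

theorem digonValue_zero_right (x : ℚ) (ν : K) (k : ℕ) : digonValue x ν k 0 = 1 := by
  simp [digonValue, circleRatio, qBinom_self]

theorem digonValue_zero_left (x : ℚ) (ν : K) (k : ℕ) : digonValue x ν 0 k = circleValue x ν k := by
  have h := circleRatio_mul_circleValue x ν 0 k
  rw [zero_add] at h
  have h₀ : circleValue x ν 0 = 1 := by simp [circleValue, qRatBinom]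
  rw [h₀, mul_one] at h
  rw [digonValue, h, zero_add, Nat.cast_zero, zero_mul, neg_zero, zpow_zero, Units.val_one, qBinom,
    one_mul, one_mul]

/-- The claimed values obey the recursion of `digonR_succ`. Three factors change with `l`: the
binomial (`hB`), the quotient of products (`hZ`) and the power of `q` (`hq`). The cancelled form of
`circleRatio` avoids any division by `{x - j}`. -/
theorem digonValue_succ (x : ℚ) (ν : K) (k l : ℕ) :
    ((qUnit K ^ (-(l : ℤ)) : Kˣ) : K) * qInt (qUnit K) (l + 1) * digonValue x ν k (l + 1) =
      (qUnit K : K) ^ (k + l) * ν * algebraMap (RatFunc ℚ) K (qRat (x - (k + l : ℕ))) *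
        digonValue x ν k l := by
  have h₀ : qNum ((k + l : ℕ) + 1) ≠ 0 := by
    have := (isUnit_qInt (K := RatFunc ℚ) (k + l)).ne_zero
    rwa [← algebraMap_qNum] at this
  have hB := qBinom_succ_mul (K := K) k l
  have hZ : algebraMap (RatFunc ℚ) K ((∏ j ∈ Finset.range (l + 1), qRat (x - (k + j : ℕ))) /
        ∏ j ∈ Finset.range (l + 1), qNum ((k + j : ℕ) + 1)) * qInt (qUnit K) ((k + l : ℕ) + 1) =
      algebraMap (RatFunc ℚ) K ((∏ j ∈ Finset.range l, qRat (x - (k + j : ℕ))) /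
        ∏ j ∈ Finset.range l, qNum ((k + j : ℕ) + 1)) *
        algebraMap (RatFunc ℚ) K (qRat (x - (k + l : ℕ))) := by
    rw [← algebraMap_qNum, ← map_mul, ← map_mul, Finset.prod_range_succ, Finset.prod_range_succ,
      mul_div_mul_comm, mul_assoc, div_mul_cancel₀ _ h₀]
  -- Both exponents are `k l + l² + k`.
  have hq : ((qUnit K ^ (-(l : ℤ)) : Kˣ) : K) * ((qUnit K ^ (-((k : ℤ) * (l + 1 : ℕ))) : Kˣ) : K) *
      (qUnit K : K) ^ ((l + 1) * (2 * k + (l + 1) - 1)) =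
      (qUnit K : K) ^ (k + l) * ((qUnit K ^ (-((k : ℤ) * l)) : Kˣ) : K) *
        (qUnit K : K) ^ (l * (2 * k + l - 1)) := by
    -- The natural subtraction can only be truncated when `l = 0`, and then the product is `0`
    -- anyway.
    have e : ((l * (2 * k + l - 1) : ℕ) : ℤ) = l * (2 * k + l - 1) := by
      rcases l with _ | l
      · simp
      · rw [← Nat.add_assoc, Nat.add_sub_cancel]; push_cast; ring
    simp only [← Units.val_pow_eq_pow_val, ← Units.val_mul, ← zpow_natCast, ← zpow_add]
    rw [e, ← Nat.add_assoc, Nat.add_sub_cancel]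
    congr 2
    push_cast
    ring
  rw [digonValue, digonValue, circleRatio, circleRatio, pow_succ]
  generalize algebraMap (RatFunc ℚ) K (_ / _) = Z' at *
  generalize algebraMap (RatFunc ℚ) K (_ / _) = Z at *
  generalize qBinom (qUnit K) (k + (l + 1)) k = B' at *
  generalize qBinom (qUnit K) (k + l) k = B at *
  generalize qInt (qUnit K) ((k + l : ℕ) + 1) = n at *
  generalize qInt (qUnit K) (l + 1) = n' at *
  generalize algebraMap (RatFunc ℚ) K (qRat (x - (k + l : ℕ))) = p at *
  generalize ((qUnit K ^ (-(l : ℤ)) : Kˣ) : K) = u₁ at *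
  generalize ((qUnit K ^ (-((k : ℤ) * (l + 1 : ℕ))) : Kˣ) : K) = u₂ at *
  generalize ((qUnit K ^ (-((k : ℤ) * l)) : Kˣ) : K) = u₃ at *
  generalize (qUnit K : K) ^ ((l + 1) * (2 * k + (l + 1) - 1)) = u₄ at *
  generalize (qUnit K : K) ^ (l * (2 * k + l - 1)) = u₅ at *
  generalize (qUnit K : K) ^ (k + l) = u₆ at *
  linear_combination u₁ * u₂ * u₄ * ν ^ l * ν * Z' * hB + u₁ * u₂ * u₄ * ν ^ l * ν * B * hZ +
    B * Z * p * ν ^ l * ν * hq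

theorem digonValue_one (x : ℚ) (ν : K) (k : ℕ) :
    digonValue x ν k 1 = (qUnit K : K) ^ k * ν * algebraMap (RatFunc ℚ) K (qRat (x - k)) := by
  have h := digonValue_succ x ν k 0
  have e : qInt (qUnit K) 1 = 1 := qInt_one _ (isUnit_qUnit_sq_sub_one K)
  simpa [digonValue_zero_right, e] using h

end CoefficientIdentities

/-! ### Comparison of the two presentations -/

section Comparison

/-- Oddness `[-m] = -[m]` of the symmetric quantum integer `[m] = q ^ (1 - m) {m}`. -/
theorem zpow_mul_qInt_neg {R : Type u} [CommRing R] (q : Rˣ) (h : IsUnit ((q : R) ^ 2 - 1))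
    (m : ℤ) : ((q ^ (1 + m) : Rˣ) : R) * qInt q (-m) = -(((q ^ (1 - m) : Rˣ) : R) * qInt q m) := by
  refine h.mul_right_cancel ?_
  have e₁ : ((q ^ (1 + m) : Rˣ) : R) * ((q ^ (2 * -m) : Rˣ) : R) = ((q ^ (1 - m) : Rˣ) : R) := by
    rw [← Units.val_mul, ← zpow_add]; ring_nf
  have e₂ : ((q ^ (1 - m) : Rˣ) : R) * ((q ^ (2 * m) : Rˣ) : R) = ((q ^ (1 + m) : Rˣ) : R) := by
    rw [← Units.val_mul, ← zpow_add]; ring_nf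
  rw [mul_assoc, neg_mul, mul_assoc, qInt_mul q h, qInt_mul q h]
  linear_combination e₁ + e₂

theorem Mor.smul_left_cancel {R : Type u} [CommRing R] {S : Relations R} {c : R} (hc : IsUnit c)
    {f g : Mor S} (h : c • f = c • g) : f = g := by
  obtain ⟨c, rfl⟩ := hc
  rw [← Mor.one_smul' f, ← Mor.one_smul' g, ← c.inv_mul, Mor.smul_smul', h, ← Mor.smul_smul']

variable {K : Type v} [CommRing K] [Algebra (RatFunc ℚ) K]
variable (x : ℚ) (ν : K) (hν : ν ^ 2 * algebraMap (RatFunc ℚ) K (qDelta x) = 1)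

/-- The relations of the universal web category, over `K`. -/
abbrev specRel : Relations K := fun X Y f g =>
  BasicRel (qUnit K) X Y f g ∨ UniversalRel (qUnit K) (aUnit x ν hν) X Y f g

open Mor

theorem hasBasic_specRel : HasBasic (specRel x ν hν) (qUnit K) := fun _ _ _ _ h => Or.inl h

theorem aInt_eq_digonValue (n : ℕ) :
    aInt (qUnit K) (aUnit x ν hν) n = digonValue x ν n 1 := by
  rw [aInt_aUnit, digonValue_one]

/-- For `k = 0` this is the circle; for `k = m + 1` the coefficient of `digonR_one` is computed by
`aInt_succ`. -/
theorem of_digonR_one_specRel (k : ℕ) :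
    of (specRel x ν hν) (digonR k 1) = digonValue x ν k 1 • I (up k) := by
  have hS := hasBasic_specRel x ν hν
  have hγ : of (specRel x ν hν) (circleR 1) = aInt (qUnit K) (aUnit x ν hν) 0 • 1 :=
    of_eq_of (.of (.inr .circleR))
  have hα : of (specRel x ν hν) (digonR 1 1) = aInt (qUnit K) (aUnit x ν hν) 1 • I (up 1) :=
    of_eq_of (.of (.inr .digonR))
  cases k with
  | zero => rw [hS.digonR_zero_left, hγ, ← aInt_eq_digonValue x ν hν]; rfl
  | succ m =>
    have hu := isUnit_qUnit_sq_sub_one K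
    rw [hS.digonR_one hα hγ, ← aInt_eq_digonValue x ν hν, Nat.cast_succ m, ← aInt_succ _ _ hu,
      qBinom_succ_self _ hu, Nat.cast_one, mul_one, add_sub_cancel_right, sub_add_eq_sub_sub,
      sub_add_cancel]

theorem of_digonL_one_specRel (k : ℕ) :
    of (specRel x ν hν) (digonL k 1) = digonValue x ν k 1 • I (up k) := by
  have hS := hasBasic_specRel x ν hν
  have hγ : of (specRel x ν hν) (circleL 1) = aInt (qUnit K) (aUnit x ν hν) 0 • 1 :=
    of_eq_of (.of (.inr .circleL))
  have hα : of (specRel x ν hν) (digonL 1 1) = aInt (qUnit K) (aUnit x ν hν) 1 • I (up 1) :=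
    of_eq_of (.of (.inr .digonL))
  cases k with
  | zero => rw [hS.digonL_zero_left, hγ, ← aInt_eq_digonValue x ν hν]; rfl
  | succ m =>
    have hu := isUnit_qUnit_sq_sub_one K
    have h := hS.digonL_one hα hγ m
    rw [add_comm 1 m] at h
    rw [h, ← aInt_eq_digonValue x ν hν, Nat.cast_succ m, ← aInt_succ _ _ hu,
      qBinom_succ_one _ hu, Nat.cast_one, one_mul, sub_self, zero_add, sub_add_cancel_right,
      add_comm (m : ℤ) 1, zpow_mul_qInt_neg _ hu, neg_mul, ← sub_eq_add_neg]

/-- Induction on the loop: diagrams and values obey the same recursion, and its leading coefficient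
`q⁻ˡ {l + 1}` is a unit. -/
theorem of_digonR_specRel (k l : ℕ) :
    of (specRel x ν hν) (digonR k l) = digonValue x ν k l • I (up k) := by
  have hS := hasBasic_specRel x ν hν
  have hu := isUnit_qUnit_sq_sub_one K
  induction l with
  | zero => rw [hS.digonR_zero_right, digonValue_zero_right, one_smul']
  | succ l ih =>
    have h := hS.digonR_succ k l (of_digonR_one_specRel x ν hν (k + l))
    have hi := (Units.isUnit (qUnit K ^ (-(l : ℤ)))).mul (isUnit_qInt (K := K) l)
    rw [qBinom_succ_self _ hu, Nat.cast_one, mul_one] at h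
    refine Mor.smul_left_cancel hi ?_
    rw [h, ih, ← smul_smul', ← smul_smul', digonValue_succ, ← digonValue_one]

theorem of_digonL_specRel (k l : ℕ) :
    of (specRel x ν hν) (digonL k l) = digonValue x ν k l • I (up k) := by
  have hS := hasBasic_specRel x ν hν
  have hu := isUnit_qUnit_sq_sub_one K
  induction l with
  | zero => rw [hS.digonL_zero_right, digonValue_zero_right, one_smul']
  | succ l ih =>
    have h := hS.digonL_succ k l (of_digonL_one_specRel x ν hν (l + k))
    have hi := (Units.isUnit (qUnit K ^ (-(l : ℤ)))).mul (isUnit_qInt (K := K) l)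
    rw [add_comm 1 l, qBinom_succ_one _ hu, Nat.cast_one, one_mul] at h
    refine Mor.smul_left_cancel hi ?_
    rw [h, ih, ← smul_smul', ← smul_smul', digonValue_succ, ← digonValue_one, add_comm l k]

theorem squareValue_eq : squareValue x ν = aInt (qUnit K) (aUnit x ν hν) 2 := by
  have h := aInt_aUnit x ν hν 2
  rw [squareValue]
  exact_mod_cast h.symm

/-- The relations with loops of arbitrary labels follow from those with labels `1`. -/
theorem equivalent_of_mixedRel {X Y : Word} {f g : Diag K X Y}
    (h : MixedRel (circleValue x ν) (digonValue x ν) (squareValue x ν) X Y f g) :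
    Equivalent (specRel x ν hν) f g := by
  have hS := hasBasic_specRel x ν hν
  cases h with
  | circleR k =>
    refine equivalent_of_eq ?_
    rw [← hS.digonR_zero_left, of_digonR_specRel, digonValue_zero_left]
    rfl
  | circleL k =>
    refine equivalent_of_eq ?_
    rw [← hS.digonL_zero_left, of_digonL_specRel, digonValue_zero_left]
    rfl
  | digonR k l => exact equivalent_of_eq (of_digonR_specRel x ν hν k l)
  | digonL k l => exact equivalent_of_eq (of_digonL_specRel x ν hν k l)
  | square => rw [squareValue_eq x ν hν]; exact .of (.inr .square)
  | square_mirror => rw [squareValue_eq x ν hν]; exact .of (.inr .square_mirror)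

/-- The relations with loops labelled `1` are among those with loops of arbitrary labels. -/
theorem mixedRel_of_universalRel {X Y : Word} {f g : Diag K X Y}
    (h : UniversalRel (qUnit K) (aUnit x ν hν) X Y f g) :
    MixedRel (circleValue x ν) (digonValue x ν) (squareValue x ν) X Y f g := by
  have h₀ : aInt (qUnit K) (aUnit x ν hν) 0 = circleValue x ν 1 := by
    rw [← digonValue_zero_left]; exact_mod_cast aInt_eq_digonValue x ν hν 0
  have h₁ : aInt (qUnit K) (aUnit x ν hν) 1 = digonValue x ν 1 1 := by
    exact_mod_cast aInt_eq_digonValue x ν hν 1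
  cases h with
  | circleR => rw [h₀]; exact .circleR 1
  | circleL => rw [h₀]; exact .circleL 1
  | digonR => rw [h₁]; exact .digonR 1 1
  | digonL => rw [h₁]; exact .digonL 1 1
  | square => rw [← squareValue_eq]; exact .square
  | square_mirror => rw [← squareValue_eq]; exact .square_mirror

end Comparison

/-! ### Removal of crossings -/

theorem Diag.IsWeb.sum {R : Type u} {X Y : Word} {n : ℕ} {f : ℕ → Diag R X Y}
    (h : ∀ i, (f i).IsWeb) :
    (Diag.sum n f).IsWeb := by
  induction n with
  | zero => trivial
  | succ n ih => exact ⟨ih, h n⟩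

theorem isWeb_rungL {R : Type u} (b k l k' l' : ℕ) : (rungL b k l k' l' : Diag R _ _).IsWeb := by
  rw [rungL]
  split_ifs
  · exact ⟨⟨trivial, trivial, trivial⟩, trivial, ⟨trivial, trivial⟩, trivial⟩
  · trivial

theorem isWeb_rungR {R : Type u} (b k l k' l' : ℕ) : (rungR b k l k' l' : Diag R _ _).IsWeb := by
  rw [rungR]
  split_ifs
  · exact ⟨⟨⟨trivial, trivial⟩, trivial⟩, trivial, trivial, trivial, trivial⟩
  · trivial

theorem singleton_eq_up_or_dn (a : Arrow) : [a] = up a.label ∨ [a] = dn a.label := by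
  obtain ⟨b, n⟩ := a
  obtain ⟨m, rfl⟩ : ∃ m, n = Nat.succPNat m := ⟨n.natPred, (PNat.succPNat_natPred n).symm⟩
  cases b
  · exact .inr rfl
  · exact .inl rfl

section Crossings

variable {R : Type u} [CommRing R] {S : Relations R}

open Mor

/-- By `h`, the strand `Y` passes under or over the cap `e` in two equivalent ways, through `g` or
through `f`. Adding the cup `c` and straightening `D` isolates `f` as a bent copy of `g`. -/
theorem mate_right {U D Y : Word} {c e f g : Mor S} (hcs : c.src = []) (hct : c.tgt = U ++ D)
    (hes : e.src = D ++ U) (zig : (I D * c) ⊚ (e * I D) = I D)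
    (hfs : f.src = D ++ Y) (hft : f.tgt = Y ++ D) (hgt : g.tgt = U ++ Y)
    (h : (I D * g) ⊚ (e * I Y) = (f * I U) ⊚ (I Y * e)) :
    f = (I (D ++ Y) * c) ⊚ (I D * g * I D) ⊚ (e * I (Y ++ D)) := by
  have h₁ : (I (D ++ Y) * c) ⊚ (f * I (U ++ D)) = f ⊚ (I (Y ++ D) * c) := by
    simpa [I_nil] using (exchange f c hfs hft hcs hct).symm
  have h₂ : (I D * g * I D) ⊚ (e * I (Y ++ D)) = (f * I (U ++ D)) ⊚ (I Y * e * I D) := by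
    rw [I_append Y, ← mul_assoc, ← comp_mul_I _ _ _ (by simp [*]), h, comp_mul_I _ _ _ (by simp [*]),
      I_append U, ← mul_assoc]
  rw [h₂, comp_eq_comp h₁, I_append, mul_assoc, mul_assoc, ← I_mul_comp _ _ _ (by simp [*]), zig,
    ← I_append, comp_id _ hft]

/-- Upside-down variant of `mate_right`, with the strand `Y` passing the cup. -/
theorem mate_left {U D Y : Word} {c e f g : Mor S} (hct : c.tgt = D ++ U)
    (hes : e.src = U ++ D) (het : e.tgt = []) (zig : (c * I D) ⊚ (I D * e) = I D)
    (hfs : f.src = Y ++ D) (hft : f.tgt = D ++ Y) (hgs : g.src = U ++ Y)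
    (h : (c * I Y) ⊚ (I D * g) = (I Y * c) ⊚ (f * I U)) :
    f = (c * I (Y ++ D)) ⊚ (I D * g * I D) ⊚ (I (D ++ Y) * e) := by
  have h₁ : (f * I (U ++ D)) ⊚ (I (D ++ Y) * e) = (I (Y ++ D) * e) ⊚ f := by
    simpa [I_nil] using exchange f e hfs hft hes het
  have h₂ : (c * I (Y ++ D)) ⊚ (I D * g * I D) = (I Y * c * I D) ⊚ (f * I (U ++ D)) := by
    rw [I_append Y, ← mul_assoc, ← comp_mul_I _ _ _ (by simp [*]), h, comp_mul_I _ _ _ (by simp [*]),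
      I_append U, ← mul_assoc]
  rw [comp_eq_comp h₂, h₁, ← comp_assoc, I_append, mul_assoc, mul_assoc,
    ← I_mul_comp _ _ _ (by simp [*]), zig, ← I_append, id_comp _ hfs.symm]

/-! ### Hexagons and unit laws for the braiding and its inverse -/

theorem braid_comp_braidInv (X Y : Word) :
    of S (braid X Y) ⊚ of S (braidInv X Y) = I (X ++ Y) := by
  rw [← of_comp]; exact of_eq_of (.braid_braidInv X Y)

theorem braidInv_comp_braid (X Y : Word) :
    of S (braidInv X Y) ⊚ of S (braid X Y) = I (Y ++ X) := by
  rw [← of_comp]; exact of_eq_of (.braidInv_braid X Y)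

theorem braid_naturality {X Y X' Y' : Word} (f : Diag R X Y) (g : Diag R X' Y') :
    (of S f * of S g) ⊚ of S (braid Y Y') = of S (braid X X') ⊚ (of S g * of S f) := by
  rw [← of_tensor, ← of_tensor, ← of_comp, ← of_comp]; exact of_eq_of (.braid_naturality f g)

theorem braid_append_right (X Y Z : Word) : of S (braid X (Y ++ Z)) =
    (of S (braid X Y) * I Z) ⊚ (I Y * of S (braid X Z)) := by
  have h := of_eq_of (S := S) (.hexagon_forward X Y Z)
  simp only [of_comp, of_eqHom, of_tensor, of_idd] at h
  rwa [comp_id _ (by simp), id_comp _ (by simp), id_comp _ (by simp)] at h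

theorem braid_append_left (X Y Z : Word) : of S (braid (X ++ Y) Z) =
    (I X * of S (braid Y Z)) ⊚ (of S (braid X Z) * I Y) := by
  have h := of_eq_of (S := S) (.hexagon_reverse X Y Z)
  simp only [of_comp, of_eqHom, of_tensor, of_idd] at h
  rwa [comp_id _ (by simp), id_comp _ (by simp), id_comp _ (by simp)] at h

theorem eq_of_inverse {f g g' : Mor S} {X Y : Word} (hg : g.src = Y) (hg' : g'.tgt = X)
    (h : g' ⊚ f = I Y) (h' : f ⊚ g = I X) : g = g' := by
  rw [← id_comp g hg.symm, ← h, comp_assoc, h', comp_id _ hg']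

/-- The hexagons are imposed on `braid` only; uniqueness of inverses transfers them to `braidInv`.
-/
theorem braidInv_append_right (X Y Z : Word) : of S (braidInv X (Y ++ Z)) =
    (I Y * of S (braidInv X Z)) ⊚ (of S (braidInv X Y) * I Z) := by
  refine eq_of_inverse (f := of S (braid X (Y ++ Z))) (X := X ++ (Y ++ Z)) (Y := Y ++ Z ++ X)
    rfl (by simp) ?_ (braid_comp_braidInv _ _)
  rw [braid_append_right, comp_assoc, ← comp_assoc (_ * I Z), ← comp_mul_I _ _ _ (by simp),
    braidInv_comp_braid, ← I_append, id_comp _ (by simp), ← I_mul_comp _ _ _ (by simp),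
    braidInv_comp_braid, ← I_append, List.append_assoc]

theorem braidInv_append_left (X Y Z : Word) : of S (braidInv (X ++ Y) Z) =
    (of S (braidInv X Z) * I Y) ⊚ (I X * of S (braidInv Y Z)) := by
  refine eq_of_inverse (f := of S (braid (X ++ Y) Z)) (X := X ++ Y ++ Z) (Y := Z ++ (X ++ Y))
    rfl (by simp) ?_ (braid_comp_braidInv _ _)
  rw [braid_append_left, comp_assoc, ← comp_assoc (I X * _), ← I_mul_comp _ _ _ (by simp),
    braidInv_comp_braid, ← I_append, id_comp _ (by simp), ← comp_mul_I _ _ _ (by simp),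
    braidInv_comp_braid, ← I_append, List.append_assoc]

/-- The hexagon for `[] ++ []` makes this braiding idempotent, and it is invertible. -/
theorem braid_nil_left (Y : Word) : of S (braid [] Y) = I Y := by
  have h : of S (braid [] Y) = _ := braid_append_left (S := S) [] [] Y
  have h' := congrArg (Mor.comp (of S (braidInv [] Y))) h
  rw [I_nil, one_mul, mul_one, ← comp_assoc, braidInv_comp_braid,
    id_comp _ (by simp)] at h'
  simpa using h'.symm

theorem braid_nil_right (X : Word) : of S (braid X []) = I X := by
  have h : of S (braid X []) = _ := braid_append_right (S := S) X [] []
  have h' := congrArg (Mor.comp (of S (braidInv X []))) h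
  rw [I_nil, one_mul, mul_one, ← comp_assoc, braidInv_comp_braid,
    id_comp _ (by simp)] at h'
  simpa using h'.symm

theorem braidInv_nil_left (Y : Word) : of S (braidInv [] Y) = I Y := by
  have h := braid_comp_braidInv (S := S) [] Y
  rwa [braid_nil_left, id_comp _ (by simp)] at h

theorem braidInv_nil_right (X : Word) : of S (braidInv X []) = I X := by
  have h := braid_comp_braidInv (S := S) X []
  rw [braid_nil_right, id_comp _ (by simp)] at h
  simpa using h

/-- The morphism is represented by a diagram without crossings. -/
def Mor.HasWeb (f : Mor S) : Prop := ∃ (X Y : Word) (w : Diag R X Y), w.IsWeb ∧ of S w = f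

namespace Mor.HasWeb

theorem of {X Y : Word} {w : Diag R X Y} (h : w.IsWeb) : (of S w).HasWeb := ⟨X, Y, w, h, rfl⟩

theorem id (X : Word) : (I X : Mor S).HasWeb := .of (w := idd X) trivial

theorem comp {f g : Mor S} (hf : f.HasWeb) (hg : g.HasWeb) : (f ⊚ g).HasWeb := by
  obtain ⟨X, Y, w, hw, rfl⟩ := hf
  obtain ⟨Y', Z, w', hw', rfl⟩ := hg
  by_cases e : Y = Y'
  · subst e
    rw [← of_comp]
    exact .of ⟨hw, hw'⟩
  · rw [of_comp_ne _ _ e]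
    exact .of (w := zero) trivial

theorem mul {f g : Mor S} (hf : f.HasWeb) (hg : g.HasWeb) : (f * g).HasWeb := by
  obtain ⟨X, Y, w, hw, rfl⟩ := hf
  obtain ⟨X', Y', w', hw', rfl⟩ := hg
  exact .of (w := tensor w w') ⟨hw, hw'⟩

theorem cupR (k : ℕ) : (Mor.of S (Diag.cupR k)).HasWeb := .of (w := Diag.cupR k) trivial

theorem capR (k : ℕ) : (Mor.of S (Diag.capR k)).HasWeb := .of (w := Diag.capR k) trivial

theorem cupL (k : ℕ) : (Mor.of S (Diag.cupL k)).HasWeb := .of (w := Diag.cupL k) trivial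

theorem capL (k : ℕ) : (Mor.of S (Diag.capL k)).HasWeb := .of (w := Diag.capL k) trivial

theorem exists_isWeb {X Y : Word} {f : Diag R X Y} (h : (Mor.of S f).HasWeb) :
    ∃ w : Diag R X Y, w.IsWeb ∧ Mor.of S w = Mor.of S f := by
  obtain ⟨X', Y', w, hw, e⟩ := h
  obtain rfl : X' = X := congrArg Mor.src e
  obtain rfl : Y' = Y := congrArg Mor.tgt e
  exact ⟨w, hw, e⟩

end Mor.HasWeb

/-- Both crossings of the words `X` and `Y` are represented by diagrams without crossings. -/
def BraidHasWeb (S : Relations R) (X Y : Word) : Prop :=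
  (of S (braid X Y)).HasWeb ∧ (of S (braidInv X Y)).HasWeb

namespace BraidHasWeb

theorem append_left {X Y Z : Word} (h : BraidHasWeb S X Z) (h' : BraidHasWeb S Y Z) :
    BraidHasWeb S (X ++ Y) Z := by
  rw [BraidHasWeb, braid_append_left, braidInv_append_left]
  exact ⟨((HasWeb.id X).mul h'.1).comp (h.1.mul (HasWeb.id Y)),
    (h.2.mul (HasWeb.id Y)).comp ((HasWeb.id X).mul h'.2)⟩

theorem append_right {X Y Z : Word} (h : BraidHasWeb S X Y) (h' : BraidHasWeb S X Z) :
    BraidHasWeb S X (Y ++ Z) := by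
  rw [BraidHasWeb, braid_append_right, braidInv_append_right]
  exact ⟨(h.1.mul (HasWeb.id Z)).comp ((HasWeb.id Y).mul h'.1),
    ((HasWeb.id Y).mul h'.2).comp (h.2.mul (HasWeb.id Z))⟩

theorem nil_left (Y : Word) : BraidHasWeb S [] Y := by
  rw [BraidHasWeb, braid_nil_left, braidInv_nil_left]
  exact ⟨HasWeb.id Y, HasWeb.id Y⟩

theorem nil_right (X : Word) : BraidHasWeb S X [] := by
  rw [BraidHasWeb, braid_nil_right, braidInv_nil_right]
  exact ⟨HasWeb.id X, HasWeb.id X⟩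

end BraidHasWeb

/-! ### Crossings of upward strands, of downward strands and of words -/

theorem isWeb_crossingSum (q : Rˣ) (k l : ℕ) : (crossingSum q k l).IsWeb :=
  Diag.IsWeb.sum fun _ => ⟨isWeb_rungR _ _ _ _ _, isWeb_rungL _ _ _ _ _⟩

theorem isWeb_crossingInvSum (q : Rˣ) (k l : ℕ) : (crossingInvSum q k l).IsWeb :=
  Diag.IsWeb.sum fun _ => ⟨isWeb_rungL _ _ _ _ _, isWeb_rungR _ _ _ _ _⟩

variable {q : Rˣ}

namespace HasBasic

theorem braidHasWeb_up_up (hS : HasBasic S q) (k l : ℕ) : BraidHasWeb S (up k) (up l) := by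
  rw [BraidHasWeb, of_eq_of (.of (hS (.crossing k l))), of_eq_of (.of (hS (.crossing_inv l k)))]
  exact ⟨.of (isWeb_crossingSum q k l), .of (isWeb_crossingInvSum q l k)⟩

/-- The braiding of `↓k` is a bent inverse braiding of `↑k`, and conversely, which is why
`BraidHasWeb` tracks both crossings at once. -/
theorem braidHasWeb_dn_left (hS : HasBasic S q) {k : ℕ} {Y : Word} (h : BraidHasWeb S (up k) Y) :
    BraidHasWeb S (dn k) Y := by
  constructor
  · rw [mate_right (U := up k) (c := of S (cupR k)) (e := of S (capR k))
      (f := of S (braid (dn k) Y))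
      (g := of S (braidInv (up k) Y)) rfl rfl rfl (hS.zigzag_dn_R k) rfl rfl rfl]
    · exact ((HasWeb.id _).mul (HasWeb.cupR k)).comp
        ((((HasWeb.id _).mul h.2).mul (HasWeb.id _)).comp
          ((HasWeb.capR k).mul (HasWeb.id _)))
    -- Naturality along the cap `↓ ↑ ⟶ ∅`: the braiding with the empty word is an identity, and the
    -- hexagon separates the crossings of `↓` and `↑` with `Y`.
    · have n := braid_naturality (S := S) (capR k) (idd Y)
      rw [of_idd, braid_nil_left, comp_id _ (by simp), braid_append_left] at n
      rw [n, comp_assoc, ← comp_assoc, ← I_mul_comp _ _ _ (by simp), braidInv_comp_braid,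
        ← I_append, id_comp _ (by simp)]
  · rw [mate_left (U := up k) (c := of S (cupL k)) (e := of S (capL k))
      (f := of S (braidInv (dn k) Y))
      (g := of S (braid (up k) Y)) rfl rfl rfl (hS.zigzag_dn_L k) rfl rfl rfl]
    · exact ((HasWeb.cupL k).mul (HasWeb.id _)).comp
        ((((HasWeb.id _).mul h.1).mul (HasWeb.id _)).comp
          ((HasWeb.id _).mul (HasWeb.capL k)))
    · have n := braid_naturality (S := S) (cupL k) (idd Y)
      rw [of_idd, braid_nil_left, id_comp _ (by simp), braid_append_left] at n
      rw [← n, comp_assoc, comp_assoc, ← comp_mul_I _ _ _ (by simp), braid_comp_braidInv,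
        ← I_append, comp_id _ (by simp)]

theorem braidHasWeb_dn_right (hS : HasBasic S q) {l : ℕ} {X : Word} (h : BraidHasWeb S X (up l)) :
    BraidHasWeb S X (dn l) := by
  constructor
  · rw [mate_left (U := up l) (c := of S (cupL l)) (e := of S (capL l))
      (f := of S (braid X (dn l)))
      (g := of S (braidInv X (up l))) rfl rfl rfl (hS.zigzag_dn_L l) rfl rfl rfl]
    · exact ((HasWeb.cupL l).mul (HasWeb.id _)).comp
        ((((HasWeb.id _).mul h.2).mul (HasWeb.id _)).comp
          ((HasWeb.id _).mul (HasWeb.capL l)))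
    · have n := braid_naturality (S := S) (idd X) (cupL l)
      rw [of_idd, braid_nil_right, id_comp _ (by simp), braid_append_right] at n
      rw [← n, comp_assoc, comp_assoc, ← I_mul_comp _ _ _ (by simp), braid_comp_braidInv,
        ← I_append, comp_id _ (by simp)]
  · rw [mate_right (U := up l) (c := of S (cupR l)) (e := of S (capR l))
      (f := of S (braidInv X (dn l)))
      (g := of S (braid X (up l))) rfl rfl rfl (hS.zigzag_dn_R l) rfl rfl rfl]
    · exact ((HasWeb.id _).mul (HasWeb.cupR l)).comp
        ((((HasWeb.id _).mul h.1).mul (HasWeb.id _)).comp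
          ((HasWeb.capR l).mul (HasWeb.id _)))
    · have n := braid_naturality (S := S) (idd X) (capR l)
      rw [of_idd, braid_nil_right, comp_id _ (by simp), braid_append_right] at n
      rw [n, comp_assoc, ← comp_assoc, ← comp_mul_I _ _ _ (by simp), braidInv_comp_braid,
        ← I_append, id_comp _ (by simp)]

/-- The hexagons cut both words into letters. `h₁` treats an arbitrary word against one upward
letter, from which downward letters on the right follow. -/
theorem braidHasWeb (hS : HasBasic S q) (X Y : Word) : BraidHasWeb S X Y := by
  have h₁ (l : ℕ) (X : Word) : BraidHasWeb S X (up l) := by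
    induction X with
    | nil => exact .nil_left _
    | cons a X ih =>
      refine BraidHasWeb.append_left (X := [a]) ?_ ih
      rcases singleton_eq_up_or_dn a with e | e <;> rw [e]
      · exact hS.braidHasWeb_up_up _ _
      · exact hS.braidHasWeb_dn_left (hS.braidHasWeb_up_up _ _)
  induction Y with
  | nil => exact .nil_right _
  | cons a Y ih =>
    refine BraidHasWeb.append_right (Y := [a]) ?_ ih
    rcases singleton_eq_up_or_dn a with e | e <;> rw [e]
    · exact h₁ _ _
    · exact hS.braidHasWeb_dn_right (h₁ _ _)

/-- Every diagram is equivalent to one without crossings. -/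
theorem hasWeb (hS : HasBasic S q) {X Y : Word} (f : Diag R X Y) : (of S f).HasWeb := by
  induction f with
  | comp f g hf hg => rw [of_comp]; exact hf.comp hg
  | tensor f g hf hg => exact hf.mul hg
  | add f g hf hg =>
    obtain ⟨w, hw, e⟩ := hf.exists_isWeb
    obtain ⟨w', hw', e'⟩ := hg.exists_isWeb
    rw [of_add, ← e, ← e', ← of_add]
    exact .of ⟨hw, hw'⟩
  | smul r f hf =>
    obtain ⟨w, hw, e⟩ := hf.exists_isWeb
    rw [of_smul, ← e, ← of_smul]
    exact .of (w := smul r w) hw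
  | braid X Y => exact (hS.braidHasWeb X Y).1
  | braidInv X Y => exact (hS.braidHasWeb X Y).2
  | _ => exact .of trivial

end HasBasic

end Crossings

/-! ### Change of coefficients in diagrams -/

section DiagMap

variable {R : Type u} {K : Type v} [CommRing R] [CommRing K] (φ : R →+* K)

/-- Apply a ring homomorphism to the coefficients of a diagram. -/
def Diag.map : ∀ {X Y : Word}, Diag R X Y → Diag K X Y
  | _, _, eqHom h => eqHom h
  | _, _, comp f g => comp (Diag.map f) (Diag.map g)
  | _, _, tensor f g => tensor (Diag.map f) (Diag.map g)
  | _, _, zero => zero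
  | _, _, add f g => add (Diag.map f) (Diag.map g)
  | _, _, smul r f => smul (φ r) (Diag.map f)
  | _, _, braid X Y => braid X Y
  | _, _, braidInv X Y => braidInv X Y
  | _, _, merge k l => merge k l
  | _, _, split k l => split k l
  | _, _, cupR k => cupR k
  | _, _, capR k => capR k
  | _, _, cupL k => cupL k
  | _, _, capL k => capL k

theorem map_rungL (b k l k' l' : ℕ) :
    (rungL b k l k' l' : Diag R _ _).map φ = rungL b k l k' l' := by
  unfold rungL
  split_ifs <;> rfl

theorem map_rungR (b k l k' l' : ℕ) :
    (rungR b k l k' l' : Diag R _ _).map φ = rungR b k l k' l' := by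
  unfold rungR
  split_ifs <;> rfl

theorem map_rungL12 (b k l r k' l' : ℕ) :
    (rungL12 b k l r k' l' : Diag R _ _).map φ = rungL12 b k l r k' l' :=
  congrArg (fun f => tensor f (idd (up r))) (map_rungL φ b k l k' l')

theorem map_rungR12 (b k l r k' l' : ℕ) :
    (rungR12 b k l r k' l' : Diag R _ _).map φ = rungR12 b k l r k' l' :=
  congrArg (fun f => tensor f (idd (up r))) (map_rungR φ b k l k' l')

theorem map_rungL23 (b k l r l' r' : ℕ) :
    (rungL23 b k l r l' r' : Diag R _ _).map φ = rungL23 b k l r l' r' :=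
  congrArg (fun f => Diag.cast (tensor (idd (up k)) f)) (map_rungL φ b l r l' r')

theorem map_rungR23 (b k l r l' r' : ℕ) :
    (rungR23 b k l r l' r' : Diag R _ _).map φ = rungR23 b k l r l' r' :=
  congrArg (fun f => Diag.cast (tensor (idd (up k)) f)) (map_rungR φ b l r l' r')

theorem map_sum {X Y : Word} (n : ℕ) (f : ℕ → Diag R X Y) :
    (Diag.sum n f).map φ = Diag.sum n fun i => (f i).map φ := by
  induction n with
  | zero => rfl
  | succ n ih => exact congrArg (fun g => add g ((f n).map φ)) ih

variable (q a : Rˣ)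

theorem map_units_zpow (n : ℤ) :
    φ ((q ^ n : Rˣ) : R) = ((Units.map φ.toMonoidHom q ^ n : Kˣ) : K) := by
  rw [← map_zpow]; rfl

theorem map_neg_units_zpow (n : ℤ) :
    φ (((-q) ^ n : Rˣ) : R) = (((-Units.map φ.toMonoidHom q) ^ n : Kˣ) : K) := by
  rw [map_units_zpow]
  congr 2
  ext
  simp

theorem map_neg_units_pow (n : ℕ) :
    φ (((-q) ^ n : Rˣ) : R) = (((-Units.map φ.toMonoidHom q) ^ n : Kˣ) : K) := by
  rw [← zpow_natCast, map_neg_units_zpow, zpow_natCast]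

theorem map_qBinom : ∀ n k : ℕ, φ (qBinom q n k) = qBinom (Units.map φ.toMonoidHom q) n k
  | _, 0 => by rw [qBinom, qBinom, map_one]
  | 0, _ + 1 => by rw [qBinom, qBinom, map_zero]
  | n + 1, k + 1 => by
    rw [qBinom, qBinom, map_add, map_mul, map_pow, map_qBinom n k, map_qBinom n (k + 1)]
    rfl

theorem map_crossingSum (k l : ℕ) :
    (crossingSum q k l).map φ = crossingSum (Units.map φ.toMonoidHom q) k l := by
  rw [crossingSum, crossingSum, Diag.map, map_sum, map_neg_units_pow]
  simp only [Diag.map, map_rungL, map_rungR, map_neg_units_zpow]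

theorem map_crossingInvSum (k l : ℕ) :
    (crossingInvSum q k l).map φ = crossingInvSum (Units.map φ.toMonoidHom q) k l := by
  rw [crossingInvSum, crossingInvSum, Diag.map, map_sum, map_neg_units_zpow]
  simp only [Diag.map, map_rungL, map_rungR, map_neg_units_zpow]

theorem isUnit_map_sq_sub_one (h : IsUnit ((q : R) ^ 2 - 1)) :
    IsUnit ((Units.map φ.toMonoidHom q : K) ^ 2 - 1) := by
  have := h.map φ
  rwa [map_sub, map_pow, map_one] at this

/-- Invertibility of `q² - 1` is needed since ring homomorphisms do not preserve the default value
of `Ring.inverse`. -/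
theorem map_qInt (h : IsUnit ((q : R) ^ 2 - 1)) (m : ℤ) :
    φ (qInt q m) = qInt (Units.map φ.toMonoidHom q) m := by
  have h' := isUnit_map_sq_sub_one φ q h
  refine h'.mul_right_cancel ?_
  have e := congrArg φ (qInt_mul q h m)
  rw [map_mul, map_sub, map_sub, map_pow, map_one, map_units_zpow] at e
  rw [qInt_mul _ h', ← e]
  rfl

theorem map_aInt (h : IsUnit ((q : R) ^ 2 - 1)) (m : ℤ) :
    φ (aInt q a m) = aInt (Units.map φ.toMonoidHom q) (Units.map φ.toMonoidHom a) m := by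
  have h' := isUnit_map_sq_sub_one φ q h
  refine h'.mul_right_cancel ?_
  have e := congrArg φ (aInt_mul q a h m)
  rw [map_mul, map_mul, map_sub, map_sub, map_pow, map_one] at e
  rw [aInt_mul _ _ h', ← map_zpow, ← map_zpow, ← map_inv, ← map_mul, ← map_mul]
  exact e

theorem BasicRel.map (h : IsUnit ((q : R) ^ 2 - 1)) {X Y : Word} {f g : Diag R X Y}
    (hfg : BasicRel q X Y f g) :
    BasicRel (Units.map φ.toMonoidHom q) X Y (f.map φ) (g.map φ) := by
  cases hfg with
  | digon k l =>
    simp only [Diag.map, map_mul, map_units_zpow, map_qBinom]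
    exact .digon k l
  | square_switch k l =>
    simp only [Diag.map, map_mul, map_neg, map_one, map_units_zpow, map_qInt φ q h, map_rungL,
      map_rungR]
    exact .square_switch k l
  | serre₁ k l r =>
    simp only [Diag.map, map_neg, map_one, map_rungL12, map_rungL23]
    exact .serre₁ k l r
  | serre₂ k l r =>
    simp only [Diag.map, map_neg, map_one, map_rungL12, map_rungL23]
    exact .serre₂ k l r
  | serre₃ k l r =>
    simp only [Diag.map, map_neg, map_one, map_rungR12, map_rungR23]
    exact .serre₃ k l r
  | serre₄ k l r =>
    simp only [Diag.map, map_neg, map_one, map_rungR12, map_rungR23]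
    exact .serre₄ k l r
  | crossing k l => rw [map_crossingSum φ q]; exact .crossing k l
  | crossing_inv k l => rw [map_crossingInvSum φ q]; exact .crossing_inv k l
  | merge_zero_left l => exact .merge_zero_left l
  | merge_zero_right l => exact .merge_zero_right l
  | split_zero_left l => exact .split_zero_left l
  | split_zero_right l => exact .split_zero_right l
  | cupR_zero => exact .cupR_zero
  | capR_zero => exact .capR_zero
  | cupL_zero => exact .cupL_zero
  | capL_zero => exact .capL_zero
  | zigzag_up_R k => exact .zigzag_up_R k
  | zigzag_dn_R k => exact .zigzag_dn_R k
  | zigzag_up_L k => exact .zigzag_up_L k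
  | zigzag_dn_L k => exact .zigzag_dn_L k
  | merge_rot k l => exact .merge_rot k l
  | split_rot k l => exact .split_rot k l
  | merge_assoc k l r => exact .merge_assoc k l r
  | split_assoc k l r => exact .split_assoc k l r

/-- The relations carry no free scalars, so each one over `K` is the image of the one with the same
labels over `R`. In this way relations over `K` are verified after extension of scalars. -/
theorem BasicRel.exists_map (h : IsUnit ((q : R) ^ 2 - 1)) {X Y : Word} {f g : Diag K X Y}
    (hfg : BasicRel (Units.map φ.toMonoidHom q) X Y f g) :
    ∃ f' g' : Diag R X Y, BasicRel q X Y f' g' ∧ f'.map φ = f ∧ g'.map φ = g := by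
  cases hfg with
  | digon k l =>
    exact ⟨_, _, .digon k l, rfl, by
      simp only [Diag.map, map_mul, map_units_zpow, map_qBinom]; rfl⟩
  | square_switch k l =>
    exact ⟨_, _, .square_switch k l, by
      simp only [Diag.map, map_neg, map_one, map_rungL, map_rungR], by
      simp only [Diag.map, map_mul, map_units_zpow, map_qInt φ q h]; rfl⟩
  | serre₁ k l r =>
    exact ⟨_, _, .serre₁ k l r, by
      simp only [Diag.map, map_neg, map_one, map_rungL12, map_rungL23], rfl⟩
  | serre₂ k l r =>
    exact ⟨_, _, .serre₂ k l r, by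
      simp only [Diag.map, map_neg, map_one, map_rungL12, map_rungL23], rfl⟩
  | serre₃ k l r =>
    exact ⟨_, _, .serre₃ k l r, by
      simp only [Diag.map, map_neg, map_one, map_rungR12, map_rungR23], rfl⟩
  | serre₄ k l r =>
    exact ⟨_, _, .serre₄ k l r, by
      simp only [Diag.map, map_neg, map_one, map_rungR12, map_rungR23], rfl⟩
  | crossing k l => exact ⟨_, _, .crossing k l, rfl, map_crossingSum φ q k l⟩
  | crossing_inv k l => exact ⟨_, _, .crossing_inv k l, rfl, map_crossingInvSum φ q k l⟩
  | merge_zero_left l => exact ⟨_, _, .merge_zero_left l, rfl, rfl⟩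
  | merge_zero_right l => exact ⟨_, _, .merge_zero_right l, rfl, rfl⟩
  | split_zero_left l => exact ⟨_, _, .split_zero_left l, rfl, rfl⟩
  | split_zero_right l => exact ⟨_, _, .split_zero_right l, rfl, rfl⟩
  | cupR_zero => exact ⟨_, _, .cupR_zero, rfl, rfl⟩
  | capR_zero => exact ⟨_, _, .capR_zero, rfl, rfl⟩
  | cupL_zero => exact ⟨_, _, .cupL_zero, rfl, rfl⟩
  | capL_zero => exact ⟨_, _, .capL_zero, rfl, rfl⟩
  | zigzag_up_R k => exact ⟨_, _, .zigzag_up_R k, rfl, rfl⟩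
  | zigzag_dn_R k => exact ⟨_, _, .zigzag_dn_R k, rfl, rfl⟩
  | zigzag_up_L k => exact ⟨_, _, .zigzag_up_L k, rfl, rfl⟩
  | zigzag_dn_L k => exact ⟨_, _, .zigzag_dn_L k, rfl, rfl⟩
  | merge_rot k l => exact ⟨_, _, .merge_rot k l, rfl, rfl⟩
  | split_rot k l => exact ⟨_, _, .split_rot k l, rfl, rfl⟩
  | merge_assoc k l r => exact ⟨_, _, .merge_assoc k l r, rfl, rfl⟩
  | split_assoc k l r => exact ⟨_, _, .split_assoc k l r, rfl, rfl⟩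

theorem UniversalRel.map (h : IsUnit ((q : R) ^ 2 - 1)) {X Y : Word} {f g : Diag R X Y}
    (hfg : UniversalRel q a X Y f g) :
    UniversalRel (Units.map φ.toMonoidHom q) (Units.map φ.toMonoidHom a) X Y
      (f.map φ) (g.map φ) := by
  cases hfg <;> simp only [Diag.map, map_aInt φ q a h]
  · exact .circleR
  · exact .circleL
  · exact .digonR
  · exact .digonL
  · exact .square
  · exact .square_mirror

theorem UniversalRel.exists_map (h : IsUnit ((q : R) ^ 2 - 1)) {X Y : Word} {f g : Diag K X Y}
    (hfg : UniversalRel (Units.map φ.toMonoidHom q) (Units.map φ.toMonoidHom a) X Y f g) :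
    ∃ f' g' : Diag R X Y, UniversalRel q a X Y f' g' ∧ f'.map φ = f ∧ g'.map φ = g := by
  cases hfg <;> rw [← map_aInt φ q a h]
  · exact ⟨_, _, .circleR, rfl, rfl⟩
  · exact ⟨_, _, .circleL, rfl, rfl⟩
  · exact ⟨_, _, .digonR, rfl, rfl⟩
  · exact ⟨_, _, .digonL, rfl, rfl⟩
  · exact ⟨_, _, .square, rfl, rfl⟩
  · exact ⟨_, _, .square_mirror, rfl, rfl⟩

end DiagMap

/-! ### Tensor products of morphisms and extension of scalars -/

theorem ofHom_comp_ofHom {R : Type u} {K : Type u'} [CommRing R] [CommRing K] [Algebra R K]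
    {C : Type v} [Category.{w} C] [Preadditive C] [Linear R C] {X Y Z : C} (f : X ⟶ Y) (g : Y ⟶ Z) :
    BaseChange.ofHom (R := R) K f ≫ BaseChange.ofHom K g = BaseChange.ofHom K (f ≫ g) :=
  (BaseChange.bcomp_tmul _ _ _ _ _ _ _).trans (by rw [one_mul]; rfl)

section TensorHom

variable {C : Type v} [Category.{w} C] [Preadditive C] [MonoidalCategory C] [MonoidalPreadditive C]

theorem zero_tensorHom {X Y X' Y' : C} (g : X' ⟶ Y') : (0 : X ⟶ Y) ⊗ₘ g = 0 := by
  simp [MonoidalCategory.tensorHom_def]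

theorem tensorHom_zero {X Y X' Y' : C} (f : X ⟶ Y) : f ⊗ₘ (0 : X' ⟶ Y') = 0 := by
  simp [MonoidalCategory.tensorHom_def]

theorem add_tensorHom {X Y X' Y' : C} (f f' : X ⟶ Y) (g : X' ⟶ Y') :
    (f + f') ⊗ₘ g = f ⊗ₘ g + f' ⊗ₘ g := by
  simp [MonoidalCategory.tensorHom_def]

theorem tensorHom_add {X Y X' Y' : C} (f : X ⟶ Y) (g g' : X' ⟶ Y') :
    f ⊗ₘ (g + g') = f ⊗ₘ g + f ⊗ₘ g' := by
  simp [MonoidalCategory.tensorHom_def]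

variable {R : Type u} [CommRing R] [Linear R C] [MonoidalLinear R C]

theorem smul_tensorHom {X Y X' Y' : C} (r : R) (f : X ⟶ Y) (g : X' ⟶ Y') :
    (r • f) ⊗ₘ g = r • (f ⊗ₘ g) := by
  simp [MonoidalCategory.tensorHom_def]

theorem tensorHom_smul {X Y X' Y' : C} (r : R) (f : X ⟶ Y) (g : X' ⟶ Y') :
    f ⊗ₘ (r • g) = r • (f ⊗ₘ g) := by
  simp [MonoidalCategory.tensorHom_def]

variable {K : Type u'} [CommRing K] [Algebra R K]

instance : MonoidalPreadditive (BaseChange R K C) where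
  whiskerLeft_zero := (BaseChange.btensor _ _ _ _ _).map_zero
  zero_whiskerRight := LinearMap.map_zero₂ (BaseChange.btensor _ _ _ _) _
  whiskerLeft_add f g := (BaseChange.btensor _ _ _ _ _).map_add f g
  add_whiskerRight f g := LinearMap.map_add₂ (BaseChange.btensor _ _ _ _) f g _

instance : MonoidalLinear K (BaseChange R K C) where
  whiskerLeft_smul _ _ _ r f := BaseChange.btensor_smul_right _ _ _ _ r _ f
  smul_whiskerRight r _ _ f _ := BaseChange.btensor_smul_left _ _ _ _ r f _

theorem ofHom_tensorHom_ofHom {X Y X' Y' : C} (f : X ⟶ Y) (g : X' ⟶ Y') :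
    BaseChange.ofHom (R := R) K f ⊗ₘ BaseChange.ofHom K g = BaseChange.ofHom K (f ⊗ₘ g) :=
  (BaseChange.btensor_tmul _ _ _ _ _ _ _ _).trans (by rw [one_mul]; rfl)

end TensorHom

/-! ### Extension of scalars of a presented category -/

section PresentedBaseChange

variable {R : Type u} {K : Type v} [CommRing R] [CommRing K] [Algebra R K]
variable (S : Relations R) (T : Relations K)

/-- A word as an object of the category with extended scalars. -/
abbrev bcObj (X : Word) : BaseChange R K (Presented S) := ⟨⟨X⟩⟩

/-- The value of a diagram over `K` in the category with extended scalars. -/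
def evalDiag : ∀ {X Y : Word}, Diag K X Y → (bcObj (K := K) S X ⟶ bcObj (K := K) S Y)
  | _, _, eqHom h => BaseChange.ofHom K (Presented.homMk S (eqHom h))
  | _, _, comp f g => evalDiag f ≫ evalDiag g
  | _, _, Diag.tensor f g => evalDiag f ⊗ₘ evalDiag g
  | _, _, zero => 0
  | _, _, add f g => evalDiag f + evalDiag g
  | _, _, smul r f => r • evalDiag f
  | _, _, braid X Y => BaseChange.ofHom K (Presented.homMk S (braid X Y))
  | _, _, braidInv X Y => BaseChange.ofHom K (Presented.homMk S (braidInv X Y))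
  | _, _, merge k l => BaseChange.ofHom K (Presented.homMk S (merge k l))
  | _, _, split k l => BaseChange.ofHom K (Presented.homMk S (split k l))
  | _, _, cupR k => BaseChange.ofHom K (Presented.homMk S (cupR k))
  | _, _, capR k => BaseChange.ofHom K (Presented.homMk S (capR k))
  | _, _, cupL k => BaseChange.ofHom K (Presented.homMk S (cupL k))
  | _, _, capL k => BaseChange.ofHom K (Presented.homMk S (capL k))

theorem evalDiag_map {X Y : Word} (f : Diag R X Y) :
    evalDiag S (f.map (algebraMap R K)) = BaseChange.ofHom K (Presented.homMk S f) := by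
  induction f with
  | comp f g hf hg =>
    rw [Diag.map, evalDiag, hf, hg]
    exact (BaseChange.bcomp_tmul _ _ _ _ _ _ _).trans (by rw [one_mul]; rfl)
  | tensor f g hf hg =>
    rw [Diag.map, evalDiag, hf, hg]
    exact (BaseChange.btensor_tmul _ _ _ _ _ _ _ _).trans (by rw [one_mul]; rfl)
  | zero => exact (TensorProduct.tmul_zero _ _).symm
  | add f g hf hg =>
    rw [Diag.map, evalDiag, hf, hg]
    exact (TensorProduct.tmul_add _ _ _).symm
  | smul r f hf =>
    rw [Diag.map, evalDiag, hf]
    change algebraMap R K r • ((1 : K) ⊗ₜ[R] (Presented.homMk S f)) =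
      (1 : K) ⊗ₜ[R] (r • Presented.homMk S f)
    rw [algebraMap_smul, TensorProduct.tmul_smul]
  | _ => rfl

variable {S T}

/-- Besides `T`, the generators of `Equivalent` are the axioms of a linear braided monoidal
category, and the category with extended scalars satisfies them. -/
theorem evalDiag_eq_of_equivalent
    (hT : ∀ X Y (f g : Diag K X Y), T X Y f g → evalDiag S f = evalDiag S g)
    {X Y : Word} {f g : Diag K X Y} (h : Equivalent T f g) : evalDiag S f = evalDiag S g := by
  induction h with
  | of h => exact hT _ _ _ _ h
  | refl f => rfl
  | symm _ ih => exact ih.symm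
  | trans _ _ ih ih' => exact ih.trans ih'
  | comp_congr _ _ ih ih' => rw [evalDiag, evalDiag, ih, ih']
  | tensor_congr _ _ ih ih' => rw [evalDiag, evalDiag, ih, ih']
  | add_congr _ _ ih ih' => rw [evalDiag, evalDiag, ih, ih']
  | smul_congr r _ ih => rw [evalDiag, evalDiag, ih]
  | add_assoc f g h => exact add_assoc _ _ _
  | add_comm f g => exact add_comm _ _
  | zero_add f => exact zero_add _
  | one_smul f => exact one_smul _ _
  | zero_smul f => exact zero_smul _ _
  | mul_smul r s f => exact mul_smul _ _ _
  | add_smul r s f => exact add_smul _ _ _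
  | smul_add r f g => exact smul_add _ _ _
  | id_comp f => exact Category.id_comp _
  | comp_id f => exact Category.comp_id _
  | comp_assoc f g h => exact Category.assoc _ _ _
  | tensor_id X Y => exact id_tensorHom_id (bcObj (K := K) S X) (bcObj (K := K) S Y)
  | tensor_comp f g f' g' => exact tensorHom_comp_tensorHom _ _ _ _
  | tensor_assoc f g h => exact associator_naturality _ _ _
  | unit_tensor f =>
    have h := leftUnitor_naturality (evalDiag S f)
    rw [← id_tensorHom] at h
    exact ((Category.comp_id _).symm.trans h).trans (Category.id_comp _)
  | tensor_unit f =>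
    have h := rightUnitor_naturality (evalDiag S f)
    rw [← tensorHom_id] at h
    exact h
  | add_comp f f' g => exact Preadditive.add_comp _ _ _ _ _ _
  | comp_add f g g' => exact Preadditive.comp_add _ _ _ _ _ _
  | smul_comp r f g => exact Linear.smul_comp _ _ _ _ _ _
  | comp_smul r f g => exact Linear.comp_smul _ _ _ _ _ _
  | add_tensor f f' g =>
    exact LinearMap.map_add₂ (BaseChange.btensor _ _ _ _) (evalDiag S f) (evalDiag S f') _
  | tensor_add f g g' =>
    exact (BaseChange.btensor _ _ _ _ (evalDiag S f)).map_add (evalDiag S g) (evalDiag S g')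
  | smul_tensor r f g => exact BaseChange.btensor_smul_left _ _ _ _ r (evalDiag S f) (evalDiag S g)
  | tensor_smul r f g => exact BaseChange.btensor_smul_right _ _ _ _ r (evalDiag S f) (evalDiag S g)
  | braid_braidInv X Y => exact (β_ (bcObj (K := K) S X) (bcObj (K := K) S Y)).hom_inv_id
  | braidInv_braid X Y => exact (β_ (bcObj (K := K) S X) (bcObj (K := K) S Y)).inv_hom_id
  | braid_naturality f g => exact BraidedCategory.braiding_naturality _ _
  | hexagon_forward X Y Z =>
    have h := BraidedCategory.hexagon_forward (bcObj (K := K) S X) (bcObj S Y) (bcObj S Z)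
    rw [← id_tensorHom, ← tensorHom_id] at h
    exact h
  | hexagon_reverse X Y Z =>
    have h := BraidedCategory.hexagon_reverse (bcObj (K := K) S X) (bcObj S Y) (bcObj S Z)
    rw [← id_tensorHom, ← tensorHom_id] at h
    exact h

theorem equivalent_map
    (hS : ∀ X Y (f g : Diag R X Y), S X Y f g →
      Equivalent T (f.map (algebraMap R K)) (g.map (algebraMap R K)))
    {X Y : Word} {f g : Diag R X Y} (h : Equivalent S f g) :
    Equivalent T (f.map (algebraMap R K)) (g.map (algebraMap R K)) := by
  induction h with
  | of h => exact hS _ _ _ _ h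
  | refl f => exact .refl _
  | symm _ ih => exact ih.symm
  | trans _ _ ih ih' => exact ih.trans ih'
  | comp_congr _ _ ih ih' => exact .comp_congr ih ih'
  | tensor_congr _ _ ih ih' => exact .tensor_congr ih ih'
  | add_congr _ _ ih ih' => exact .add_congr ih ih'
  | smul_congr r _ ih => exact .smul_congr _ ih
  | add_assoc f g h => exact .add_assoc _ _ _
  | add_comm f g => exact .add_comm _ _
  | zero_add f => exact .zero_add _
  | one_smul f => rw [Diag.map, map_one]; exact .one_smul _
  | zero_smul f => simp only [Diag.map, _root_.map_zero]; exact .zero_smul _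
  | mul_smul r s f => rw [Diag.map, map_mul]; exact .mul_smul _ _ _
  | add_smul r s f => simp only [Diag.map, _root_.map_add]; exact .add_smul _ _ _
  | smul_add r f g => exact .smul_add _ _ _
  | id_comp f => exact .id_comp _
  | comp_id f => exact .comp_id _
  | comp_assoc f g h => exact .comp_assoc _ _ _
  | tensor_id X Y => exact .tensor_id _ _
  | tensor_comp f g f' g' => exact .tensor_comp _ _ _ _
  | tensor_assoc f g h => exact .tensor_assoc _ _ _
  | unit_tensor f => exact .unit_tensor _
  | tensor_unit f => exact .tensor_unit _
  | add_comp f f' g => exact .add_comp _ _ _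
  | comp_add f g g' => exact .comp_add _ _ _
  | smul_comp r f g => exact .smul_comp _ _ _
  | comp_smul r f g => exact .comp_smul _ _ _
  | add_tensor f f' g => exact .add_tensor _ _ _
  | tensor_add f g g' => exact .tensor_add _ _ _
  | smul_tensor r f g => exact .smul_tensor _ _ _
  | tensor_smul r f g => exact .tensor_smul _ _ _
  | braid_braidInv X Y => exact .braid_braidInv _ _
  | braidInv_braid X Y => exact .braidInv_braid _ _
  | braid_naturality f g => exact .braid_naturality _ _
  | hexagon_forward X Y Z => exact .hexagon_forward _ _ _
  | hexagon_reverse X Y Z => exact .hexagon_reverse _ _ _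

variable (hS : ∀ X Y (f g : Diag R X Y), S X Y f g →
      Equivalent T (f.map (algebraMap R K)) (g.map (algebraMap R K)))

/-- The map on morphisms induced by the change of coefficients in diagrams. -/
def mapHom (X Y : Word) : ((⟨X⟩ : Presented S) ⟶ ⟨Y⟩) →+ ((⟨X⟩ : Presented T) ⟶ ⟨Y⟩) where
  toFun := Quotient.map (Diag.map (algebraMap R K)) fun _ _ h => equivalent_map hS h
  map_zero' := rfl
  map_add' f g := by
    obtain ⟨f, rfl⟩ := Presented.cls_surj f
    obtain ⟨g, rfl⟩ := Presented.cls_surj g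
    rfl

/-- The balancing condition under which `s ⊗ f ↦ s • f` is well defined on the tensor product over
`R`. -/
theorem mapHom_smul {X Y : Word} (r : R) (f : (⟨X⟩ : Presented S) ⟶ ⟨Y⟩) :
    mapHom hS X Y (r • f) = algebraMap R K r • mapHom hS X Y f := by
  obtain ⟨f, rfl⟩ := Presented.cls_surj f
  rfl

/-- `s ⊗ f ↦ s • f`. -/
def baseChangeHom (X Y : Word) :
    (bcObj (K := K) S X ⟶ bcObj (K := K) S Y) →+ ((⟨X⟩ : Presented T) ⟶ ⟨Y⟩) :=
  TensorProduct.liftAddHom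
    ((AddMonoidHom.mk' (fun s : K => (DistribSMul.toAddMonoidHom
      ((⟨X⟩ : Presented T) ⟶ ⟨Y⟩) s).comp (mapHom hS X Y))
      fun s t => by ext f; exact add_smul s t _))
    fun r s f => by
      change (r • s) • mapHom hS X Y f = s • mapHom hS X Y (r • f)
      rw [mapHom_smul, Algebra.smul_def, mul_smul, smul_comm]

theorem baseChangeHom_tmul {X Y : Word} (s : K) (f : (⟨X⟩ : Presented S) ⟶ ⟨Y⟩) :
    baseChangeHom hS X Y (s ⊗ₜ[R] f) = s • mapHom hS X Y f := rfl

theorem baseChangeHom_ofHom {X Y : Word} (f : Diag R X Y) :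
    baseChangeHom hS X Y (BaseChange.ofHom K (Presented.homMk S f)) =
      Presented.homMk T (f.map (algebraMap R K)) :=
  (baseChangeHom_tmul hS 1 _).trans (one_smul _ _)

/-- Pure tensors are `s • (1 ⊗ f)` with `f` represented by a diagram, and they span. -/
theorem baseChange_induction {X Y : Word} {p : (bcObj (K := K) S X ⟶ bcObj (K := K) S Y) → Prop}
    (zero : p 0) (add : ∀ f g, p f → p g → p (f + g))
    (smul : ∀ (s : K) (f : Diag R X Y), p (s • BaseChange.ofHom K (Presented.homMk S f)))
    (f : bcObj (K := K) S X ⟶ bcObj (K := K) S Y) : p f := by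
  refine TensorProduct.induction_on (motive := p) f zero (fun s g => ?_) add
  obtain ⟨g, rfl⟩ := Presented.cls_surj g
  have e : s • BaseChange.ofHom K (Presented.homMk S g) =
      (s ⊗ₜ[R] Presented.cls S g : K ⊗[R] ((⟨X⟩ : Presented S) ⟶ ⟨Y⟩)) := by
    refine (TensorProduct.smul_tmul' s (1 : K) (Presented.homMk S g)).trans ?_
    rw [smul_eq_mul, mul_one]
    rfl
  exact e ▸ smul s g

theorem baseChangeHom_smul_ofHom {X Y : Word} (s : K) (f : Diag R X Y) :
    baseChangeHom hS X Y (s • BaseChange.ofHom K (Presented.homMk S f)) =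
      s • Presented.homMk T (f.map (algebraMap R K)) := by
  have e : s • BaseChange.ofHom K (Presented.homMk S f) =
      (s ⊗ₜ[R] Presented.homMk S f : K ⊗[R] ((⟨X⟩ : Presented S) ⟶ ⟨Y⟩)) := by
    refine (TensorProduct.smul_tmul' s (1 : K) (Presented.homMk S f)).trans ?_
    rw [smul_eq_mul, mul_one]
  exact (congrArg (baseChangeHom hS X Y) e).trans (baseChangeHom_tmul hS s _)

theorem baseChangeHom_smul {X Y : Word} (r : K) (f : bcObj (K := K) S X ⟶ bcObj S Y) :
    baseChangeHom hS X Y (r • f) = r • baseChangeHom hS X Y f := by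
  induction f using baseChange_induction with
  | zero => rw [smul_zero, map_zero, smul_zero]
  | add f g hf hg => rw [smul_add, map_add, map_add, hf, hg, smul_add]
  | smul s f => rw [smul_smul, baseChangeHom_smul_ofHom, baseChangeHom_smul_ofHom, smul_smul]

theorem baseChangeHom_comp {X Y Z : Word} (f : bcObj (K := K) S X ⟶ bcObj S Y)
    (g : bcObj (K := K) S Y ⟶ bcObj S Z) :
    baseChangeHom hS X Z (f ≫ g) = baseChangeHom hS X Y f ≫ baseChangeHom hS Y Z g := by
  induction f using baseChange_induction with
  | zero => rw [Limits.zero_comp, map_zero, map_zero, Limits.zero_comp]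
  | add f f' hf hf' =>
    rw [Preadditive.add_comp, map_add, map_add, hf, hf', Preadditive.add_comp]
  | smul s f =>
    induction g using baseChange_induction with
    | zero => rw [Limits.comp_zero, map_zero, map_zero, Limits.comp_zero]
    | add g g' hg hg' =>
      rw [Preadditive.comp_add, map_add, map_add, hg, hg', Preadditive.comp_add]
    | smul t g =>
      rw [Linear.smul_comp, Linear.comp_smul, baseChangeHom_smul, baseChangeHom_smul,
        baseChangeHom_smul, baseChangeHom_smul, Linear.smul_comp, Linear.comp_smul,
        baseChangeHom_ofHom, baseChangeHom_ofHom]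
      refine congrArg (s • ·) (congrArg (t • ·) ?_)
      exact (congrArg _ (ofHom_comp_ofHom (Presented.homMk S f) (Presented.homMk S g))).trans
        (baseChangeHom_ofHom hS (comp f g))

theorem baseChangeHom_tensor {X Y X' Y' : Word} (f : bcObj (K := K) S X ⟶ bcObj S Y)
    (g : bcObj (K := K) S X' ⟶ bcObj S Y') :
    baseChangeHom hS (X ++ X') (Y ++ Y') (f ⊗ₘ g) =
      (baseChangeHom hS X Y f ⊗ₘ baseChangeHom hS X' Y' g) := by
  induction f using baseChange_induction with
  | zero =>
    rw [zero_tensorHom, map_zero (baseChangeHom hS X Y), zero_tensorHom]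
    exact map_zero (baseChangeHom hS _ _)
  | add f f' hf hf' =>
    rw [add_tensorHom, map_add (baseChangeHom hS X Y), add_tensorHom, ← hf, ← hf']
    exact map_add (baseChangeHom hS _ _) _ _
  | smul s f =>
    induction g using baseChange_induction with
    | zero =>
      rw [tensorHom_zero, map_zero (baseChangeHom hS X' Y'), tensorHom_zero]
      exact map_zero (baseChangeHom hS _ _)
    | add g g' hg hg' =>
      rw [tensorHom_add, map_add (baseChangeHom hS X' Y'), tensorHom_add, ← hg, ← hg']
      exact map_add (baseChangeHom hS _ _) _ _
    | smul t g =>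
      rw [smul_tensorHom, tensorHom_smul, baseChangeHom_smul_ofHom, baseChangeHom_smul_ofHom,
        smul_tensorHom, tensorHom_smul]
      refine (baseChangeHom_smul hS s _).trans (congrArg (s • ·)
        ((baseChangeHom_smul hS t _).trans (congrArg (t • ·) ?_)))
      exact (congrArg _ (ofHom_tensorHom_ofHom (Presented.homMk S f) (Presented.homMk S g))).trans
        (baseChangeHom_ofHom hS (Diag.tensor f g))

/-- Both maps respect all operations and fix the generators, so the composite is the identity on
diagrams. -/
theorem baseChangeHom_evalDiag {X Y : Word} (f : Diag K X Y) :
    baseChangeHom hS X Y (evalDiag S f) = Presented.homMk T f := by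
  induction f with
  | comp f g hf hg => rw [evalDiag, baseChangeHom_comp, hf, hg]; rfl
  | tensor f g hf hg => rw [evalDiag, baseChangeHom_tensor, hf, hg]; rfl
  | zero => exact map_zero _
  | add f g hf hg => rw [evalDiag, map_add, hf, hg]; rfl
  | smul r f hf => rw [evalDiag, baseChangeHom_smul, hf]; rfl
  | _ => exact baseChangeHom_ofHom hS _

variable (hT : ∀ X Y (f g : Diag K X Y), T X Y f g → evalDiag S f = evalDiag S g)

/-- Extension of scalars commutes with presentations. -/
def baseChangeEquiv (X Y : Word) :
    ((⟨X⟩ : Presented T) ⟶ ⟨Y⟩) ≃ₗ[K] (bcObj (K := K) S X ⟶ bcObj (K := K) S Y) where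
  toFun := Quotient.lift (evalDiag S) fun _ _ h => evalDiag_eq_of_equivalent hT h
  map_add' f g := by
    obtain ⟨f, rfl⟩ := Presented.cls_surj f
    obtain ⟨g, rfl⟩ := Presented.cls_surj g
    rfl
  map_smul' r f := by
    obtain ⟨f, rfl⟩ := Presented.cls_surj f
    rfl
  invFun := baseChangeHom hS X Y
  left_inv f := by
    obtain ⟨f, rfl⟩ := Presented.cls_surj f
    exact baseChangeHom_evalDiag hS f
  right_inv f := by
    induction f using baseChange_induction with
    | zero => rw [map_zero]; rfl
    | add f g hf hg =>
      rw [map_add]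
      nth_rw 2 [← hf, ← hg]
      -- On representatives the evaluation is additive by definition.
      obtain ⟨f', h⟩ := Presented.cls_surj (baseChangeHom hS X Y f)
      obtain ⟨g', h'⟩ := Presented.cls_surj (baseChangeHom hS X Y g)
      rw [← h, ← h']
      rfl
    | smul s f =>
      rw [baseChangeHom_smul_ofHom, ← evalDiag_map]
      rfl

end PresentedBaseChange

/-! ### Specialization of the universal category -/

theorem isUnit_univQ_sq_sub_one : IsUnit ((univQ : UnivRing) ^ 2 - 1) := by
  have h := isUnit_univ
  rw [map_mul] at h
  have h' := isUnit_of_mul_isUnit_right h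
  rwa [map_sub, map_pow, map_one] at h'

section Specialization

variable {K : Type v} [CommRing K] [Algebra (RatFunc ℚ) K]
variable (x : ℚ) (ν : K) (hν : ν ^ 2 * algebraMap (RatFunc ℚ) K (qDelta x) = 1)

theorem map_specialize_univQ :
    Units.map (specialize x ν hν).toMonoidHom univQ = qUnit K :=
  Units.ext (specialize_q x ν hν)

theorem map_specialize_univA :
    Units.map (specialize x ν hν).toMonoidHom univA = aUnit x ν hν :=
  Units.ext (specialize_a x ν hν)

/-- The defining relations of the universal category. -/
abbrev univRel : Relations UnivRing := fun X Y f g =>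
  BasicRel univQ X Y f g ∨ UniversalRel univQ univA X Y f g

/-- The defining relations of the category presented at `x`. -/
abbrev presRel : Relations K := fun X Y f g =>
  BasicRel (qUnit K) X Y f g ∨
    MixedRel (circleValue x ν) (digonValue x ν) (squareValue x ν) X Y f g

theorem univRel.equivalent_map {X Y : Word} {f g : Diag UnivRing X Y} (h : univRel X Y f g) :
    Equivalent (presRel x ν) (f.map (specialize x ν hν)) (g.map (specialize x ν hν)) := by
  rcases h with h | h
  · have h' := h.map (specialize x ν hν) univQ isUnit_univQ_sq_sub_one
    rw [map_specialize_univQ] at h'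
    exact .of (.inl h')
  · have h' := h.map (specialize x ν hν) univQ univA isUnit_univQ_sq_sub_one
    rw [map_specialize_univQ, map_specialize_univA] at h'
    exact .of (.inr (mixedRel_of_universalRel x ν hν h'))

theorem specRel.exists_univRel {X Y : Word} {f g : Diag K X Y} (h : specRel x ν hν X Y f g) :
    ∃ f' g' : Diag UnivRing X Y, univRel X Y f' g' ∧
      f'.map (specialize x ν hν) = f ∧ g'.map (specialize x ν hν) = g := by
  rcases h with h | h
  · rw [← map_specialize_univQ x ν hν] at h
    obtain ⟨f', g', h', e, e'⟩ := h.exists_map (specialize x ν hν) univQ isUnit_univQ_sq_sub_one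
    exact ⟨f', g', .inl h', e, e'⟩
  · rw [← map_specialize_univQ x ν hν, ← map_specialize_univA x ν hν] at h
    obtain ⟨f', g', h', e, e'⟩ :=
      h.exists_map (specialize x ν hν) univQ univA isUnit_univQ_sq_sub_one
    exact ⟨f', g', .inr h', e, e'⟩

/-- A relation with arbitrary labels is first derived from `specRel`; each relation of `specRel`
then lifts to `univRel`, where it holds before the extension of scalars. -/
theorem evalDiag_eq_of_presRel {X Y : Word} {f g : Diag K X Y} (h : presRel x ν X Y f g) :
    letI := specAlgebra x ν hν
    evalDiag univRel f = evalDiag univRel g := by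
  let _ := specAlgebra x ν hν
  have h' : Equivalent (specRel x ν hν) f g := by
    rcases h with h | h
    · exact .of (.inl h)
    · exact equivalent_of_mixedRel x ν hν h
  refine evalDiag_eq_of_equivalent (fun X Y f g h => ?_) h'
  obtain ⟨f', g', h₀, rfl, rfl⟩ := specRel.exists_univRel x ν hν h
  exact ((evalDiag_map univRel f').trans
    (congrArg (BaseChange.ofHom K) (Presented.sound (.of h₀)))).trans (evalDiag_map univRel g').symm

end Specialization

end Web

end

/-! ### The isomorphism and the removal of crossings -/

theorem mainTheorem1 {K : Type*} [CommRing K] [Algebra (RatFunc ℚ) K] (x : ℚ) (ν : K)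
    (hν : ν ^ 2 * algebraMap (RatFunc ℚ) K (Web.qDelta x) = 1) :
    ∃ Φ : ∀ X Y : Web.Word,
        (Web.XWeb.of x ν hν X ⟶ Web.XWeb.of x ν hν Y) ≃ₗ[K]
          (Web.XWebPresented.of x ν X ⟶ Web.XWebPresented.of x ν Y),
      (∀ X, Φ X X (𝟙 _) = 𝟙 _) ∧
      (∀ (X Y Z : Web.Word) (f : Web.XWeb.of x ν hν X ⟶ Web.XWeb.of x ν hν Y)
        (g : Web.XWeb.of x ν hν Y ⟶ Web.XWeb.of x ν hν Z),
        Φ X Z (f ≫ g) = Φ X Y f ≫ Φ Y Z g) ∧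
      (∀ (X Y X' Y' : Web.Word) (f : Web.XWeb.of x ν hν X ⟶ Web.XWeb.of x ν hν Y)
        (g : Web.XWeb.of x ν hν X' ⟶ Web.XWeb.of x ν hν Y'),
        Φ (X ++ X') (Y ++ Y') (f ⊗ₘ g) = Φ X Y f ⊗ₘ Φ X' Y' g) ∧
      (∀ X Y : Web.Word,
        Φ (X ++ Y) (Y ++ X) (β_ (Web.XWeb.of x ν hν X) (Web.XWeb.of x ν hν Y)).hom =
          (β_ (Web.XWebPresented.of x ν X) (Web.XWebPresented.of x ν Y)).hom) ∧
      (∀ k l : ℕ,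
        Φ _ _ (Web.XWeb.ofDiag x ν hν (.merge k l)) = Web.XWebPresented.ofDiag x ν (.merge k l) ∧
        Φ _ _ (Web.XWeb.ofDiag x ν hν (.split k l)) = Web.XWebPresented.ofDiag x ν (.split k l)) ∧
      (∀ k : ℕ,
        Φ _ _ (Web.XWeb.ofDiag x ν hν (.cupR k)) = Web.XWebPresented.ofDiag x ν (.cupR k) ∧
        Φ _ _ (Web.XWeb.ofDiag x ν hν (.capR k)) = Web.XWebPresented.ofDiag x ν (.capR k) ∧
        Φ _ _ (Web.XWeb.ofDiag x ν hν (.cupL k)) = Web.XWebPresented.ofDiag x ν (.cupL k) ∧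
        Φ _ _ (Web.XWeb.ofDiag x ν hν (.capL k)) = Web.XWebPresented.ofDiag x ν (.capL k)) ∧
      (∀ k l : ℕ,
        (β_ (Web.XWebPresented.of x ν (Web.up k)) (Web.XWebPresented.of x ν (Web.up l))).hom =
            Web.XWebPresented.ofDiag x ν (Web.crossingSum (Web.qUnit K) k l) ∧
          (β_ (Web.XWebPresented.of x ν (Web.up l)) (Web.XWebPresented.of x ν (Web.up k))).inv =
            Web.XWebPresented.ofDiag x ν (Web.crossingInvSum (Web.qUnit K) k l)) ∧
      (∀ (X Y : Web.Word) (f : Web.XWebPresented.of x ν X ⟶ Web.XWebPresented.of x ν Y),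
        ∃ w : Web.Diag K X Y, w.IsWeb ∧ Web.XWebPresented.ofDiag x ν w = f) := by

  let _ := Web.specAlgebra x ν hν
  have hS : ∀ X Y (f g : Web.Diag Web.UnivRing X Y), Web.univRel X Y f g →
      Web.Equivalent (Web.presRel x ν) (f.map (algebraMap Web.UnivRing K))
        (g.map (algebraMap Web.UnivRing K)) :=
    fun _ _ _ _ h => h.equivalent_map x ν hν
  have hT : ∀ X Y (f g : Web.Diag K X Y), Web.presRel x ν X Y f g →
      Web.evalDiag Web.univRel f = Web.evalDiag Web.univRel g :=
    fun _ _ _ _ h => Web.evalDiag_eq_of_presRel x ν hν h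
  have hB : Web.HasBasic (Web.presRel x ν) (Web.qUnit K) := fun _ _ _ _ h => .inl h
  -- The inverse of `baseChangeEquiv` is `baseChangeHom`, whose compatibility with composition and
  -- tensor product is known; on generators it acts by specializing the diagram.
  refine ⟨fun X Y => (Web.baseChangeEquiv hS hT X Y).symm, fun X => ?_, fun X Y Z f g => ?_,
    fun X Y X' Y' f g => ?_, fun X Y => ?_, fun k l => ⟨?_, ?_⟩, fun k => ⟨?_, ?_, ?_, ?_⟩,
    fun k l => ⟨?_, ?_⟩, fun X Y f => ?_⟩
  · exact Web.baseChangeHom_ofHom hS (Web.Diag.idd X)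
  · exact Web.baseChangeHom_comp hS f g
  · exact Web.baseChangeHom_tensor hS f g
  · exact Web.baseChangeHom_ofHom hS (.braid X Y)
  · exact Web.baseChangeHom_ofHom hS (.merge k l)
  · exact Web.baseChangeHom_ofHom hS (.split k l)
  · exact Web.baseChangeHom_ofHom hS (.cupR k)
  · exact Web.baseChangeHom_ofHom hS (.capR k)
  · exact Web.baseChangeHom_ofHom hS (.cupL k)
  · exact Web.baseChangeHom_ofHom hS (.capL k)
  -- The formulas for the upward crossings are themselves defining relations.
  · exact Web.Presented.sound (.of (.inl (.crossing k l)))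
  · exact Web.Presented.sound (.of (.inl (.crossing_inv k l)))
  · obtain ⟨f, rfl⟩ := Web.Presented.cls_surj f
    obtain ⟨w, hw, e⟩ := (hB.hasWeb f).exists_isWeb
    exact ⟨w, hw, Web.Presented.sound (Web.Mor.equivalent_of_eq e)⟩
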